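/- Let $1<p<\infty$, $q=\frac{p}{p-1}$, $0\le m<M$, let $I=[l,r)$ be a bounded interval with $l<r$, and for a dyadic subinterval $J$ of $I$ let $D(J)$ be the family of all dyadic subintervals of $J$ ($J$ included). For $x=(x_1,x_2,x_3)$ consider all triples $(\varphi,\mu,(\alpha_J)_{J\in D(I)})$ consisting of a measurable function $\varphi\ge 0$ on $I$, a non-negative measure $\mu$ without atoms and numbers $\alpha_J\ge0$ such that, with $\langle f\rangle_J=\frac1{|J|}\int_J f\,dt$, $$\langle\varphi\rangle_I=x_1,\quad \langle\varphi^p\rangle_I=x_2,\quad \frac1{|I|}\Bigl(\mu(I)+\sum_{J\in D(I)}\alpha_J\Bigr)=x_3,\quad m|J|\le\mu(J)+\sum_{\ell\in D(J)}\alpha_\ell\le M|J|\ \ \text{for all } J\in D(I).$$ Let $\mathbf B_{\max}(x;m,M)$ and $\mathbf B_{\min}(x;m,M)$ be the supremum and the infimum, over these triples, of $$\frac1{|I|}\Bigl(\int_I\varphi^p\,d\mu+\sum_{J\in D(I)}\langle\varphi\rangle_J^p\,\alpha_J\Bigr).$$ For a real parameter $a$ put $$B(x;m,M)=\frac{(x_3-m)\,x_2}{\bigl|1-q(M-m)\,a|a|^{p-2}\bigr|^p\,\bigl(1-pq(M-x_3)\,a|a|^{p-2}\bigr)}+m\,x_2$$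 (with $a|a|^{p-2}=0$ for $a=0$), and consider the equation $$\frac{x_1^p}{x_2}=\left|\frac{a-q(M-x_3)|a|^p}{a-q(M-m)|a|^p}\right|^p\,\frac{a-pq(M-m)|a|^p}{a-pq(M-x_3)|a|^p},\qquad(*)$$ whose right-hand side is understood as its limit value $1$ at $a=0$. **Theorem.** Let $x_1>0$, $x_1^p\le x_2$ and $m\le x_3\le M$. 1. If $m<x_3\le M$, then $(*)$ has a unique solution $a=a^+(x)$ in $\bigl[0,\bigl(\tfrac1{pq(M-m)}\bigr)^{q-1}\bigr]$, and $\mathbf B_{\max}(x;m,M)=B(x;m,M)$ with $a=a^+(x)$. If $x_3=m$, then $\mathbf B_{\max}(x;m,M)=m\,x_2$. 2. The condition $x_3>M-(M-m)\,x_1^q/x_2^{q-1}$ is equivalent to $(M-x_3)^{p-1}x_2<(M-m)^{p-1}x_1^p$. If it holds, then $(*)$ has a unique solution $a=a^-(x)$ in $(-\infty,0]$, and $\mathbf B_{\min}(x;m,M)=B(x;m,M)$ with $a=a^-(x)$. If $m\le x_3\le M-(M-m)\,x_1^q/x_2^{q-1}$, then $\mathbf B_{\min}(x;m,M)=m\,x_2$.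 Moreover, $\mathbf B_{\max}(0,0,x_3;m,M)=\mathbf B_{\min}(0,0,x_3;m,M)=0$ for $m\le x_3\le M$. -/

import Mathlib

open MeasureTheory Set
open scoped ENNReal NNReal

noncomputable section

/-- Indices of the dyadic subintervals of an interval: the generation `n` and the position
`k < 2 ^ n` inside the generation. The interval itself has index `⟨0, 0⟩`. -/
abbrev DyadicIndex : Type := Σ n : ℕ, Fin (2 ^ n)

/-- The dyadic subinterval of `I = [l, r)` with index `J = ⟨n, k⟩`, of length `(r - l) / 2 ^ n`. -/
def dyadicInterval (l r : ℝ) (J : DyadicIndex) : Set ℝ :=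
  Ico (l + (J.2 : ℕ) * ((r - l) / 2 ^ J.1)) (l + ((J.2 : ℕ) + 1) * ((r - l) / 2 ^ J.1))

/-- The mass `μ(J) + ∑_{ℓ ∈ D(J)} α_ℓ`, where `D(J)` is the family of the dyadic subintervals
of `J`, the interval `J` included. -/
def carlesonMass (l r : ℝ) (μ : Measure ℝ) (α : DyadicIndex → ℝ≥0) (J : DyadicIndex) : ℝ≥0∞ :=
  μ (dyadicInterval l r J) +
    ∑' ℓ : {ℓ : DyadicIndex // dyadicInterval l r ℓ ⊆ dyadicInterval l r J}, (α ℓ.1 : ℝ≥0∞)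

/-- The triples (non-negative test function `φ`, measure `μ` without atoms, non-negative numbers
`α_J`) over which the Bellman functions on `I = [l, r)` are optimized. Averages are with respect
to Lebesgue measure. -/
structure IsBellmanAdmissible (p m M l r x₁ x₂ x₃ : ℝ)
    (φ : ℝ → ℝ≥0) (μ : Measure ℝ) (α : DyadicIndex → ℝ≥0) : Prop where
  measurable : Measurable φ
  noAtoms : ∀ t : ℝ, μ {t} = 0
  average : ⨍⁻ t in Ico l r, (φ t : ℝ≥0∞) ∂volume = ENNReal.ofReal x₁
  average_pow : ⨍⁻ t in Ico l r, (φ t : ℝ≥0∞) ^ p ∂volume = ENNReal.ofReal x₂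
  mass : (μ (Ico l r) + ∑' J : DyadicIndex, (α J : ℝ≥0∞)) / volume (Ico l r) = ENNReal.ofReal x₃
  lower_le : ∀ J : DyadicIndex,
    ENNReal.ofReal m * volume (dyadicInterval l r J) ≤ carlesonMass l r μ α J
  le_upper : ∀ J : DyadicIndex,
    carlesonMass l r μ α J ≤ ENNReal.ofReal M * volume (dyadicInterval l r J)

/-- The quantity `|I|⁻¹ (∫_I φ ^ p dμ + ∑_{J ∈ D(I)} ⟨φ⟩_J ^ p α_J)` for `I = [l, r)`. -/
def carlesonFunctional (p l r : ℝ) (φ : ℝ → ℝ≥0) (μ : Measure ℝ) (α : DyadicIndex → ℝ≥0) :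
    ℝ≥0∞ :=
  ((∫⁻ t in Ico l r, (φ t : ℝ≥0∞) ^ p ∂μ) +
    ∑' J : DyadicIndex, (⨍⁻ t in dyadicInterval l r J, (φ t : ℝ≥0∞) ∂volume) ^ p * (α J : ℝ≥0∞)) /
      volume (Ico l r)

/-- The values of the functional on all admissible triples. -/
def bellmanValues (p m M l r x₁ x₂ x₃ : ℝ) : Set ℝ≥0∞ :=
  {v | ∃ (φ : ℝ → ℝ≥0) (μ : Measure ℝ) (α : DyadicIndex → ℝ≥0),
    IsBellmanAdmissible p m M l r x₁ x₂ x₃ φ μ α ∧ v = carlesonFunctional p l r φ μ α}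

/-- The upper Bellman function (with values in `[0, ∞]`). -/
def upperBellman (p m M l r x₁ x₂ x₃ : ℝ) : ℝ≥0∞ := sSup (bellmanValues p m M l r x₁ x₂ x₃)

/-- The lower Bellman function (with values in `[0, ∞]`, equal to `∞` if nothing is admissible). -/
def lowerBellman (p m M l r x₁ x₂ x₃ : ℝ) : ℝ≥0∞ := sInf (bellmanValues p m M l r x₁ x₂ x₃)

/-- The right-hand side `s(a)` of the equation for the root `a`; at `a = 0`, where the displayed
quotients are `0 / 0`, it is given its limit value `1`. -/
def rootRatio (p q m M x₃ a : ℝ) : ℝ :=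
  if a = 0 then 1 else
    |(a - q * (M - x₃) * |a| ^ p) / (a - q * (M - m) * |a| ^ p)| ^ p *
      ((a - p * q * (M - m) * |a| ^ p) / (a - p * q * (M - x₃) * |a| ^ p))

/-- `a` is a root `a⁺`: it solves the equation and `0 ≤ a ≤ (1 / (p q (M - m))) ^ (q - 1)`. -/
def IsUpperRoot (p q m M x₁ x₂ x₃ a : ℝ) : Prop :=
  a ∈ Icc 0 ((1 / (p * q * (M - m))) ^ (q - 1)) ∧ |x₁| ^ p / x₂ = rootRatio p q m M x₃ a

/-- `a` is a root `a⁻`: it solves the equation and `a ≤ 0`. -/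
def IsLowerRoot (p q m M x₁ x₂ x₃ a : ℝ) : Prop :=
  a ≤ 0 ∧ |x₁| ^ p / x₂ = rootRatio p q m M x₃ a

/-- The explicit function `B(x; m, M)`, written with the parameter `a`. -/
def bellmanFormula (p q m M x₂ x₃ a : ℝ) : ℝ :=
  (x₃ - m) * x₂ /
      (|1 - q * (M - m) * (a * |a| ^ (p - 2))| ^ p *
        (1 - p * q * (M - x₃) * (a * |a| ^ (p - 2)))) + m * x₂

end

/-! Put `w = (M - x₃) / (M - m)` and `v = q (M - m) a |a| ^ (p - 2)`. In these variables the
equation for the root reads `scaledRatio p w v = x₁ ^ p / x₂`. The function increases strictly on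
`(-∞, 0]`, from the limit `w ^ (p - 1)` to `1`, and decreases strictly on `[0, 1 / p]`, from `1` to
`0`. This gives existence and uniqueness of both roots and the threshold for the lower one.

Bounds. Let `N` be the normalised excess of the Carleson mass over `m |J|`, so that `0 ≤ N ≤ 1`. For
every `v < 1` the function `x ^ p (1 - v (1 - N)) ^ (1 - p)` is convex in `(x, N)`, being a
perspective of the power function. Removing a coefficient `α` from `N` raises it by at least `(p -
1) v α x ^ p`. Summation over the dyadic tree (`bellman_induction_terminal`) and passage to the
limit (`IsBellmanAdmissible.exists_value`) give, for the value `F` of the functional, `(p - 1) v (F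
- m x₂) / (M - m) ≤ (1 - v) ^ (1 - p) x₂ - x₁ ^ p (1 - v w) ^ (1 - p)`. This bounds `F` from above
for `v > 0` and from below for `v < 0`. For `v ≠ 0` the root equation is the critical point equation
of the resulting bound as a function of `v`, and there the bound equals the stated formula
(`root_identity`). If `v = 0` is the root, both sides vanish at `0`, and comparison of derivatives
there determines `F`.

Sharpness. With `m = 0`, `M = 1`, `μ = 0`, data on the two halves of an interval can be glued and a
coefficient added at the root. A self-similar construction of this kind produces the extremal points
with full mass (`closure_attained_selfSimilar`). Mixing them with a constant function that carries
no mass gives the remaining points (`mem_closure_attained_of_root`), as limits of values.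

Below the threshold of the lower function there is room for a test function supported where `μ` has
its least density `m`, which gives `m x₂`. This is always a lower bound, since `μ` itself dominates
`m` times Lebesgue measure on dyadic intervals (`le_measure_dyadicIco`). -/

/-! ### The equation for the root -/

/-- The right-hand side of the equation for the root in the variable `v = q (M - m) a |a| ^ (p - 2)`,
with `w = (M - x₃) / (M - m)`. -/
noncomputable def scaledRatio (p w v : ℝ) : ℝ :=
  ((1 - w * v) / (1 - v)) ^ p * ((1 - p * v) / (1 - p * w * v))

/-- The logarithm of `scaledRatio`. -/
noncomputable def logRatio (p w v : ℝ) : ℝ :=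
  p * Real.log (1 - w * v) - p * Real.log (1 - v) + Real.log (1 - p * v) -
    Real.log (1 - p * w * v)

section Root

variable {p w : ℝ}

lemma one_sub_pos_of_mul_lt_one {v : ℝ} (hp : 1 < p) (hw0 : 0 ≤ w) (hw1 : w ≤ 1)
    (hv : p * v < 1) :
    0 < 1 - v ∧ 0 < 1 - p * v ∧ 0 < 1 - w * v ∧ 0 < 1 - p * w * v := by
  rcases le_total 0 v with h | h
  · have h1 : v ≤ p * v := by nlinarith
    have h2 : w * v ≤ v := by nlinarith
    have h3 : p * w * v ≤ p * v := by nlinarith [mul_nonneg (by linarith : 0 ≤ p) h]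
    refine ⟨?_, ?_, ?_, ?_⟩ <;> linarith
  · have h2 : w * v ≤ 0 := mul_nonpos_of_nonneg_of_nonpos hw0 h
    have h3 : p * w * v ≤ 0 := mul_nonpos_of_nonneg_of_nonpos (by positivity) h
    refine ⟨?_, ?_, ?_, ?_⟩ <;> linarith

lemma scaledRatio_eq_exp {v : ℝ} (hp : 1 < p) (hw0 : 0 ≤ w) (hw1 : w ≤ 1) (hv : p * v < 1) :
    scaledRatio p w v = Real.exp (logRatio p w v) := by
  obtain ⟨h1, h2, h3, h4⟩ := one_sub_pos_of_mul_lt_one hp hw0 hw1 hv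
  have : logRatio p w v = Real.log ((1 - w * v) / (1 - v)) * p
      + Real.log ((1 - p * v) / (1 - p * w * v)) := by
    rw [Real.log_div h3.ne' h1.ne', Real.log_div h2.ne' h4.ne', logRatio]; ring
  rw [this, Real.exp_add, Real.exp_log (div_pos h2 h4), ← Real.rpow_def_of_pos (div_pos h3 h1),
    scaledRatio]

@[simp] lemma scaledRatio_zero : scaledRatio p w 0 = 1 := by simp [scaledRatio]

lemma hasDerivAt_logRatio {v : ℝ} (hp : 1 < p) (hw0 : 0 ≤ w) (hw1 : w ≤ 1) (hv : p * v < 1) :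
    HasDerivAt (logRatio p w)
      (p * (p - 1) * v * (w ^ 2 / ((1 - w * v) * (1 - p * w * v)) -
        1 / ((1 - v) * (1 - p * v)))) v := by
  obtain ⟨h1, h2, h3, h4⟩ := one_sub_pos_of_mul_lt_one hp hw0 hw1 hv
  have d (c : ℝ) (hc : 1 - c * v ≠ 0) :
      HasDerivAt (fun v => Real.log (1 - c * v)) (-c / (1 - c * v)) v := by
    have : HasDerivAt (fun v : ℝ => 1 - c * v) (-c) v := by
      simpa using ((hasDerivAt_id v).const_mul c).const_sub 1
    exact this.log hc
  have e1 : HasDerivAt (fun v => Real.log (1 - v)) (-1 / (1 - v)) v := by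
    simpa using d 1 (by simpa using h1.ne')
  have := ((((d w h3.ne').const_mul p).sub (e1.const_mul p)).add (d p h2.ne')).sub
    (d (p * w) h4.ne')
  refine HasDerivAt.congr_deriv (f := logRatio p w) this ?_
  symm
  have h1' := h1.ne'
  have h2' := h2.ne'
  have h3' := h3.ne'
  have h4' := h4.ne'
  rw [div_sub_div _ _ (mul_ne_zero h3' h4') (mul_ne_zero h1' h2'), ← mul_div_assoc,
    ← mul_div_assoc, ← mul_div_assoc, div_sub_div _ _ h3' h1', div_add_div _ _
    (mul_ne_zero h3' h1') h2', div_sub_div _ _ (mul_ne_zero (mul_ne_zero h3' h1') h2') h4',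
    div_eq_div_iff (mul_ne_zero (mul_ne_zero h3' h4') (mul_ne_zero h1' h2'))
      (mul_ne_zero (mul_ne_zero (mul_ne_zero h3' h1') h2') h4')]
  ring

/-- Since `w < 1`, both `w (1 - v) < 1 - w v` and `w (1 - p v) < 1 - p w v`; multiply the two. The
sign of the derivative of `logRatio` is therefore opposite to that of `v`. -/
lemma logRatio_factor_neg {v : ℝ} (hp : 1 < p) (hw0 : 0 ≤ w) (hw1 : w < 1) (hv : p * v < 1) :
    w ^ 2 / ((1 - w * v) * (1 - p * w * v)) - 1 / ((1 - v) * (1 - p * v)) < 0 := by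
  obtain ⟨h1, h2, h3, h4⟩ := one_sub_pos_of_mul_lt_one hp hw0 hw1.le hv
  have a1 : w * (1 - v) < 1 - w * v := by nlinarith
  have a2 : w * (1 - p * v) < 1 - p * w * v := by nlinarith
  rw [sub_neg, div_lt_div_iff₀ (mul_pos h3 h4) (mul_pos h1 h2)]
  have := mul_lt_mul'' a1 a2 (by positivity) (by positivity)
  nlinarith

lemma scaledRatio_strictAntiOn (hp : 1 < p) (hw0 : 0 ≤ w) (hw1 : w < 1) :
    StrictAntiOn (scaledRatio p w) (Ico 0 (1 / p)) := by
  have key : ∀ v ∈ Ico 0 (1 / p), p * v < 1 := fun v hv => by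
    have := hv.2
    rwa [lt_div_iff₀ (by linarith), mul_comm] at this
  have : StrictAntiOn (logRatio p w) (Ico 0 (1 / p)) := by
    apply strictAntiOn_of_deriv_neg (convex_Ico _ _)
    · intro v hv
      exact (hasDerivAt_logRatio hp hw0 hw1.le (key v hv)).continuousAt.continuousWithinAt
    · intro v hv
      rw [interior_Ico] at hv
      have hv' := key v ⟨hv.1.le, hv.2⟩
      rw [(hasDerivAt_logRatio hp hw0 hw1.le hv').deriv]
      have := hv.1
      exact mul_neg_of_pos_of_neg (mul_pos (mul_pos (by linarith) (by linarith)) this)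
        (logRatio_factor_neg hp hw0 hw1 hv')
  intro a ha b hb hab
  rw [scaledRatio_eq_exp hp hw0 hw1.le (key a ha), scaledRatio_eq_exp hp hw0 hw1.le (key b hb)]
  exact Real.exp_lt_exp.2 (this ha hb hab)

lemma scaledRatio_strictMonoOn (hp : 1 < p) (hw0 : 0 ≤ w) (hw1 : w < 1) :
    StrictMonoOn (scaledRatio p w) (Iic 0) := by
  have key : ∀ v ∈ Iic (0 : ℝ), p * v < 1 := fun v hv => by
    have : p * v ≤ 0 := mul_nonpos_of_nonneg_of_nonpos (by linarith) hv
    linarith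
  have : StrictMonoOn (logRatio p w) (Iic 0) := by
    apply strictMonoOn_of_deriv_pos (convex_Iic _)
    · intro v hv
      exact (hasDerivAt_logRatio hp hw0 hw1.le (key v hv)).continuousAt.continuousWithinAt
    · intro v hv
      rw [interior_Iic] at hv
      have hv' := key v (mem_Iic.2 (le_of_lt hv))
      rw [(hasDerivAt_logRatio hp hw0 hw1.le hv').deriv]
      have hv0 : v < 0 := hv
      exact mul_pos_of_neg_of_neg
        (mul_neg_of_pos_of_neg (mul_pos (by linarith) (by linarith)) hv0)
        (logRatio_factor_neg hp hw0 hw1 hv')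
  intro a ha b hb hab
  rw [scaledRatio_eq_exp hp hw0 hw1.le (key a ha), scaledRatio_eq_exp hp hw0 hw1.le (key b hb)]
  exact Real.exp_lt_exp.2 (this ha hb hab)

lemma continuousOn_scaledRatio (hp : 1 < p) (hw0 : 0 ≤ w) (hw1 : w < 1) :
    ContinuousOn (scaledRatio p w) (Iic (1 / p)) := by
  have hp0 : 0 < p := by linarith
  intro v hv
  have hpv : p * v ≤ 1 := by
    have : v ≤ 1 / p := hv
    rwa [le_div_iff₀ hp0, mul_comm] at this
  have h1 : 1 - v ≠ 0 := by nlinarith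
  have h2 : 1 - p * w * v ≠ 0 := by
    rcases le_total 0 v with h | h
    · nlinarith [mul_nonneg hp0.le h]
    · nlinarith [mul_nonneg hp0.le hw0, mul_nonneg (mul_nonneg hp0.le hw0) (neg_nonneg.2 h)]
  apply ContinuousAt.continuousWithinAt
  unfold scaledRatio
  refine ContinuousAt.mul (ContinuousAt.rpow_const ?_ (Or.inr hp0.le)) ?_
  · exact ContinuousAt.div (by fun_prop) (by fun_prop) h1
  · exact ContinuousAt.div (by fun_prop) (by fun_prop) h2

/-- Intermediate values between `1` at `v = 0` and `0` at `v = 1 / p`; the right endpoint is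
excluded because `R > 0`. -/
lemma exists_scaledRatio_eq_of_nonneg {R : ℝ} (hp : 1 < p) (hw0 : 0 ≤ w) (hw1 : w < 1)
    (hR0 : 0 < R) (hR1 : R ≤ 1) : ∃ v ∈ Ico 0 (1 / p), scaledRatio p w v = R := by
  have hp0 : 0 < p := by linarith
  have hc : ContinuousOn (scaledRatio p w) (Icc 0 (1 / p)) :=
    (continuousOn_scaledRatio hp hw0 hw1).mono Icc_subset_Iic_self
  have h1 : scaledRatio p w (1 / p) = 0 := by
    simp [scaledRatio, hp0.ne']
  have := intermediate_value_Icc' (by positivity) hc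
  rw [scaledRatio_zero, h1] at this
  obtain ⟨v, hv, hvR⟩ := this ⟨hR0.le, hR1⟩
  refine ⟨v, ⟨hv.1, lt_of_le_of_ne hv.2 ?_⟩, hvR⟩
  rintro rfl
  rw [h1] at hvR
  exact hR0.ne hvR

-- The limit of `scaledRatio` at `-∞` is `w ^ (p - 1)`. The substitution `v = -1 / τ` moves it to `τ
-- → 0+`, and splitting off one factor of the `p`-th power lets the cases `w = 0` and `w > 0` share
-- a formula.
open Filter Topology in
lemma exists_scaledRatio_lt {R : ℝ} (hp : 1 < p) (hw0 : 0 ≤ w) (hR : w ^ (p - 1) < R) :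
    ∃ v ≤ 0, scaledRatio p w v < R := by
  have hp0 : 0 < p := by linarith
  have eq : ∀ τ : ℝ, 0 < τ → scaledRatio p w (-τ⁻¹) =
      ((τ + w) / (τ + 1)) ^ (p - 1) * ((τ + w) / (τ + p * w) * ((τ + p) / (τ + 1))) := by
    intro τ hτ
    have hτw : 0 < τ + w := by positivity
    have hτw' : 0 < τ + p * w := by positivity
    have e1 : (1 - w * -τ⁻¹) / (1 - -τ⁻¹) = (τ + w) / (τ + 1) := by
      have : 1 - -τ⁻¹ ≠ 0 := by rw [sub_neg_eq_add]; positivity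
      rw [div_eq_div_iff this (by positivity)]
      field_simp
      ring
    have e2 : (1 - p * -τ⁻¹) / (1 - p * w * -τ⁻¹) = (τ + p) / (τ + p * w) := by
      have : 1 - p * w * -τ⁻¹ ≠ 0 := by
        rw [mul_neg, sub_neg_eq_add]; positivity
      rw [div_eq_div_iff this (by positivity)]
      field_simp
      ring
    have e3 : ((τ + w) / (τ + 1)) ^ p = ((τ + w) / (τ + 1)) ^ (p - 1) * ((τ + w) / (τ + 1)) := by
      rw [← Real.rpow_add_one (by positivity)]; ring_nf
    rw [scaledRatio, e1, e2, e3]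
    ring
  have lim : Tendsto (fun τ : ℝ => scaledRatio p w (-τ⁻¹)) (𝓝[>] 0) (𝓝 (w ^ (p - 1))) := by
    have c1 : Tendsto (fun τ : ℝ => ((τ + w) / (τ + 1)) ^ (p - 1)) (𝓝[>] 0) (𝓝 (w ^ (p - 1))) := by
      have : ContinuousAt (fun τ : ℝ => ((τ + w) / (τ + 1)) ^ (p - 1)) 0 :=
        ContinuousAt.rpow_const (ContinuousAt.div (by fun_prop) (by fun_prop) (by norm_num))
          (Or.inr (by linarith))
      have := this.tendsto.mono_left (nhdsWithin_le_nhds (s := Ioi 0))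
      simpa using this
    have c2 : Tendsto (fun τ : ℝ => (τ + p) / (τ + 1)) (𝓝[>] 0) (𝓝 p) := by
      have : ContinuousAt (fun τ : ℝ => (τ + p) / (τ + 1)) 0 :=
        ContinuousAt.div (by fun_prop) (by fun_prop) (by norm_num)
      have := this.tendsto.mono_left (nhdsWithin_le_nhds (s := Ioi 0))
      simpa using this
    have main : Tendsto (fun τ : ℝ => ((τ + w) / (τ + 1)) ^ (p - 1) *
        ((τ + w) / (τ + p * w) * ((τ + p) / (τ + 1)))) (𝓝[>] 0) (𝓝 (w ^ (p - 1))) := by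
      -- For `w = 0` the middle factor is `τ / τ`, which has the junk value `0` at `τ = 0`, so its
      -- limit is taken off the point instead of by continuity.
      rcases hw0.eq_or_lt with rfl | hw
      · have c3 : Tendsto (fun τ : ℝ => (τ + 0) / (τ + p * 0)) (𝓝[>] 0) (𝓝 1) := by
          apply tendsto_const_nhds.congr'
          filter_upwards [self_mem_nhdsWithin] with τ hτ
          have : τ ≠ 0 := ne_of_gt hτ
          simp [this]
        have := c1.mul (c3.mul c2)
        rw [Real.zero_rpow (by linarith), zero_mul] at this
        rwa [Real.zero_rpow (by linarith)]
      · have c3 : Tendsto (fun τ : ℝ => (τ + w) / (τ + p * w)) (𝓝[>] 0) (𝓝 (w / (p * w))) := by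
          have : ContinuousAt (fun τ : ℝ => (τ + w) / (τ + p * w)) 0 :=
            ContinuousAt.div (by fun_prop) (by fun_prop) (by positivity)
          have := this.tendsto.mono_left (nhdsWithin_le_nhds (s := Ioi 0))
          simpa using this
        have := c1.mul (c3.mul c2)
        rwa [show w / (p * w) * p = 1 by field_simp, mul_one] at this
    refine main.congr' ?_
    filter_upwards [self_mem_nhdsWithin] with τ hτ
    exact (eq τ hτ).symm
  obtain ⟨τ, h1, h2⟩ := ((lim.eventually_lt_const hR).and self_mem_nhdsWithin).exists
  have : (0 : ℝ) < τ := h2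
  exact ⟨-τ⁻¹, by simpa using this.le, h1⟩

lemma exists_scaledRatio_eq_of_nonpos {R : ℝ} (hp : 1 < p) (hw0 : 0 ≤ w) (hw1 : w < 1)
    (hR0 : w ^ (p - 1) < R) (hR1 : R ≤ 1) : ∃ v ≤ 0, scaledRatio p w v = R := by
  obtain ⟨v₀, hv₀, hlt⟩ := exists_scaledRatio_lt hp hw0 hR0
  have hc : ContinuousOn (scaledRatio p w) (Icc v₀ 0) :=
    (continuousOn_scaledRatio hp hw0 hw1).mono fun x hx =>
      le_trans hx.2 (by positivity)
  have := intermediate_value_Icc hv₀ hc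
  rw [scaledRatio_zero] at this
  obtain ⟨v, hv, hvR⟩ := this ⟨hlt.le, hR1⟩
  exact ⟨v, hv.2, hvR⟩

end Root

/-! ### From the parameter `a` to the scaled parameter `v` -/

section SignedPower

variable {p q m M x₁ x₂ x₃ : ℝ}

lemma mul_abs_rpow_of_nonneg {a : ℝ} (hp : 1 < p) (ha : 0 ≤ a) :
    a * |a| ^ (p - 2) = a ^ (p - 1) := by
  rcases ha.eq_or_lt with rfl | h
  · rw [zero_mul, Real.zero_rpow (by linarith)]
  · rw [abs_of_pos h, mul_comm, ← Real.rpow_add_one h.ne']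
    ring_nf

lemma mul_abs_rpow_of_nonpos {a : ℝ} (hp : 1 < p) (ha : a ≤ 0) :
    a * |a| ^ (p - 2) = -(-a) ^ (p - 1) := by
  have := mul_abs_rpow_of_nonneg hp (neg_nonneg.2 ha)
  rw [abs_neg] at this
  linarith

/-- With `u = a |a| ^ (p - 2)` one has `|a| ^ p = a u`, so each of the four linear expressions has a
factor `a`, which cancels. The condition on `v` makes the base of the power positive, and the
absolute value disappears. -/
lemma rootRatio_eq_scaledRatio {a : ℝ} (hp : 1 < p) (hmM : m < M) (hm3 : m ≤ x₃) (h3M : x₃ ≤ M)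
    (hv : p * (q * (M - m) * (a * |a| ^ (p - 2))) ≤ 1) :
    rootRatio p q m M x₃ a =
      scaledRatio p ((M - x₃) / (M - m)) (q * (M - m) * (a * |a| ^ (p - 2))) := by
  by_cases ha : a = 0
  · simp [rootRatio, ha]
  have hW : M - m ≠ 0 := (sub_pos.2 hmM).ne'
  set u := a * |a| ^ (p - 2) with hu
  have hau : |a| ^ p = a * u := by
    have h2 : |a| ^ p = |a| ^ (p - 2) * |a| ^ (2 : ℕ) := by
      rw [← Real.rpow_natCast, ← Real.rpow_add (abs_pos.2 ha)]; norm_num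
    rw [h2, sq_abs, hu]; ring
  set v := q * (M - m) * u with hvdef
  set w := (M - x₃) / (M - m) with hw
  have hw0 : 0 ≤ w := div_nonneg (by linarith) (by linarith)
  have hw1 : w ≤ 1 := (div_le_one (by linarith)).2 (by linarith)
  have hwv : w * v = q * (M - x₃) * u := by rw [hw, hvdef]; field_simp
  have h1 : 0 < 1 - v := by nlinarith
  have h2 : 0 < 1 - w * v := by
    rcases le_total 0 v with h | h
    · nlinarith
    · nlinarith [mul_nonneg hw0 (neg_nonneg.2 h)]
  have e1 : a - q * (M - x₃) * |a| ^ p = a * (1 - w * v) := by rw [hau, hwv]; ring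
  have e2 : a - q * (M - m) * |a| ^ p = a * (1 - v) := by rw [hau, hvdef]; ring
  have e3 : a - p * q * (M - m) * |a| ^ p = a * (1 - p * v) := by rw [hau, hvdef]; ring
  have e4 : a - p * q * (M - x₃) * |a| ^ p = a * (1 - p * w * v) := by
    rw [hau, mul_assoc p w v, hwv]; ring
  rw [rootRatio, if_neg ha, e1, e2, e3, e4, mul_div_mul_left _ _ ha, mul_div_mul_left _ _ ha,
    abs_of_pos (div_pos h2 h1), scaledRatio]

lemma bellmanFormula_eq_scaled {a : ℝ} (hp : 1 < p) (hmM : m < M)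
    (hv : p * (q * (M - m) * (a * |a| ^ (p - 2))) ≤ 1) :
    bellmanFormula p q m M x₂ x₃ a =
      (x₃ - m) * x₂ / ((1 - q * (M - m) * (a * |a| ^ (p - 2))) ^ p *
        (1 - p * ((M - x₃) / (M - m)) * (q * (M - m) * (a * |a| ^ (p - 2))))) + m * x₂ := by
  have hW : M - m ≠ 0 := (sub_pos.2 hmM).ne'
  have h1 : 0 < 1 - q * (M - m) * (a * |a| ^ (p - 2)) := by nlinarith
  have e : p * ((M - x₃) / (M - m)) * (q * (M - m) * (a * |a| ^ (p - 2))) =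
      p * q * (M - x₃) * (a * |a| ^ (p - 2)) := by field_simp
  rw [bellmanFormula, abs_of_pos h1, e]

lemma upperRoot_spec (hp : 1 < p) (hq : q = p / (p - 1)) (hmM : m < M) (hx1 : 0 < x₁)
    (hx2 : x₁ ^ p ≤ x₂) (hm3 : m < x₃) (h3M : x₃ ≤ M) :
    (∃! a, IsUpperRoot p q m M x₁ x₂ x₃ a) ∧
    ∀ a, IsUpperRoot p q m M x₁ x₂ x₃ a → ∃ v ∈ Ico 0 (1 / p),
      scaledRatio p ((M - x₃) / (M - m)) v = x₁ ^ p / x₂ ∧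
      bellmanFormula p q m M x₂ x₃ a = (x₃ - m) * x₂ /
        ((1 - v) ^ p * (1 - p * ((M - x₃) / (M - m)) * v)) + m * x₂ := by
  have hp0 : 0 < p := by linarith
  have hp1 : 0 < p - 1 := by linarith
  have hq0 : 0 < q := by rw [hq]; positivity
  have hq1 : (q - 1) * (p - 1) = 1 := by rw [hq]; field_simp; ring
  have hW : 0 < M - m := sub_pos.2 hmM
  have hw0 : 0 ≤ (M - x₃) / (M - m) := div_nonneg (by linarith) hW.le
  have hw1 : (M - x₃) / (M - m) < 1 := (div_lt_one hW).2 (by linarith)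
  have hx1p : 0 < x₁ ^ p := Real.rpow_pos_of_pos hx1 p
  have hx2' : 0 < x₂ := by linarith
  have hR0 : 0 < x₁ ^ p / x₂ := by positivity
  have hR1 : x₁ ^ p / x₂ ≤ 1 := (div_le_one hx2').2 hx2
  -- As `(q - 1) (p - 1) = 1`, the prescribed upper end of the range of `a` is exactly `v = 1 / p`.
  have bound : ∀ a : ℝ, 0 ≤ a → a ≤ (1 / (p * q * (M - m))) ^ (q - 1) →
      p * (q * (M - m) * (a * |a| ^ (p - 2))) ≤ 1 := by
    intro a ha hab
    rw [mul_abs_rpow_of_nonneg hp ha]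
    have := Real.rpow_le_rpow ha hab hp1.le
    rw [← Real.rpow_mul (by positivity), hq1, Real.rpow_one, le_div_iff₀ (by positivity)] at this
    linarith
  have spec : ∀ a, IsUpperRoot p q m M x₁ x₂ x₃ a →
      q * (M - m) * (a * |a| ^ (p - 2)) ∈ Ico 0 (1 / p) ∧
      scaledRatio p ((M - x₃) / (M - m)) (q * (M - m) * (a * |a| ^ (p - 2))) = x₁ ^ p / x₂ := by
    rintro a ⟨⟨ha, hab⟩, hr⟩
    have hb := bound a ha hab
    rw [rootRatio_eq_scaledRatio hp hmM hm3.le h3M hb, abs_of_pos hx1] at hr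
    refine ⟨⟨?_, lt_of_le_of_ne ?_ ?_⟩, hr.symm⟩
    · rw [mul_abs_rpow_of_nonneg hp ha]; positivity
    · rw [le_div_iff₀ hp0]; linarith
    · intro h
      rw [h] at hr
      have : scaledRatio p ((M - x₃) / (M - m)) (1 / p) = 0 := by
        simp [scaledRatio, hp0.ne']
      rw [this] at hr
      exact hR0.ne' hr
  refine ⟨?_, fun a ha => ⟨_, (spec a ha).1, (spec a ha).2,
    bellmanFormula_eq_scaled hp hmM (bound a ha.1.1 ha.1.2)⟩⟩
  obtain ⟨v, hv, hvR⟩ := exists_scaledRatio_eq_of_nonneg hp hw0 hw1 hR0 hR1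
  have hv0 : 0 ≤ v / (q * (M - m)) := div_nonneg hv.1 (by positivity)
  -- The inverse of `a ↦ q (M - m) a ^ (p - 1)` on the half-line `a ≥ 0`.
  refine ⟨(v / (q * (M - m))) ^ (q - 1), ⟨⟨by positivity, ?_⟩, ?_⟩, ?_⟩
  · apply Real.rpow_le_rpow hv0 _ (by nlinarith)
    rw [div_le_div_iff₀ (by positivity) (by positivity)]
    have := (lt_div_iff₀ hp0).1 hv.2
    nlinarith [mul_pos hq0 hW]
  · have e : q * (M - m) * ((v / (q * (M - m))) ^ (q - 1) *
        |(v / (q * (M - m))) ^ (q - 1)| ^ (p - 2)) = v := by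
      rw [mul_abs_rpow_of_nonneg hp (by positivity), ← Real.rpow_mul hv0, hq1, Real.rpow_one]
      field_simp
    have hpv := (lt_div_iff₀ hp0).1 hv.2
    rw [rootRatio_eq_scaledRatio hp hmM hm3.le h3M (by rw [e]; linarith), e, hvR, abs_of_pos hx1]
  · intro b hb
    have hs := spec b hb
    have := (scaledRatio_strictAntiOn hp hw0 hw1).injOn hs.1 hv (hs.2.trans hvR.symm)
    rw [mul_abs_rpow_of_nonneg hp hb.1.1] at this
    rw [← this, mul_div_cancel_left₀ _ (by positivity), ← Real.rpow_mul hb.1.1, mul_comm, hq1,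
      Real.rpow_one]

lemma lowerRoot_spec (hp : 1 < p) (hq : q = p / (p - 1)) (hmM : m < M) (hx1 : 0 < x₁)
    (hx2 : x₁ ^ p ≤ x₂) (hm3 : m < x₃) (h3M : x₃ ≤ M)
    (hlow : ((M - x₃) / (M - m)) ^ (p - 1) < x₁ ^ p / x₂) :
    (∃! a, IsLowerRoot p q m M x₁ x₂ x₃ a) ∧
    ∀ a, IsLowerRoot p q m M x₁ x₂ x₃ a → ∃ v ≤ 0,
      scaledRatio p ((M - x₃) / (M - m)) v = x₁ ^ p / x₂ ∧
      bellmanFormula p q m M x₂ x₃ a = (x₃ - m) * x₂ /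
        ((1 - v) ^ p * (1 - p * ((M - x₃) / (M - m)) * v)) + m * x₂ := by
  have hp0 : 0 < p := by linarith
  have hp1 : 0 < p - 1 := by linarith
  have hq0 : 0 < q := by rw [hq]; positivity
  have hq1 : (q - 1) * (p - 1) = 1 := by rw [hq]; field_simp; ring
  have hW : 0 < M - m := sub_pos.2 hmM
  have hw0 : 0 ≤ (M - x₃) / (M - m) := div_nonneg (by linarith) hW.le
  have hw1 : (M - x₃) / (M - m) < 1 := (div_lt_one hW).2 (by linarith)
  have hx1p : 0 < x₁ ^ p := Real.rpow_pos_of_pos hx1 p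
  have hx2' : 0 < x₂ := by linarith
  have hR1 : x₁ ^ p / x₂ ≤ 1 := (div_le_one hx2').2 hx2
  have nonpos : ∀ a : ℝ, a ≤ 0 → q * (M - m) * (a * |a| ^ (p - 2)) ≤ 0 := by
    intro a ha
    exact mul_nonpos_of_nonneg_of_nonpos (by positivity)
      (mul_nonpos_of_nonpos_of_nonneg ha (by positivity))
  have bound : ∀ a : ℝ, a ≤ 0 → p * (q * (M - m) * (a * |a| ^ (p - 2))) ≤ 1 := by
    intro a ha
    nlinarith [nonpos a ha]
  have spec : ∀ a, IsLowerRoot p q m M x₁ x₂ x₃ a →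
      scaledRatio p ((M - x₃) / (M - m)) (q * (M - m) * (a * |a| ^ (p - 2))) = x₁ ^ p / x₂ := by
    rintro a ⟨ha, hr⟩
    rw [rootRatio_eq_scaledRatio hp hmM hm3.le h3M (bound a ha), abs_of_pos hx1] at hr
    exact hr.symm
  refine ⟨?_, fun a ha => ⟨_, nonpos a ha.1, spec a ha,
    bellmanFormula_eq_scaled hp hmM (bound a ha.1)⟩⟩
  obtain ⟨v, hv, hvR⟩ := exists_scaledRatio_eq_of_nonpos hp hw0 hw1 hlow hR1
  have hv0 : 0 ≤ -v / (q * (M - m)) := div_nonneg (by linarith) (by positivity)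
  have hc0 : -(-v / (q * (M - m))) ^ (q - 1) ≤ 0 := neg_nonpos.2 (by positivity)
  refine ⟨-(-v / (q * (M - m))) ^ (q - 1), ⟨hc0, ?_⟩, ?_⟩
  · have e : q * (M - m) * (-(-v / (q * (M - m))) ^ (q - 1) *
        |-(-v / (q * (M - m))) ^ (q - 1)| ^ (p - 2)) = v := by
      rw [mul_abs_rpow_of_nonpos hp hc0, neg_neg, ← Real.rpow_mul hv0, hq1, Real.rpow_one]
      field_simp
    rw [rootRatio_eq_scaledRatio hp hmM hm3.le h3M (bound _ hc0), e, hvR, abs_of_pos hx1]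
  · intro b hb
    have := (scaledRatio_strictMonoOn hp hw0 hw1).injOn (mem_Iic.2 (nonpos b hb.1)) hv
      ((spec b hb).trans hvR.symm)
    rw [mul_abs_rpow_of_nonpos hp hb.1] at this
    rw [← this, mul_neg, neg_neg, mul_div_cancel_left₀ _ (by positivity),
      ← Real.rpow_mul (by linarith [hb.1]), mul_comm, hq1, Real.rpow_one, neg_neg]

/-- The two descriptions of the domain of the lower formula. -/
lemma lower_domain_iff (hp : 1 < p) (hq : q = p / (p - 1)) (hmM : m < M) (hx1 : 0 < x₁)
    (hx2 : x₁ ^ p ≤ x₂) (h3M : x₃ ≤ M) :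
    (M - (M - m) * (x₁ ^ q / x₂ ^ (q - 1)) < x₃ ↔
      (M - x₃) ^ (p - 1) * x₂ < (M - m) ^ (p - 1) * x₁ ^ p) ∧
    (M - (M - m) * (x₁ ^ q / x₂ ^ (q - 1)) < x₃ ↔
      ((M - x₃) / (M - m)) ^ (p - 1) < x₁ ^ p / x₂) := by
  have hp1 : 0 < p - 1 := by linarith
  have hq1 : (q - 1) * (p - 1) = 1 := by rw [hq]; field_simp; ring
  have hqp : q * (p - 1) = p := by rw [hq]; field_simp
  have hW : 0 < M - m := sub_pos.2 hmM
  have hw : 0 ≤ M - x₃ := by linarith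
  have hx1p : 0 < x₁ ^ p := Real.rpow_pos_of_pos hx1 p
  have hx2' : 0 < x₂ := by linarith
  have hθ : 0 ≤ x₁ ^ q / x₂ ^ (q - 1) := by positivity
  have e : (x₁ ^ q / x₂ ^ (q - 1)) ^ (p - 1) = x₁ ^ p / x₂ := by
    rw [Real.div_rpow (by positivity) (by positivity), ← Real.rpow_mul hx1.le,
      ← Real.rpow_mul hx2'.le, hqp, hq1, Real.rpow_one]
  have h2 : M - (M - m) * (x₁ ^ q / x₂ ^ (q - 1)) < x₃ ↔
      ((M - x₃) / (M - m)) ^ (p - 1) < x₁ ^ p / x₂ := by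
    rw [← e, Real.rpow_lt_rpow_iff (by positivity) hθ hp1, div_lt_iff₀ hW]
    constructor <;> intro h <;> linarith
  refine ⟨?_, h2⟩
  rw [h2, Real.div_rpow hw hW.le, div_lt_div_iff₀ (by positivity) hx2', mul_comm (x₁ ^ p)]

end SignedPower

/-! ### The Bellman induction on finitely many generations -/

section FiniteLevel

variable {p v : ℝ}

lemma sum_range_two_mul {E : Type*} [AddCommMonoid E] (f : ℕ → E) (m : ℕ) :
    ∑ k ∈ Finset.range (2 * m), f k = ∑ k ∈ Finset.range m, (f (2 * k) + f (2 * k + 1)) := by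
  induction m with
  | zero => simp
  | succ m ih =>
    rw [show 2 * (m + 1) = 2 * m + 1 + 1 by ring, Finset.sum_range_succ, Finset.sum_range_succ, ih,
      Finset.sum_range_succ, add_assoc]

lemma mul_div_rpow_eq {x c : ℝ} (hx : 0 ≤ x) (hc : 0 < c) :
    c * (x / c) ^ p = x ^ p * c ^ (1 - p) := by
  rw [Real.div_rpow hx hc.le, Real.rpow_sub hc, Real.rpow_one]
  ring

/-- Midpoint convexity of the perspective `x ^ p * c ^ (1 - p)` of the power function. -/
lemma rpow_mul_rpow_midpoint_le {x y c d : ℝ} (hp : 1 ≤ p) (hx : 0 ≤ x) (hy : 0 ≤ y)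
    (hc : 0 < c) (hd : 0 < d) :
    ((x + y) / 2) ^ p * ((c + d) / 2) ^ (1 - p) ≤
      (x ^ p * c ^ (1 - p) + y ^ p * d ^ (1 - p)) / 2 := by
  have hcd : 0 < c + d := by positivity
  -- Jensen's inequality at the points `x / c` and `y / d` with the weights `c / (c + d)` and `d /
  -- (c + d)`.
  have key := (convexOn_rpow hp).2 (mem_Ici.2 (div_nonneg hx hc.le))
    (mem_Ici.2 (div_nonneg hy hd.le)) (div_nonneg hc.le hcd.le) (div_nonneg hd.le hcd.le)
    (by rw [← add_div, div_self hcd.ne'])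
  simp only [smul_eq_mul] at key
  have e : c / (c + d) * (x / c) + d / (c + d) * (y / d) = ((x + y) / 2) / ((c + d) / 2) := by
    field_simp
  rw [e] at key
  rw [← mul_div_rpow_eq (by positivity) (by positivity), ← mul_div_rpow_eq hx hc,
    ← mul_div_rpow_eq hy hd]
  calc (c + d) / 2 * (((x + y) / 2) / ((c + d) / 2)) ^ p
      ≤ (c + d) / 2 * (c / (c + d) * (x / c) ^ p + d / (c + d) * (y / d) ^ p) := by gcongr
    _ = _ := by field_simp

lemma one_sub_mul_pos {N : ℝ} (hv : v < 1) (hN0 : 0 ≤ N) (hN1 : N ≤ 1) : 0 < 1 - v * (1 - N) := by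
  rcases le_total 0 v with h | h
  · nlinarith
  · nlinarith [mul_nonneg (neg_nonneg.2 h) (sub_nonneg.2 hN1)]

/-- Bernoulli's inequality for non-positive exponents. -/
lemma one_add_mul_self_le_rpow_of_nonpos {t s : ℝ} (ht : 0 < 1 + t) (hs : s ≤ 0) :
    1 + s * t ≤ (1 + t) ^ s := by
  rw [Real.rpow_def_of_pos ht]
  have h1 := Real.log_le_sub_one_of_pos ht
  have h2 := Real.add_one_le_exp (Real.log (1 + t) * s)
  nlinarith

/-- The jump inequality. With `c = 1 - v (1 - N)`, the tangent line of `t ^ (1 - p)` at `c` gives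
the gain `(p - 1) v α c ^ (-p)`. The factor `c ^ (-p)` may be dropped because `c ≤ 1` when `v ≥ 0`
and `c ≥ 1` when `v ≤ 0`, so that `v (c ^ (-p) - 1) ≥ 0` for either sign. -/
lemma rpow_one_sub_add_le {N α : ℝ} (hp : 1 < p) (hv : v < 1) (hα : 0 ≤ α) (hαN : α ≤ N)
    (hN1 : N ≤ 1) :
    (1 - v * (1 - N)) ^ (1 - p) + (p - 1) * v * α ≤ (1 - v * (1 - (N - α))) ^ (1 - p) := by
  have hc := one_sub_mul_pos hv (hα.trans hαN) hN1
  have hd : 0 < 1 - v * (1 - (N - α)) :=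
    one_sub_mul_pos hv (by linarith) (by linarith)
  set c := 1 - v * (1 - N) with hcdef
  have e : 1 - v * (1 - (N - α)) = c * (1 + -(v * α / c)) := by
    field_simp
    rw [hcdef]
    ring
  have ht : 0 < 1 + -(v * α / c) := by
    rw [e] at hd
    exact (mul_pos_iff_of_pos_left hc).1 hd
  have hb : 1 + (1 - p) * -(v * α / c) ≤ (1 + -(v * α / c)) ^ (1 - p) := by
    exact one_add_mul_self_le_rpow_of_nonpos ht (by linarith)
  have hcp : c ^ (1 - p) = c ^ (-p) * c := by
    rw [← Real.rpow_add_one hc.ne']; ring_nf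
  have hcv : 0 ≤ v * (c ^ (-p) - 1) := by
    rcases le_total 0 v with h | h
    · have : c ≤ 1 := by nlinarith
      have := Real.one_le_rpow_of_pos_of_le_one_of_nonpos hc this (by linarith : -p ≤ 0)
      exact mul_nonneg h (by linarith)
    · have : 1 ≤ c := by nlinarith [mul_nonneg (neg_nonneg.2 h) (sub_nonneg.2 hN1)]
      have := Real.rpow_le_one_of_one_le_of_nonpos this (by linarith : -p ≤ 0)
      exact mul_nonneg_of_nonpos_of_nonpos h (by linarith)
  rw [e, Real.mul_rpow hc.le ht.le]
  calc c ^ (1 - p) + (p - 1) * v * α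
      ≤ c ^ (1 - p) + (p - 1) * v * α + (p - 1) * α * (v * (c ^ (-p) - 1)) :=
        le_add_of_nonneg_right (mul_nonneg (mul_nonneg (by linarith) hα) hcv)
    _ = c ^ (1 - p) * (1 + (1 - p) * -(v * α / c)) := by
        rw [hcp]; field_simp; ring
    _ ≤ _ := by gcongr

/-- One generation step combines the jump inequality, which removes `α` from `N`, with midpoint
convexity of the perspective, since `N - α` is the mean of the values on the two halves. -/
lemma bellman_induction {a α N : ℕ → ℕ → ℝ} (hp : 1 < p) (hv : v < 1)
    (ha : ∀ n k, 0 ≤ a n k) (hα : ∀ n k, 0 ≤ α n k)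
    (hN0 : ∀ n k, k < 2 ^ n → 0 ≤ N n k) (hN1 : ∀ n k, k < 2 ^ n → N n k ≤ 1)
    (ha2 : ∀ n k, k < 2 ^ n → a n k = (a (n + 1) (2 * k) + a (n + 1) (2 * k + 1)) / 2)
    (hN2 : ∀ n k, k < 2 ^ n → N n k = (N (n + 1) (2 * k) + N (n + 1) (2 * k + 1)) / 2 + α n k)
    (n : ℕ) :
    (p - 1) * v * ∑ j ∈ Finset.range n, (∑ k ∈ Finset.range (2 ^ j), a j k ^ p * α j k) / 2 ^ j +
        a 0 0 ^ p * (1 - v * (1 - N 0 0)) ^ (1 - p) ≤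
      (∑ k ∈ Finset.range (2 ^ n), a n k ^ p * (1 - v * (1 - N n k)) ^ (1 - p)) / 2 ^ n := by
  induction n with
  | zero => simp
  | succ n ih =>
    rw [Finset.sum_range_succ, mul_add, add_right_comm]
    refine (add_le_add_left ih _).trans ?_
    rw [← mul_div_assoc, ← add_div, pow_succ', pow_succ' (2 : ℝ),
      sum_range_two_mul, ← div_div]
    gcongr
    rw [Finset.mul_sum, ← Finset.sum_add_distrib, Finset.sum_div]
    refine Finset.sum_le_sum fun k hk => ?_
    have hk' : k < 2 ^ n := Finset.mem_range.1 hk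
    have hk1 : 2 * k < 2 ^ (n + 1) := by rw [pow_succ]; omega
    have hk2 : 2 * k + 1 < 2 ^ (n + 1) := by rw [pow_succ]; omega
    have c1 := one_sub_mul_pos hv (hN0 _ _ hk1) (hN1 _ _ hk1)
    have c2 := one_sub_mul_pos hv (hN0 _ _ hk2) (hN1 _ _ hk2)
    have h1 := rpow_mul_rpow_midpoint_le hp.le (ha (n + 1) (2 * k)) (ha (n + 1) (2 * k + 1)) c1 c2
    have hαN : α n k ≤ N n k := by
      have := hN2 n k hk'
      linarith [hN0 _ _ hk1, hN0 _ _ hk2]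
    have h2 := rpow_one_sub_add_le hp hv (hα n k) hαN (hN1 n k hk')
    have e : (1 - v * (1 - N (n + 1) (2 * k)) + (1 - v * (1 - N (n + 1) (2 * k + 1)))) / 2 =
        1 - v * (1 - (N n k - α n k)) := by
      rw [hN2 n k hk']; ring
    rw [e, ← ha2 n k hk'] at h1
    refine le_trans ?_ h1
    have := mul_le_mul_of_nonneg_left h2 (Real.rpow_nonneg (ha n k) p)
    linarith

/-- The mass left in the last generation is treated as one more jump, from `N` down to `0`. -/
lemma bellman_induction_terminal {a α N : ℕ → ℕ → ℝ} (hp : 1 < p) (hv : v < 1)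
    (ha : ∀ n k, 0 ≤ a n k) (hα : ∀ n k, 0 ≤ α n k)
    (hN0 : ∀ n k, k < 2 ^ n → 0 ≤ N n k) (hN1 : ∀ n k, k < 2 ^ n → N n k ≤ 1)
    (ha2 : ∀ n k, k < 2 ^ n → a n k = (a (n + 1) (2 * k) + a (n + 1) (2 * k + 1)) / 2)
    (hN2 : ∀ n k, k < 2 ^ n → N n k = (N (n + 1) (2 * k) + N (n + 1) (2 * k + 1)) / 2 + α n k)
    (n : ℕ) :
    (p - 1) * v * (∑ j ∈ Finset.range n, (∑ k ∈ Finset.range (2 ^ j), a j k ^ p * α j k) / 2 ^ j +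
          (∑ k ∈ Finset.range (2 ^ n), a n k ^ p * N n k) / 2 ^ n) ≤
      (1 - v) ^ (1 - p) * ((∑ k ∈ Finset.range (2 ^ n), a n k ^ p) / 2 ^ n) -
        a 0 0 ^ p * (1 - v * (1 - N 0 0)) ^ (1 - p) := by
  have h := bellman_induction hp hv ha hα hN0 hN1 ha2 hN2 n
  have h2 : (∑ k ∈ Finset.range (2 ^ n), a n k ^ p * (1 - v * (1 - N n k)) ^ (1 - p)) / 2 ^ n ≤
      (1 - v) ^ (1 - p) * ((∑ k ∈ Finset.range (2 ^ n), a n k ^ p) / 2 ^ n) -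
      (p - 1) * v * ((∑ k ∈ Finset.range (2 ^ n), a n k ^ p * N n k) / 2 ^ n) := by
    rw [← mul_div_assoc, ← mul_div_assoc, ← sub_div]
    gcongr
    rw [Finset.mul_sum, Finset.mul_sum, ← Finset.sum_sub_distrib]
    refine Finset.sum_le_sum fun k hk => ?_
    have hk' : k < 2 ^ n := Finset.mem_range.1 hk
    have := rpow_one_sub_add_le hp hv (hN0 n k hk') le_rfl (hN1 n k hk')
    rw [sub_self, sub_zero, mul_one] at this
    have := mul_le_mul_of_nonneg_left this (Real.rpow_nonneg (ha n k) p)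
    linarith
  linarith

end FiniteLevel

/-! ### Dyadic intervals and sums over their descendants -/

section Dyadic

variable {l r : ℝ}

/-- The dyadic interval of generation `n` at position `k`. -/
def dyadicIco (l r : ℝ) (n k : ℕ) : Set ℝ :=
  Ico (l + k * ((r - l) / 2 ^ n)) (l + (k + 1) * ((r - l) / 2 ^ n))

lemma dyadicInterval_eq (J : DyadicIndex) : dyadicInterval l r J = dyadicIco l r J.1 J.2 := rfl

lemma measurableSet_dyadicIco (n k : ℕ) : MeasurableSet (dyadicIco l r n k) := measurableSet_Ico

@[simp] lemma dyadicIco_zero : dyadicIco l r 0 0 = Ico l r := by simp [dyadicIco]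

lemma volume_dyadicIco (n k : ℕ) :
    volume (dyadicIco l r n k) = ENNReal.ofReal ((r - l) / 2 ^ n) := by
  rw [dyadicIco, Real.volume_Ico]; congr 1; ring

lemma dyadicIco_eq_union (hlr : l < r) (n k : ℕ) :
    dyadicIco l r n k = dyadicIco l r (n + 1) (2 * k) ∪ dyadicIco l r (n + 1) (2 * k + 1) := by
  have h : 0 < (r - l) / 2 ^ (n + 1) := div_pos (sub_pos.2 hlr) (by positivity)
  have e : (r - l) / 2 ^ n = 2 * ((r - l) / 2 ^ (n + 1)) := by rw [pow_succ]; field_simp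
  simp only [dyadicIco]
  rw [e, show l + (((2 * k + 1 : ℕ) : ℝ)) * ((r - l) / 2 ^ (n + 1)) =
      l + (((2 * k : ℕ) : ℝ) + 1) * ((r - l) / 2 ^ (n + 1)) by push_cast; ring,
    Ico_union_Ico_eq_Ico (by nlinarith) (by push_cast; nlinarith)]
  push_cast
  congr 1 <;> ring

lemma disjoint_dyadicIco (n k : ℕ) :
    Disjoint (dyadicIco l r (n + 1) (2 * k)) (dyadicIco l r (n + 1) (2 * k + 1)) := by
  simp only [dyadicIco]
  rw [Set.disjoint_left]
  intro t h1 h2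
  have := h1.2
  have := h2.1
  push_cast at *
  linarith

lemma measure_dyadicIco (hlr : l < r) (μ : Measure ℝ) (n k : ℕ) :
    μ (dyadicIco l r n k) =
      μ (dyadicIco l r (n + 1) (2 * k)) + μ (dyadicIco l r (n + 1) (2 * k + 1)) := by
  rw [dyadicIco_eq_union hlr, measure_union (disjoint_dyadicIco n k) (measurableSet_dyadicIco _ _)]

lemma lintegral_dyadicIco (hlr : l < r) (μ : Measure ℝ) (f : ℝ → ℝ≥0∞) (n k : ℕ) :
    ∫⁻ t in dyadicIco l r n k, f t ∂μ =
      ∫⁻ t in dyadicIco l r (n + 1) (2 * k), f t ∂μ +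
        ∫⁻ t in dyadicIco l r (n + 1) (2 * k + 1), f t ∂μ := by
  rw [dyadicIco_eq_union hlr, lintegral_union (measurableSet_dyadicIco _ _) (disjoint_dyadicIco n k)]

/-- An additive function of dyadic intervals is the sum of its values on the descendants. -/
lemma eq_sum_descendants {E : Type*} [AddCommMonoid E] {F : ℕ → ℕ → E}
    (hF : ∀ n k, F n k = F (n + 1) (2 * k) + F (n + 1) (2 * k + 1)) (n k j : ℕ) :
    F n k = ∑ i ∈ Finset.range (2 ^ j), F (n + j) (k * 2 ^ j + i) := by
  induction j with
  | zero => simp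
  | succ j ih =>
    rw [ih, pow_succ', sum_range_two_mul]
    refine Finset.sum_congr rfl fun i _ => ?_
    rw [hF]
    congr 2 <;> ring

lemma sum_measure_dyadicIco (hlr : l < r) (μ : Measure ℝ) (n : ℕ) :
    ∑ k ∈ Finset.range (2 ^ n), μ (dyadicIco l r n k) = μ (Ico l r) := by
  have := eq_sum_descendants (F := fun n k => μ (dyadicIco l r n k))
    (fun n k => measure_dyadicIco hlr μ n k) 0 0 n
  simpa using this.symm

lemma sum_lintegral_dyadicIco (hlr : l < r) (μ : Measure ℝ) (f : ℝ → ℝ≥0∞) (n : ℕ) :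
    ∑ k ∈ Finset.range (2 ^ n), ∫⁻ t in dyadicIco l r n k, f t ∂μ = ∫⁻ t in Ico l r, f t ∂μ := by
  have := eq_sum_descendants (F := fun n k => ∫⁻ t in dyadicIco l r n k, f t ∂μ)
    (fun n k => lintegral_dyadicIco hlr μ f n k) 0 0 n
  simpa using this.symm

lemma dyadicIco_subset_Ico (hlr : l < r) {n k : ℕ} (hk : k < 2 ^ n) :
    dyadicIco l r n k ⊆ Ico l r := by
  have h : 0 < (r - l) / 2 ^ n := div_pos (sub_pos.2 hlr) (by positivity)
  apply Ico_subset_Ico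
  · have : (0 : ℝ) ≤ k * ((r - l) / 2 ^ n) := by positivity
    linarith
  · have hk' : (k : ℝ) + 1 ≤ 2 ^ n := by exact_mod_cast hk
    have : ((k : ℝ) + 1) * ((r - l) / 2 ^ n) ≤ 2 ^ n * ((r - l) / 2 ^ n) := by gcongr
    rw [mul_div_cancel₀ _ (by positivity)] at this
    linarith

lemma dyadicIco_subset_iff (hlr : l < r) {n k n' k' : ℕ} :
    dyadicIco l r n' k' ⊆ dyadicIco l r n k ↔
      ∃ j i, i < 2 ^ j ∧ n' = n + j ∧ k' = k * 2 ^ j + i := by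
  have hd : 0 < r - l := sub_pos.2 hlr
  -- After comparing endpoints and clearing denominators, the inclusion is a statement about natural
  -- numbers.
  have step : dyadicIco l r n' k' ⊆ dyadicIco l r n k ↔
      k * 2 ^ n' ≤ k' * 2 ^ n ∧ (k' + 1) * 2 ^ n ≤ (k + 1) * 2 ^ n' := by
    have h' : 0 < (r - l) / 2 ^ n' := div_pos hd (by positivity)
    rw [dyadicIco, dyadicIco, Ico_subset_Ico_iff (by nlinarith), add_le_add_iff_left,
      add_le_add_iff_left, ← mul_div_assoc, ← mul_div_assoc, ← mul_div_assoc, ← mul_div_assoc,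
      div_le_div_iff₀ (by positivity) (by positivity),
      div_le_div_iff₀ (by positivity) (by positivity), mul_right_comm (k : ℝ) (r - l),
      mul_right_comm (k' : ℝ) (r - l), mul_right_comm ((k' : ℝ) + 1) (r - l),
      mul_right_comm ((k : ℝ) + 1) (r - l), mul_le_mul_iff_left₀ hd,
      mul_le_mul_iff_left₀ hd]
    norm_cast
  rw [step]
  constructor
  · rintro ⟨h1, h2⟩
    have hn : n ≤ n' := by
      have : 2 ^ n ≤ 2 ^ n' := by nlinarith
      exact (Nat.pow_le_pow_iff_right (by norm_num)).1 this
    obtain ⟨j, rfl⟩ := Nat.exists_eq_add_of_le hn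
    have hpos : 0 < 2 ^ n := by positivity
    rw [pow_add] at h1 h2
    have h1' : k * 2 ^ j ≤ k' := by
      refine Nat.le_of_mul_le_mul_left ?_ hpos
      linarith
    have h2' : k' + 1 ≤ (k + 1) * 2 ^ j := by
      refine Nat.le_of_mul_le_mul_left ?_ hpos
      linarith
    refine ⟨j, k' - k * 2 ^ j, ?_, rfl, ?_⟩
    · rw [add_mul, one_mul] at h2'; omega
    · omega
  · rintro ⟨j, i, hi, rfl, rfl⟩
    rw [pow_add]
    constructor
    · nlinarith [Nat.zero_le (i * 2 ^ n)]
    · have : (i + 1) * 2 ^ n ≤ 2 ^ j * 2 ^ n := by gcongr; omega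
      nlinarith

/-- The sum of `a` over all dyadic subintervals of the interval of generation `n` at position `k`. -/
noncomputable def subMass (a : ℕ → ℕ → ℝ≥0∞) (n k : ℕ) : ℝ≥0∞ :=
  ∑' j, ∑ i ∈ Finset.range (2 ^ j), a (n + j) (k * 2 ^ j + i)

lemma subMass_eq (a : ℕ → ℕ → ℝ≥0∞) (n k : ℕ) :
    subMass a n k = a n k + (subMass a (n + 1) (2 * k) + subMass a (n + 1) (2 * k + 1)) := by
  rw [subMass, subMass, subMass, tsum_eq_zero_add' ENNReal.summable, ← ENNReal.tsum_add]
  congr 1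
  · simp
  · refine tsum_congr fun j => ?_
    rw [pow_succ', two_mul, Finset.sum_range_add]
    congr 1
    · refine Finset.sum_congr rfl fun i _ => ?_
      congr 1 <;> ring
    · refine Finset.sum_congr rfl fun i _ => ?_
      congr 1 <;> ring

lemma subMass_mono {a b : ℕ → ℕ → ℝ≥0∞} (h : ∀ n k, a n k ≤ b n k) (n k : ℕ) :
    subMass a n k ≤ subMass b n k :=
  ENNReal.tsum_le_tsum fun _ => Finset.sum_le_sum fun _ _ => h _ _

lemma subMass_zero_zero (a : ℕ → ℕ → ℝ≥0∞) :
    subMass a 0 0 = ∑' n, ∑ k ∈ Finset.range (2 ^ n), a n k := by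
  simp [subMass]

lemma subMass_eq_sum_add_sum (a : ℕ → ℕ → ℝ≥0∞) (n k j : ℕ) :
    subMass a n k =
      ∑ j' ∈ Finset.range j, ∑ i ∈ Finset.range (2 ^ j'), a (n + j') (k * 2 ^ j' + i) +
        ∑ i ∈ Finset.range (2 ^ j), subMass a (n + j) (k * 2 ^ j + i) := by
  induction j with
  | zero => simp
  | succ j ih =>
    rw [ih, Finset.sum_range_succ, add_assoc]
    congr 1
    rw [pow_succ', sum_range_two_mul, ← Finset.sum_add_distrib]
    refine Finset.sum_congr rfl fun i _ => ?_
    rw [subMass_eq]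
    congr 2
    · congr 1; ring
    · congr 1; ring

lemma tsum_dyadicIndex (a : ℕ → ℕ → ℝ≥0∞) :
    ∑' J : DyadicIndex, a J.1 J.2 = ∑' n, ∑ k ∈ Finset.range (2 ^ n), a n k := by
  rw [ENNReal.tsum_sigma (fun n (k : Fin (2 ^ n)) => a n k)]
  refine tsum_congr fun n => ?_
  rw [tsum_fintype, Finset.sum_range]

lemma tsum_subset_dyadicInterval (hlr : l < r) (a : ℕ → ℕ → ℝ≥0∞) (J : DyadicIndex) :
    ∑' ℓ : {ℓ : DyadicIndex // dyadicInterval l r ℓ ⊆ dyadicInterval l r J},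
      a ℓ.1.1 ℓ.1.2 = subMass a J.1 J.2 := by
  obtain ⟨n, k, hk⟩ := J
  have bound : ∀ j i, i < 2 ^ j → k * 2 ^ j + i < 2 ^ (n + j) := by
    intro j i hi
    rw [pow_add]
    have : (k + 1) * 2 ^ j ≤ 2 ^ n * 2 ^ j := by gcongr; omega
    nlinarith
  let g : (Σ j : ℕ, Fin (2 ^ j)) →
      {ℓ : DyadicIndex // dyadicInterval l r ℓ ⊆ dyadicInterval l r ⟨n, k, hk⟩} := fun x =>
    ⟨⟨n + x.1, ⟨k * 2 ^ x.1 + x.2, bound x.1 x.2 x.2.2⟩⟩,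
      (dyadicIco_subset_iff hlr).2 ⟨x.1, x.2, x.2.2, rfl, rfl⟩⟩
  have hg : Function.Bijective g := by
    constructor
    · rintro ⟨j, i⟩ ⟨j', i'⟩ h
      have h' := congrArg Subtype.val h
      have h1 : n + j = n + j' := congrArg Sigma.fst h'
      obtain rfl : j = j' := by omega
      have h2 : ((⟨k * 2 ^ j + i, bound j i i.2⟩ : Fin (2 ^ (n + j)))) =
          ⟨k * 2 ^ j + i', bound j i' i'.2⟩ := eq_of_heq (Sigma.mk.inj h').2
      have h3 : k * 2 ^ j + (i : ℕ) = k * 2 ^ j + i' := congrArg Fin.val h2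
      have : i = i' := Fin.ext (by omega)
      rw [this]
    · rintro ⟨⟨n', k', hk'⟩, hs⟩
      obtain ⟨j, i, hi, rfl, rfl⟩ := (dyadicIco_subset_iff hlr).1 hs
      exact ⟨⟨j, ⟨i, hi⟩⟩, rfl⟩
  rw [← (Equiv.ofBijective g hg).tsum_eq]
  rw [subMass]
  change ∑' x : (Σ j : ℕ, Fin (2 ^ j)), a (n + x.1) (k * 2 ^ x.1 + x.2) = _
  rw [ENNReal.tsum_sigma (fun j (i : Fin (2 ^ j)) => a (n + j) (k * 2 ^ j + i))]
  refine tsum_congr fun j => ?_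
  rw [tsum_fintype, Finset.sum_range]

/-- The extension of a family indexed by dyadic intervals to all pairs of natural numbers by `0`. -/
def extendIndex (α : DyadicIndex → ℝ≥0) (n k : ℕ) : ℝ≥0∞ :=
  if h : k < 2 ^ n then α ⟨n, ⟨k, h⟩⟩ else 0

lemma extendIndex_apply (α : DyadicIndex → ℝ≥0) (J : DyadicIndex) :
    extendIndex α J.1 J.2 = α J := by
  simp [extendIndex]

lemma extendIndex_ne_top (α : DyadicIndex → ℝ≥0) (n k : ℕ) : extendIndex α n k ≠ ∞ := by
  unfold extendIndex; split_ifs <;> simp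

lemma carlesonMass_eq (hlr : l < r) (μ : Measure ℝ) (α : DyadicIndex → ℝ≥0) (J : DyadicIndex) :
    carlesonMass l r μ α J = μ (dyadicIco l r J.1 J.2) + subMass (extendIndex α) J.1 J.2 := by
  rw [carlesonMass, ← tsum_subset_dyadicInterval hlr, dyadicInterval_eq]
  simp_rw [extendIndex_apply]

end Dyadic

/-! ### Gluing and scaling of attained values -/

section Attained

variable {p : ℝ}

/-- The values of the functional that are attained, on every interval, by triples with `μ = 0`
(for the bounds `m = 0` and `M = 1`). -/
def attained (p x₁ x₂ s : ℝ) : Set ℝ :=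
  {f | 0 ≤ f ∧ ∀ l r : ℝ, l < r → ∃ (φ : ℝ → ℝ≥0) (a : ℕ → ℕ → ℝ≥0), Measurable φ ∧
    ∫⁻ t in Ico l r, (φ t : ℝ≥0∞) = ENNReal.ofReal (x₁ * (r - l)) ∧
    ∫⁻ t in Ico l r, (φ t : ℝ≥0∞) ^ p = ENNReal.ofReal (x₂ * (r - l)) ∧
    subMass (fun n k => (a n k : ℝ≥0∞)) 0 0 = ENNReal.ofReal (s * (r - l)) ∧
    (∀ n k, k < 2 ^ n →
      subMass (fun n k => (a n k : ℝ≥0∞)) n k ≤ ENNReal.ofReal ((r - l) / 2 ^ n)) ∧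
    subMass (fun n k => (⨍⁻ t in dyadicIco l r n k, (φ t : ℝ≥0∞) ∂volume) ^ p * (a n k : ℝ≥0∞)) 0 0 =
      ENNReal.ofReal (f * (r - l))}

lemma subMass_succ_left {b b₁ : ℕ → ℕ → ℝ≥0∞} (h : ∀ n k, k < 2 ^ n → b (n + 1) k = b₁ n k)
    {n k : ℕ} (hk : k < 2 ^ n) : subMass b (n + 1) k = subMass b₁ n k := by
  refine tsum_congr fun j => Finset.sum_congr rfl fun i hi => ?_
  rw [add_right_comm]
  apply h
  have hi' := Finset.mem_range.1 hi
  rw [pow_add]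
  have : (k + 1) * 2 ^ j ≤ 2 ^ n * 2 ^ j := by gcongr; omega
  nlinarith

lemma subMass_succ_right {b b₂ : ℕ → ℕ → ℝ≥0∞}
    (h : ∀ n k, k < 2 ^ n → b (n + 1) (2 ^ n + k) = b₂ n k)
    {n k : ℕ} (hk : k < 2 ^ n) : subMass b (n + 1) (2 ^ n + k) = subMass b₂ n k := by
  refine tsum_congr fun j => Finset.sum_congr rfl fun i hi => ?_
  rw [add_right_comm, add_mul, ← pow_add, add_assoc (2 ^ (n + j))]
  apply h
  have hi' := Finset.mem_range.1 hi
  rw [pow_add]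
  have : (k + 1) * 2 ^ j ≤ 2 ^ n * 2 ^ j := by gcongr; omega
  nlinarith

lemma subMass_const_mul (c : ℝ≥0∞) (b : ℕ → ℕ → ℝ≥0∞) (n k : ℕ) :
    subMass (fun n k => c * b n k) n k = c * subMass b n k := by
  simp_rw [subMass, ← Finset.mul_sum, ENNReal.tsum_mul_left]

lemma subMass_single (b : ℕ → ℕ → ℝ≥0∞) (hb : ∀ n k, n ≠ 0 → b n k = 0) (n k : ℕ) :
    subMass b n k = b n k := by
  rw [subMass, tsum_eq_single 0]
  · simp
  · intro j hj
    exact Finset.sum_eq_zero fun i _ => hb _ _ (by omega)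

lemma dyadicIco_succ_left (l r : ℝ) (n k : ℕ) :
    dyadicIco l r (n + 1) k = dyadicIco l ((l + r) / 2) n k := by
  have : (r - l) / 2 ^ (n + 1) = ((l + r) / 2 - l) / 2 ^ n := by rw [pow_succ]; field_simp; ring
  rw [dyadicIco, dyadicIco, this]

lemma dyadicIco_succ_right (l r : ℝ) (n k : ℕ) :
    dyadicIco l r (n + 1) (2 ^ n + k) = dyadicIco ((l + r) / 2) r n k := by
  have : (r - l) / 2 ^ (n + 1) = (r - (l + r) / 2) / 2 ^ n := by rw [pow_succ]; field_simp; ring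
  rw [dyadicIco, dyadicIco, this]
  push_cast
  congr 1 <;> (field_simp; ring)

lemma setLAverage_congr_fun' {μ : Measure ℝ} {s : Set ℝ} (hs : MeasurableSet s) {f g : ℝ → ℝ≥0∞}
    (h : EqOn f g s) : ⨍⁻ t in s, f t ∂μ = ⨍⁻ t in s, g t ∂μ := by
  rw [setLAverage_eq, setLAverage_eq, setLIntegral_congr_fun hs h]

lemma ofReal_glue {a b d : ℝ} (ha : 0 ≤ a) (hb : 0 ≤ b) (hd : 0 ≤ d) :
    ENNReal.ofReal (a * (d / 2)) + ENNReal.ofReal (b * (d / 2)) =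
      ENNReal.ofReal ((a + b) / 2 * d) := by
  rw [← ENNReal.ofReal_add (by positivity) (by positivity)]
  congr 1; ring

/-- Realise the two sets of data on the left and right halves and give the whole interval the
coefficient `β (r - l)`. The bound by `1` on the total is the only new constraint, since the proper
subintervals lie in one of the halves. -/
lemma attained_glue {x₁ x₂ s y₁ y₂ t f g β : ℝ} (hx1 : 0 ≤ x₁) (hx2 : 0 ≤ x₂)
    (hs : 0 ≤ s) (hy1 : 0 ≤ y₁) (hy2 : 0 ≤ y₂) (ht : 0 ≤ t) (hβ : 0 ≤ β)
    (hsum : (s + t) / 2 + β ≤ 1) (hp : 0 < p)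
    (hf : f ∈ attained p x₁ x₂ s) (hg : g ∈ attained p y₁ y₂ t) :
    (f + g) / 2 + β * ((x₁ + y₁) / 2) ^ p ∈
      attained p ((x₁ + y₁) / 2) ((x₂ + y₂) / 2) ((s + t) / 2 + β) := by
  obtain ⟨hf0, hf⟩ := hf
  obtain ⟨hg0, hg⟩ := hg
  refine ⟨by positivity, fun l r hlr => ?_⟩
  have hd : 0 < r - l := sub_pos.2 hlr
  set c := (l + r) / 2 with hc
  have hlc : l < c := by rw [hc]; linarith
  have hcr : c < r := by rw [hc]; linarith
  have ecl : c - l = (r - l) / 2 := by rw [hc]; ring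
  have erc : r - c = (r - l) / 2 := by rw [hc]; ring
  obtain ⟨φ₁, a₁, m1, i1, j1, s1, b1, v1⟩ := hf l c hlc
  obtain ⟨φ₂, a₂, m2, i2, j2, s2, b2, v2⟩ := hg c r hcr
  rw [ecl] at i1 j1 s1 v1
  rw [erc] at i2 j2 s2 v2
  let φ : ℝ → ℝ≥0 := fun t => if t < c then φ₁ t else φ₂ t
  let a : ℕ → ℕ → ℝ≥0 := fun n k => match n with
    | 0 => (β * (r - l)).toNNReal
    | n + 1 => if k < 2 ^ n then a₁ n k else a₂ n (k - 2 ^ n)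
  have eφ1 : EqOn φ φ₁ (Ico l c) := fun t ht => if_pos ht.2
  have eφ2 : EqOn φ φ₂ (Ico c r) := fun t ht => if_neg (not_lt.2 ht.1)
  have ea1 : ∀ n k, k < 2 ^ n → a (n + 1) k = a₁ n k := fun n k hk => if_pos hk
  have ea2 : ∀ n k, k < 2 ^ n → a (n + 1) (2 ^ n + k) = a₂ n k := fun n k hk => by
    simp [a]
  have eA1 : ∀ n k, k < 2 ^ n → ⨍⁻ t in dyadicIco l r (n + 1) k, (φ t : ℝ≥0∞) ∂volume =
      ⨍⁻ t in dyadicIco l c n k, (φ₁ t : ℝ≥0∞) ∂volume := fun n k hk => by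
    rw [dyadicIco_succ_left]
    refine setLAverage_congr_fun' (measurableSet_dyadicIco _ _) fun t ht => ?_
    simp only [eφ1 (dyadicIco_subset_Ico hlc hk ht)]
  have eA2 : ∀ n k, k < 2 ^ n → ⨍⁻ t in dyadicIco l r (n + 1) (2 ^ n + k), (φ t : ℝ≥0∞) ∂volume =
      ⨍⁻ t in dyadicIco c r n k, (φ₂ t : ℝ≥0∞) ∂volume := fun n k hk => by
    rw [dyadicIco_succ_right]
    refine setLAverage_congr_fun' (measurableSet_dyadicIco _ _) fun t ht => ?_
    simp only [eφ2 (dyadicIco_subset_Ico hcr hk ht)]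
  have split : ∀ G : ℝ≥0 → ℝ≥0∞, ∫⁻ t in Ico l r, G (φ t) =
      (∫⁻ t in Ico l c, G (φ₁ t)) + ∫⁻ t in Ico c r, G (φ₂ t) := by
    intro G
    rw [← Ico_union_Ico_eq_Ico hlc.le hcr.le,
      lintegral_union measurableSet_Ico (Ico_disjoint_Ico_same (a := l) (b := c) (c := r)),
      setLIntegral_congr_fun (g := fun t => G (φ₁ t)) measurableSet_Ico
        (fun t ht => congrArg G (eφ1 ht)),
      setLIntegral_congr_fun (g := fun t => G (φ₂ t)) measurableSet_Ico
        (fun t ht => congrArg G (eφ2 ht))]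
  have int1 : ∫⁻ t in Ico l r, (φ t : ℝ≥0∞) = ENNReal.ofReal ((x₁ + y₁) / 2 * (r - l)) := by
    rw [split (fun x => (x : ℝ≥0∞)), i1, i2, ofReal_glue hx1 hy1 hd.le]
  have S1 : subMass (fun n k => (a n k : ℝ≥0∞)) 1 0 = ENNReal.ofReal (s * ((r - l) / 2)) := by
    rw [← s1]
    exact subMass_succ_left (fun n k hk => by rw [ea1 n k hk]) (by simp)
  have S2 : subMass (fun n k => (a n k : ℝ≥0∞)) 1 1 = ENNReal.ofReal (t * ((r - l) / 2)) := by
    rw [← s2]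
    exact subMass_succ_right (n := 0) (k := 0) (fun n k hk => by rw [ea2 n k hk]) (by simp)
  have S0 : subMass (fun n k => (a n k : ℝ≥0∞)) 0 0 =
      ENNReal.ofReal (((s + t) / 2 + β) * (r - l)) := by
    rw [subMass_eq, S1, S2, ofReal_glue hs ht hd.le]
    change ENNReal.ofReal (β * (r - l)) + _ = _
    rw [← ENNReal.ofReal_add (by positivity) (by positivity)]
    congr 1; ring
  refine ⟨φ, a, Measurable.ite measurableSet_Iio m1 m2, int1, ?_, S0, ?_, ?_⟩
  · rw [split (fun x => (x : ℝ≥0∞) ^ p), j1, j2, ofReal_glue hx2 hy2 hd.le]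
  · intro n k hk
    rcases n with _ | n
    · obtain rfl : k = 0 := by simpa using hk
      rw [S0, pow_zero, div_one]
      exact ENNReal.ofReal_le_ofReal (by nlinarith)
    · have e : (r - l) / 2 ^ (n + 1) = (r - l) / 2 / 2 ^ n := by rw [pow_succ]; field_simp
      by_cases hk' : k < 2 ^ n
      · rw [subMass_succ_left (fun n k hk => by rw [ea1 n k hk]) hk', e, ← ecl]
        exact b1 n k hk'
      · obtain ⟨k, rfl⟩ := Nat.exists_eq_add_of_le (not_lt.1 hk')
        have hk2 : k < 2 ^ n := by rw [pow_succ] at hk; omega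
        rw [subMass_succ_right (fun n k hk => by rw [ea2 n k hk]) hk2, e, ← erc]
        exact b2 n k hk2
  · have V1 : subMass (fun n k => (⨍⁻ t in dyadicIco l r n k, (φ t : ℝ≥0∞) ∂volume) ^ p *
        (a n k : ℝ≥0∞)) 1 0 = ENNReal.ofReal (f * ((r - l) / 2)) := by
      rw [← v1]
      exact subMass_succ_left (fun n k hk => by rw [ea1 n k hk, eA1 n k hk]) (by simp)
    have V2 : subMass (fun n k => (⨍⁻ t in dyadicIco l r n k, (φ t : ℝ≥0∞) ∂volume) ^ p *
        (a n k : ℝ≥0∞)) 1 1 = ENNReal.ofReal (g * ((r - l) / 2)) := by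
      rw [← v2]
      exact subMass_succ_right (n := 0) (k := 0)
        (fun n k hk => by rw [ea2 n k hk, eA2 n k hk]) (by simp)
    rw [subMass_eq, V1, V2, ofReal_glue hf0 hg0 hd.le]
    rw [dyadicIco_zero, setLAverage_eq, int1, Real.volume_Ico,
      ← ENNReal.ofReal_div_of_pos hd, mul_div_cancel_right₀ _ hd.ne',
      ENNReal.ofReal_rpow_of_nonneg (by positivity) hp.le]
    change _ * ENNReal.ofReal (β * (r - l)) + _ = _
    rw [← ENNReal.ofReal_mul (by positivity), ← ENNReal.ofReal_add (by positivity) (by positivity)]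
    congr 1; ring

lemma attained_smul {x₁ x₂ s f ρ : ℝ} (hp : 0 < p) (hρ : 0 ≤ ρ)
    (hf : f ∈ attained p x₁ x₂ s) : ρ ^ p * f ∈ attained p (ρ * x₁) (ρ ^ p * x₂) s := by
  obtain ⟨hf0, hf⟩ := hf
  have hρp : 0 ≤ ρ ^ p := by positivity
  refine ⟨by positivity, fun l r hlr => ?_⟩
  obtain ⟨φ, a, m1, i1, j1, s1, b1, v1⟩ := hf l r hlr
  have ec : ∀ t, ((ρ.toNNReal * φ t : ℝ≥0) : ℝ≥0∞) = ENNReal.ofReal ρ * φ t := fun t => by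
    rw [ENNReal.coe_mul]; rfl
  refine ⟨fun t => ρ.toNNReal * φ t, a, m1.const_mul _, ?_, ?_, s1, b1, ?_⟩
  · simp_rw [ec]
    rw [lintegral_const_mul _ m1.coe_nnreal_ennreal, i1, ← ENNReal.ofReal_mul hρ, mul_assoc]
  · simp_rw [ec, ENNReal.mul_rpow_of_nonneg _ _ hp.le]
    rw [lintegral_const_mul _ (m1.coe_nnreal_ennreal.pow_const p), j1,
      ENNReal.ofReal_rpow_of_nonneg hρ hp.le, ← ENNReal.ofReal_mul hρp, mul_assoc]
  · simp_rw [ec]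
    have : ∀ n k, (⨍⁻ t in dyadicIco l r n k, ENNReal.ofReal ρ * (φ t : ℝ≥0∞) ∂volume) ^ p * (a n k : ℝ≥0∞)
        = ENNReal.ofReal (ρ ^ p) *
          ((⨍⁻ t in dyadicIco l r n k, (φ t : ℝ≥0∞) ∂volume) ^ p * (a n k : ℝ≥0∞)) := by
      intro n k
      rw [setLAverage_eq, lintegral_const_mul _ m1.coe_nnreal_ennreal, mul_div_assoc,
        ← setLAverage_eq, ENNReal.mul_rpow_of_nonneg _ _ hp.le,
        ENNReal.ofReal_rpow_of_nonneg hρ hp.le, mul_assoc]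
    simp_rw [this]
    rw [subMass_const_mul, v1, ← ENNReal.ofReal_mul hρp, mul_assoc]

/-- The height and the relative length of the support of a test function which is constant on its
support and has the prescribed averages. -/
lemma exists_height_length {x₁ X : ℝ} (hp : 1 < p) (hx1 : 0 < x₁) (hX : x₁ ^ p ≤ X) :
    ∃ κ θ : ℝ, 0 < κ ∧ 0 < θ ∧ θ ≤ 1 ∧ θ ^ (p - 1) = x₁ ^ p / X ∧ κ * θ = x₁ ∧ κ ^ p * θ = X := by
  have hx : 0 < x₁ ^ p := Real.rpow_pos_of_pos hx1 p
  have hX0 : 0 < X := by linarith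
  have hp1 : p - 1 ≠ 0 := by linarith
  set θ := (x₁ ^ p / X) ^ (1 / (p - 1)) with hθ
  have hθ0 : 0 < θ := Real.rpow_pos_of_pos (by positivity) _
  have hθp : θ ^ (p - 1) = x₁ ^ p / X := by
    rw [hθ, ← Real.rpow_mul (by positivity), one_div_mul_cancel hp1, Real.rpow_one]
  refine ⟨x₁ / θ, θ, by positivity, hθ0,
    Real.rpow_le_one (by positivity) ((div_le_one hX0).2 hX) (by
      have : 0 < p - 1 := by linarith
      positivity), hθp, by field_simp, ?_⟩
  have : θ ^ p = θ ^ (p - 1) * θ := by rw [← Real.rpow_add_one hθ0.ne']; ring_nf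
  rw [Real.div_rpow hx1.le hθ0.le, this, hθp]
  field_simp

lemma lintegral_indicator_Ico {l r κ θ : ℝ} (hlr : l < r) (hθ1 : θ ≤ 1)
    (hκ : 0 ≤ κ) :
    ∫⁻ t in Ico l r, (Ico l (l + θ * (r - l))).indicator (fun _ => ENNReal.ofReal κ) t =
      ENNReal.ofReal (κ * θ * (r - l)) := by
  have hd : 0 < r - l := sub_pos.2 hlr
  rw [lintegral_indicator measurableSet_Ico, lintegral_const, Measure.restrict_apply_univ,
    Measure.restrict_apply measurableSet_Ico,
    Ico_inter_Ico, max_self, min_eq_left (by nlinarith), Real.volume_Ico, ← ENNReal.ofReal_mul hκ]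
  congr 1; ring

/-- The explicit support at the left end matters for the lower Bellman function, where the surplus
of the measure is put to the right of it. -/
lemma exists_testFunction {x₁ X l r : ℝ} (hp : 1 < p) (hx1 : 0 < x₁) (hX : x₁ ^ p ≤ X)
    (hlr : l < r) :
    ∃ (φ : ℝ → ℝ≥0) (θ : ℝ), Measurable φ ∧ 0 < θ ∧ θ ≤ 1 ∧ θ ^ (p - 1) = x₁ ^ p / X ∧
      (∀ t, l + θ * (r - l) ≤ t → φ t = 0) ∧
      ∫⁻ t in Ico l r, (φ t : ℝ≥0∞) = ENNReal.ofReal (x₁ * (r - l)) ∧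
      ∫⁻ t in Ico l r, (φ t : ℝ≥0∞) ^ p = ENNReal.ofReal (X * (r - l)) := by
  obtain ⟨κ, θ, hκ, hθ, hθ1, hθp, h1, h2⟩ := exists_height_length hp hx1 hX
  have hp0 : 0 < p := by linarith
  refine ⟨(Ico l (l + θ * (r - l))).indicator fun _ => κ.toNNReal, θ,
    measurable_const.indicator measurableSet_Ico, hθ, hθ1, hθp, ?_, ?_, ?_⟩
  · intro t ht
    exact indicator_of_notMem (fun h => absurd h.2 (not_lt.2 ht)) _
  · rw [← h1, ← lintegral_indicator_Ico hlr hθ1 hκ.le]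
    refine lintegral_congr fun t => ?_
    by_cases ht : t ∈ Ico l (l + θ * (r - l)) <;> simp [ht, ENNReal.ofReal]
  · rw [← h2, ← lintegral_indicator_Ico hlr hθ1 (by positivity)]
    refine lintegral_congr fun t => ?_
    by_cases ht : t ∈ Ico l (l + θ * (r - l))
    · simp only [ht, indicator_of_mem]
      rw [← ENNReal.ofReal_rpow_of_nonneg hκ.le hp0.le]; rfl
    · simp [ht, hp0]

/-- All the mass is a single coefficient at the whole interval, so only the average of the test
function enters. These are the seeds of the later constructions. -/
lemma attained_root {x₁ X s : ℝ} (hp : 1 < p) (hx1 : 0 < x₁) (hX : x₁ ^ p ≤ X) (hs0 : 0 ≤ s)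
    (hs1 : s ≤ 1) : s * x₁ ^ p ∈ attained p x₁ X s := by
  refine ⟨by positivity, fun l r hlr => ?_⟩
  have hd : 0 < r - l := sub_pos.2 hlr
  obtain ⟨φ, θ, hφ, -, -, -, -, h1, h2⟩ := exists_testFunction hp hx1 hX hlr
  let a : ℕ → ℕ → ℝ≥0 := fun n _ => if n = 0 then (s * (r - l)).toNNReal else 0
  have ha : ∀ n k, subMass (fun n k => (a n k : ℝ≥0∞)) n k = a n k := fun n k =>
    subMass_single _ (fun n k hn => by simp [a, hn]) n k
  refine ⟨φ, a, hφ, h1, h2, ?_, ?_, ?_⟩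
  · rw [ha]; rfl
  · intro n k _
    rw [ha]
    by_cases hn : n = 0
    · subst hn
      change ENNReal.ofReal (s * (r - l)) ≤ _
      exact ENNReal.ofReal_le_ofReal (by rw [pow_zero, div_one]; nlinarith)
    · simp [a, hn]
  · rw [subMass_single _ (fun n k hn => by simp [a, hn]), dyadicIco_zero, setLAverage_eq, h1,
      Real.volume_Ico, ← ENNReal.ofReal_div_of_pos hd, mul_div_cancel_right₀ _ hd.ne',
      ENNReal.ofReal_rpow_of_nonneg hx1.le (by linarith)]
    change _ * ENNReal.ofReal (s * (r - l)) = _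
    rw [← ENNReal.ofReal_mul (by positivity)]
    congr 1; ring

/-- Affine reduction to `m = 0`, `M = 1`: take `m` times Lebesgue measure for `μ`, which contributes
`m x₂`, and multiply the coefficients by `M - m`. -/
lemma mem_bellmanValues_of_attained {m M l r x₁ x₂ s f : ℝ} (hm : 0 ≤ m)
    (hmM : m < M) (hlr : l < r) (hx2 : 0 ≤ x₂) (hs : 0 ≤ s)
    (hf : f ∈ attained p x₁ x₂ s) :
    ENNReal.ofReal (m * x₂ + (M - m) * f) ∈
      bellmanValues p m M l r x₁ x₂ (m + (M - m) * s) := by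
  obtain ⟨hf0, hf⟩ := hf
  have hd : 0 < r - l := sub_pos.2 hlr
  have hW : 0 < M - m := sub_pos.2 hmM
  obtain ⟨φ, a, m1, i1, j1, s1, b1, v1⟩ := hf l r hlr
  let α : DyadicIndex → ℝ≥0 := fun J => (M - m).toNNReal * a J.1 J.2
  have eα : ∀ J, (α J : ℝ≥0∞) = ENNReal.ofReal (M - m) * a J.1 J.2 := fun J => by
    rw [ENNReal.coe_mul]; rfl
  have mass : ∀ J, carlesonMass l r (ENNReal.ofReal m • volume) α J =
      ENNReal.ofReal m * volume (dyadicInterval l r J) +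
        ENNReal.ofReal (M - m) * subMass (fun n k => (a n k : ℝ≥0∞)) J.1 J.2 := by
    intro J
    rw [carlesonMass]
    simp_rw [eα]
    rw [ENNReal.tsum_mul_left, tsum_subset_dyadicInterval hlr (fun n k => (a n k : ℝ≥0∞)) J]
    simp
  refine ⟨φ, ENNReal.ofReal m • volume, α, ⟨m1, ?_, ?_, ?_, ?_, ?_, ?_⟩, ?_⟩
  · intro t; simp
  · rw [setLAverage_eq, i1, Real.volume_Ico, ← ENNReal.ofReal_div_of_pos hd,
      mul_div_cancel_right₀ _ hd.ne']
  · rw [setLAverage_eq, j1, Real.volume_Ico, ← ENNReal.ofReal_div_of_pos hd,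
      mul_div_cancel_right₀ _ hd.ne']
  · simp_rw [eα]
    rw [ENNReal.tsum_mul_left, tsum_dyadicIndex (fun n k => (a n k : ℝ≥0∞)), ← subMass_zero_zero, s1,
      Measure.smul_apply, smul_eq_mul, Real.volume_Ico, ← ENNReal.ofReal_mul hm,
      ← ENNReal.ofReal_mul hW.le, ← ENNReal.ofReal_add (by positivity) (by positivity),
      ← ENNReal.ofReal_div_of_pos hd]
    congr 1
    field_simp
  · intro J
    rw [mass]
    exact le_self_add
  · intro J
    rw [mass]
    calc _ ≤ ENNReal.ofReal m * volume (dyadicInterval l r J) +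
        ENNReal.ofReal (M - m) * volume (dyadicInterval l r J) := by
          gcongr
          rw [dyadicInterval_eq, volume_dyadicIco]
          exact b1 J.1 J.2 J.2.2
      _ = _ := by
          rw [← add_mul, ← ENNReal.ofReal_add hm hW.le]; congr 2; ring
  · have : ∑' J : DyadicIndex,
        (⨍⁻ t in dyadicInterval l r J, (φ t : ℝ≥0∞) ∂volume) ^ p * (α J : ℝ≥0∞) =
        ENNReal.ofReal (M - m) * ENNReal.ofReal (f * (r - l)) := by
      rw [← v1, subMass_zero_zero, ← tsum_dyadicIndex (fun n k =>
        (⨍⁻ t in dyadicIco l r n k, (φ t : ℝ≥0∞) ∂volume) ^ p * (a n k : ℝ≥0∞)), ← ENNReal.tsum_mul_left]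
      refine tsum_congr fun J => ?_
      rw [eα, dyadicInterval_eq, mul_left_comm]
    rw [carlesonFunctional, this, Measure.restrict_smul, lintegral_smul_measure, j1, smul_eq_mul,
      Real.volume_Ico, ← ENNReal.ofReal_mul hm,
      ← ENNReal.ofReal_mul hW.le, ← ENNReal.ofReal_add (by positivity) (by positivity),
      ← ENNReal.ofReal_div_of_pos hd]
    congr 1
    field_simp

end Attained

/-! ### Extremal sequences -/

section Extremal

open Filter Topology

variable {p : ℝ}

lemma closure_attained_glue {x₁ x₂ s y₁ y₂ t f g β : ℝ} (hx1 : 0 ≤ x₁) (hx2 : 0 ≤ x₂)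
    (hs : 0 ≤ s) (hy1 : 0 ≤ y₁) (hy2 : 0 ≤ y₂) (ht : 0 ≤ t) (hβ : 0 ≤ β)
    (hsum : (s + t) / 2 + β ≤ 1) (hp : 0 < p)
    (hf : f ∈ closure (attained p x₁ x₂ s)) (hg : g ∈ closure (attained p y₁ y₂ t)) :
    (f + g) / 2 + β * ((x₁ + y₁) / 2) ^ p ∈
      closure (attained p ((x₁ + y₁) / 2) ((x₂ + y₂) / 2) ((s + t) / 2 + β)) :=
  map_mem_closure₂ (f := fun f g => (f + g) / 2 + β * ((x₁ + y₁) / 2) ^ p) (by fun_prop) hf hg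
    fun _ hf _ hg => attained_glue hx1 hx2 hs hy1 hy2 ht hβ hsum hp hf hg

/-- Two copies of the same data are glued, so the averages do not change and only the new
coefficient is felt. -/
lemma closure_attained_jump {x₁ x₂ s f β : ℝ} (hx1 : 0 ≤ x₁) (hx2 : 0 ≤ x₂)
    (hs : 0 ≤ s) (hβ : 0 ≤ β) (hsum : s + β ≤ 1) (hp : 0 < p)
    (hf : f ∈ closure (attained p x₁ x₂ s)) :
    f + β * x₁ ^ p ∈ closure (attained p x₁ x₂ (s + β)) := by
  have := closure_attained_glue hx1 hx2 hs hx1 hx2 hs hβ (by linarith) hp hf hf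
  simpa using this

lemma closure_attained_smul {x₁ x₂ s f ρ : ℝ} (hp : 0 < p) (hρ : 0 ≤ ρ)
    (hf : f ∈ closure (attained p x₁ x₂ s)) :
    ρ ^ p * f ∈ closure (attained p (ρ * x₁) (ρ ^ p * x₂) s) :=
  map_mem_closure (f := fun f => ρ ^ p * f) (by fun_prop) hf fun _ hf => attained_smul hp hρ hf

/-- Mixing with a dyadic weight `j / 2 ^ k` is `k`-fold gluing without coefficients: write `j = j₁ +
j₂` with both terms at most `2 ^ k` and average the two mixtures of the previous level. -/
lemma closure_attained_mix {x₁ x₂ s y₁ y₂ t f g : ℝ} (hx1 : 0 ≤ x₁) (hx2 : 0 ≤ x₂)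
    (hs : 0 ≤ s) (hs1 : s ≤ 1) (hy1 : 0 ≤ y₁) (hy2 : 0 ≤ y₂) (ht : 0 ≤ t) (ht1 : t ≤ 1)
    (hp : 0 < p) (hf : f ∈ closure (attained p x₁ x₂ s)) (hg : g ∈ closure (attained p y₁ y₂ t))
    (k j : ℕ) (hj : j ≤ 2 ^ k) {θ : ℝ} (hθ : θ = j / 2 ^ k) :
    θ * f + (1 - θ) * g ∈ closure (attained p (θ * x₁ + (1 - θ) * y₁)
      (θ * x₂ + (1 - θ) * y₂) (θ * s + (1 - θ) * t)) := by
  induction k generalizing j θ with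
  | zero =>
    have : j = 0 ∨ j = 1 := by simp at hj; omega
    rcases this with rfl | rfl
    · have : θ = 0 := by simpa using hθ
      subst this; simpa using hg
    · have : θ = 1 := by simpa using hθ
      subst this; simpa using hf
  | succ k ih =>
    obtain ⟨j₁, j₂, h1, h2, rfl⟩ : ∃ j₁ j₂, j₁ ≤ 2 ^ k ∧ j₂ ≤ 2 ^ k ∧ j = j₁ + j₂ :=
      ⟨min j (2 ^ k), j - min j (2 ^ k), by omega, by rw [pow_succ] at hj; omega, by omega⟩
    have ub : ∀ i : ℕ, i ≤ 2 ^ k → 0 ≤ (i : ℝ) / 2 ^ k ∧ (i : ℝ) / 2 ^ k ≤ 1 := fun i hi =>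
      ⟨by positivity, (div_le_one (by positivity)).2 (by exact_mod_cast hi)⟩
    have i1 := ih j₁ h1 rfl
    have i2 := ih j₂ h2 rfl
    obtain ⟨a1, b1⟩ := ub j₁ h1
    obtain ⟨a2, b2⟩ := ub j₂ h2
    have hθ' : θ = ((j₁ : ℝ) / 2 ^ k + j₂ / 2 ^ k) / 2 := by
      rw [hθ, pow_succ]; push_cast; field_simp
    generalize (j₁ : ℝ) / 2 ^ k = θ₁ at *
    generalize (j₂ : ℝ) / 2 ^ k = θ₂ at *
    have c1 := sub_nonneg.2 b1
    have c2 := sub_nonneg.2 b2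
    have := closure_attained_glue (β := 0) (by positivity) (by positivity) (by positivity)
      (by positivity) (by positivity) (by positivity) le_rfl (by nlinarith) hp i1 i2
    rw [hθ']
    convert this using 1
    · congr 2 <;> ring
    · ring

/-- The self-similar extremal point with third coordinate `1`. -/
lemma closure_attained_selfSimilar {v δ ρ m₁ m₂ : ℝ} (hp : 1 < p) (hv : v < 1) (k : ℕ)
    (hk : k ≠ 0) (hδ : δ = 1 / 2 ^ k) (hρ : ρ = 1 + δ * v / (1 - δ)) (hρ0 : 0 < ρ)
    (hr : (1 - δ) * ρ ^ p < 1) (hm₁ : m₁ = 1 / (1 - v)) (hm₂ : m₂ = δ / (1 - (1 - δ) * ρ ^ p)) :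
    m₁ ^ p * m₂ ∈ closure (attained p m₁ m₂ 1) := by
  have hp0 : 0 < p := by linarith
  have hδ0 : 0 < δ := by rw [hδ]; positivity
  have hδ1 : δ < 1 := by
    rw [hδ, div_lt_one (by positivity)]
    exact one_lt_pow₀ (by norm_num) hk
  have hδ2 : 0 < 1 - δ := by linarith
  have hv0 : 0 < 1 - v := by linarith
  have hm1 : 0 < m₁ := by rw [hm₁]; positivity
  have hρp : 0 < ρ ^ p := Real.rpow_pos_of_pos hρ0 p
  have hr0 : 0 < 1 - (1 - δ) * ρ ^ p := by linarith
  have hm2 : 0 < m₂ := by rw [hm₂]; positivity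
  have e1 : (1 - δ) * (ρ * m₁) + (1 - (1 - δ)) * 1 = m₁ := by
    rw [hm₁, hρ]; field_simp; ring
  have e2 : (1 - δ) * (ρ ^ p * m₂) + (1 - (1 - δ)) * 1 = m₂ := by
    rw [hm₂]; field_simp; ring
  have hm1p : 0 < m₁ ^ p := Real.rpow_pos_of_pos hm1 p
  have feas : m₁ ^ p ≤ m₂ := by
    have := (convexOn_rpow hp.le).2 (mem_Ici.2 (by positivity : 0 ≤ ρ * m₁))
      (mem_Ici.2 zero_le_one) hδ2.le hδ0.le (by ring)
    simp only [smul_eq_mul, mul_one, Real.one_rpow] at this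
    rw [show (1 - δ) * (ρ * m₁) + δ = m₁ by linarith, Real.mul_rpow hρ0.le hm1.le] at this
    rw [hm₂, le_div_iff₀ hr0]
    linarith
  -- A portion `1 - δ` carries a copy of the data scaled by `ρ`, a portion `δ` carries the constant
  -- `1` without mass, and a coefficient `δ` at the root restores the total mass `1`. The choices of
  -- `ρ` and `m₂` make both averages reproduce themselves.
  have step : ∀ f ∈ closure (attained p m₁ m₂ 1),
      (1 - δ) * ρ ^ p * f + δ * m₁ ^ p ∈ closure (attained p m₁ m₂ 1) := by
    intro f hf
    have h1 := closure_attained_smul hp0 hρ0.le hf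
    have h2 : (0 : ℝ) ∈ closure (attained p 1 1 0) := by
      have := attained_root (p := p) (x₁ := 1) (X := 1) (s := 0) hp one_pos (by simp) le_rfl
        zero_le_one
      rw [zero_mul] at this
      exact subset_closure this
    have h3 := closure_attained_mix (by positivity) (by positivity) zero_le_one le_rfl zero_le_one
      zero_le_one le_rfl zero_le_one hp0 h1 h2 k (2 ^ k - 1) (Nat.sub_le _ _) (θ := 1 - δ) (by
        rw [Nat.cast_sub Nat.one_le_two_pow, hδ]; push_cast; field_simp)
    rw [e1, e2] at h3
    have h4 := closure_attained_jump (β := δ) hm1.le hm2.le (by linarith) hδ0.le (by linarith)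
      hp0 h3
    convert h4 using 1
    · congr 2; ring
    · ring
  -- The step acts on values as an affine map with slope `(1 - δ) ρ ^ p < 1` and fixed point `m₁ ^ p
  -- m₂`; the iteration starts at the value `m₁ ^ p` of `attained_root`.
  have iter : ∀ n : ℕ, m₁ ^ p * m₂ + ((1 - δ) * ρ ^ p) ^ n * (m₁ ^ p - m₁ ^ p * m₂) ∈
      closure (attained p m₁ m₂ 1) := by
    intro n
    induction n with
    | zero =>
      have := attained_root hp hm1 feas zero_le_one le_rfl
      rw [one_mul] at this
      simpa using subset_closure this
    | succ n ih =>
      have := step _ ih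
      convert this using 1
      have : m₂ * (1 - (1 - δ) * ρ ^ p) = δ := by rw [hm₂]; field_simp
      rw [pow_succ]
      linear_combination m₁ ^ p * this
  have lim : Tendsto (fun n : ℕ => m₁ ^ p * m₂ + ((1 - δ) * ρ ^ p) ^ n * (m₁ ^ p - m₁ ^ p * m₂))
      atTop (𝓝 (m₁ ^ p * m₂)) := by
    have := ((tendsto_pow_atTop_nhds_zero_of_lt_one (by positivity) hr).mul_const
      (m₁ ^ p - m₁ ^ p * m₂)).const_add (m₁ ^ p * m₂)
    simpa using this
  exact isClosed_closure.mem_of_tendsto lim (Eventually.of_forall iter)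

/-- The expression is the reciprocal of minus the difference quotient at `0` of `(1 - δ) ρ ^ p`,
whose derivative there is `p v - 1`. -/
lemma tendsto_selfSimilar_average {v : ℝ} (hv : p * v < 1) :
    Tendsto (fun δ : ℝ => δ / (1 - (1 - δ) * (1 + δ * v / (1 - δ)) ^ p)) (𝓝[>] 0)
      (𝓝 (1 / (1 - p * v))) := by
  have hd : HasDerivAt (fun δ : ℝ => (1 - δ) * (1 + δ * v / (1 - δ)) ^ p) (p * v - 1) 0 := by
    have h1 : HasDerivAt (fun δ : ℝ => 1 - δ) (-1) 0 := (hasDerivAt_id 0).const_sub 1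
    have h2 : HasDerivAt (fun δ : ℝ => δ * v) v 0 := by
      simpa using (hasDerivAt_id (0 : ℝ)).mul_const v
    have h3 : HasDerivAt (fun δ : ℝ => 1 + δ * v / (1 - δ)) v 0 := by
      have := (h2.div h1 (by norm_num)).const_add 1
      simpa using this
    have h4 := h3.rpow_const (p := p) (Or.inl (by norm_num))
    have := h1.mul h4
    refine this.congr_deriv ?_
    simp
    ring
  have ht := hd.tendsto_slope_zero_right
  have := (ht.neg).inv₀ (by linarith : -(p * v - 1) ≠ 0)
  convert this using 1
  · funext δ
    rw [smul_eq_mul, ← mul_neg, neg_sub, mul_inv, inv_inv, div_eq_mul_inv]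
    simp
  · congr 1
    rw [neg_sub, one_div]

lemma tendsto_floor_div_two_pow {s : ℝ} :
    Tendsto (fun k : ℕ => (⌊s * 2 ^ k⌋₊ : ℝ) / 2 ^ k) atTop (𝓝 (max s 0)) := by
  rcases le_total s 0 with h | h
  · rw [max_eq_right h]
    refine tendsto_const_nhds.congr fun k => ?_
    rw [Nat.floor_of_nonpos (mul_nonpos_of_nonpos_of_nonneg h (by positivity))]
    simp
  · rw [max_eq_left h]
    exact (tendsto_nat_floor_mul_div_atTop h).comp (tendsto_pow_atTop_atTop_of_one_lt one_lt_two)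

/-- A portion close to `s` carries a multiple of the self-similar data and the rest the matching
constant without mass. The `p`-average of this mixture is below `x₂` in the limit. The deficit is
made up on a portion `δ k`, with data whose value stays bounded, so that the limit of the values is
unaffected. -/
lemma mem_closure_attained_of_lt {x₁ x₂ s v : ℝ} (hp : 1 < p) (hx1 : 0 < x₁)
    (hx2 : x₁ ^ p ≤ x₂) (hs0 : 0 ≤ s) (hs1 : s ≤ 1) (hv1 : v < 1) (hv : p * v < 1)
    (hlt : x₁ ^ p * (s * (1 / (1 - p * v)) + (1 - s)) / (s * (1 / (1 - v)) + (1 - s)) ^ p < x₂) :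
    x₁ ^ p * (s * (1 / (1 - v)) ^ p * (1 / (1 - p * v))) / (s * (1 / (1 - v)) + (1 - s)) ^ p ∈
      closure (attained p x₁ x₂ s) := by
  have hp0 : 0 < p := by linarith
  have hv0 : 0 < 1 - v := by linarith
  set m₁ := 1 / (1 - v) with hm₁
  have hm1 : 0 < m₁ := by positivity
  let δ : ℕ → ℝ := fun k => 1 / 2 ^ k
  let ρ : ℕ → ℝ := fun k => 1 + δ k * v / (1 - δ k)
  let m₂ : ℕ → ℝ := fun k => δ k / (1 - (1 - δ k) * ρ k ^ p)
  let σ : ℕ → ℝ := fun k => (⌊s * 2 ^ k⌋₊ : ℝ) / 2 ^ k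
  let κ : ℕ → ℝ := fun k => x₁ / (σ k * m₁ + (1 - σ k))
  let X : ℕ → ℝ := fun k => κ k ^ p * (σ k * m₂ k + (1 - σ k))
  let f : ℕ → ℝ := fun k => (1 - δ k) * (σ k * (κ k ^ p * (m₁ ^ p * m₂ k)) + (s - σ k) * x₁ ^ p) +
    δ k * (s * x₁ ^ p)
  have hδ0 : ∀ k, 0 < δ k := fun k => by positivity
  have limδ : Tendsto δ atTop (𝓝 0) := by
    have := tendsto_pow_atTop_nhds_zero_of_lt_one (r := (1 / 2 : ℝ)) (by norm_num) (by norm_num)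
    refine this.congr fun k => ?_
    simp [δ]
  have limδ' : Tendsto δ atTop (𝓝[>] 0) :=
    tendsto_nhdsWithin_iff.2 ⟨limδ, Eventually.of_forall hδ0⟩
  have limm₂ : Tendsto m₂ atTop (𝓝 (1 / (1 - p * v))) := (tendsto_selfSimilar_average hv).comp limδ'
  have limσ : Tendsto σ atTop (𝓝 s) := by
    have := tendsto_floor_div_two_pow (s := s)
    rwa [max_eq_left hs0] at this
  have hD : 0 < s * m₁ + (1 - s) := by
    rcases hs0.eq_or_lt with h | h
    · rw [← h]; norm_num
    · have := mul_pos h hm1; linarith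
  have limρ : Tendsto ρ atTop (𝓝 1) := by
    have : Tendsto (fun k => 1 + δ k * v / (1 - δ k)) atTop (𝓝 (1 + 0 * v / (1 - 0))) :=
      ((limδ.mul_const v).div (limδ.const_sub 1) (by norm_num)).const_add 1
    simpa using this
  have limκ : Tendsto (fun k => κ k ^ p) atTop (𝓝 (x₁ ^ p / (s * m₁ + (1 - s)) ^ p)) := by
    have h1 : Tendsto κ atTop (𝓝 (x₁ / (s * m₁ + (1 - s)))) :=
      tendsto_const_nhds.div ((limσ.mul_const m₁).add (limσ.const_sub 1)) hD.ne'
    have := h1.rpow_const (p := p) (Or.inr hp0.le)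
    rwa [Real.div_rpow hx1.le hD.le] at this
  have limX : Tendsto X atTop (𝓝 (x₁ ^ p * (s * (1 / (1 - p * v)) + (1 - s)) /
      (s * m₁ + (1 - s)) ^ p)) := by
    have := limκ.mul ((limσ.mul limm₂).add (limσ.const_sub 1))
    convert this using 2
    ring
  have limf : Tendsto f atTop (𝓝 (x₁ ^ p * (s * m₁ ^ p * (1 / (1 - p * v))) /
      (s * m₁ + (1 - s)) ^ p)) := by
    have := ((limδ.const_sub 1).mul ((limσ.mul (limκ.mul (limm₂.const_mul (m₁ ^ p)))).add
      ((limσ.const_sub s).mul_const (x₁ ^ p)))).add (limδ.mul_const (s * x₁ ^ p))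
    convert this using 2
    ring
  refine isClosed_closure.mem_of_tendsto limf ?_
  have hm₂pos : 0 < 1 / (1 - p * v) := by have : 0 < 1 - p * v := by linarith
                                          positivity
  filter_upwards [eventually_ne_atTop 0, limρ.eventually_const_lt one_pos,
    limm₂.eventually_const_lt hm₂pos, limX.eventually_lt_const hlt] with k hk hρ0 hm2 hX
  -- Positivity of `m₂ k`, known from its limit, forces its denominator to be positive.
  have hr : (1 - δ k) * ρ k ^ p < 1 := by
    by_contra h
    have : m₂ k ≤ 0 := div_nonpos_of_nonneg_of_nonpos (hδ0 k).le (by linarith)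
    linarith
  have hδ1 : δ k ≤ 1 := by
    change 1 / 2 ^ k ≤ (1 : ℝ)
    rw [div_le_one (by positivity)]
    exact one_le_pow₀ (by norm_num)
  have hσ0 : 0 ≤ σ k := by positivity
  have hσs : σ k ≤ s := by
    change (⌊s * 2 ^ k⌋₊ : ℝ) / 2 ^ k ≤ s
    rw [div_le_iff₀ (by positivity)]
    exact Nat.floor_le (by positivity)
  have hσ1 : 0 ≤ 1 - σ k := by linarith
  have hfl : ⌊s * 2 ^ k⌋₊ ≤ 2 ^ k := by
    have : (⌊s * 2 ^ k⌋₊ : ℝ) / 2 ^ k ≤ 1 := hσs.trans hs1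
    rw [div_le_one (by positivity)] at this
    exact_mod_cast this
  have hDσ : 0 < σ k * m₁ + (1 - σ k) := by
    rcases hσ0.eq_or_lt with h | h
    · rw [← h]; norm_num
    · have := mul_pos h hm1; linarith
  have hκ : 0 < κ k := div_pos hx1 hDσ
  have hκp : 0 < κ k ^ p := Real.rpow_pos_of_pos hκ p
  have a1 := closure_attained_smul hp0 hκ.le
    (closure_attained_selfSimilar hp hv1 k hk rfl rfl hρ0 hr hm₁ rfl)
  have a2 : (0 : ℝ) ∈ closure (attained p (κ k) (κ k ^ p) 0) := by
    have := attained_root hp hκ le_rfl le_rfl zero_le_one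
    rw [zero_mul] at this
    exact subset_closure this
  have a3 := closure_attained_mix (by positivity) (by positivity) zero_le_one le_rfl hκ.le hκp.le
    le_rfl zero_le_one hp0 a1 a2 k ⌊s * 2 ^ k⌋₊ hfl (θ := σ k) rfl
  have e1 : σ k * (κ k * m₁) + (1 - σ k) * κ k = x₁ := by
    have : κ k * (σ k * m₁ + (1 - σ k)) = x₁ := div_mul_cancel₀ _ hDσ.ne'
    linarith
  have e2 : σ k * (κ k ^ p * m₂ k) + (1 - σ k) * κ k ^ p = X k := by
    change _ = κ k ^ p * (σ k * m₂ k + (1 - σ k)); ring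
  have hX0 : 0 ≤ X k := by rw [← e2]; positivity
  rw [e1, e2, mul_zero, add_zero, add_zero, mul_one] at a3
  -- The rounding error of the dyadic weight `σ k ≤ s` is supplied as a coefficient at the root.
  have a4 := closure_attained_jump (β := s - σ k) hx1.le hX0 hσ0 (by linarith) (by linarith) hp0 a3
  rw [add_sub_cancel] at a4
  -- The right-hand side is the `p`-average which, with weight `δ k` against `X k`, gives exactly
  -- `x₂`.
  have hX' : x₂ ≤ X k + (x₂ - X k) / δ k := by
    have : x₂ - X k ≤ (x₂ - X k) / δ k := by
      rw [le_div_iff₀ (hδ0 k)]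
      have := sub_pos.2 hX
      nlinarith
    linarith
  have a5 := subset_closure (attained_root hp hx1 (hx2.trans hX') hs0 hs1)
  have hx1p : 0 < x₁ ^ p := Real.rpow_pos_of_pos hx1 p
  have a6 := closure_attained_mix hx1.le hX0 hs0 hs1 hx1.le (by linarith) hs0 hs1 hp0 a4 a5 k
    (2 ^ k - 1) (Nat.sub_le _ _) (θ := 1 - δ k) (by
      rw [Nat.cast_sub Nat.one_le_two_pow]; push_cast
      change 1 - 1 / 2 ^ k = _
      field_simp)
  convert a6 using 1
  · have := (hδ0 k).ne'
    congr 2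
    · ring
    · field_simp; ring
    · ring
  · change (1 - δ k) * (σ k * (κ k ^ p * (m₁ ^ p * m₂ k)) + (s - σ k) * x₁ ^ p) +
      δ k * (s * x₁ ^ p) = _
    ring

/-- At a root the `p`-average of the limiting mixture is exactly `x₂`, whereas the construction
needs room. Moving the parameter from `v` slightly towards `0` increases `scaledRatio` and creates
it; the value depends continuously on the parameter. At `v = 0` a single coefficient suffices. -/
lemma mem_closure_attained_of_root {x₁ x₂ w v : ℝ} (hp : 1 < p) (hx1 : 0 < x₁)
    (hx2 : x₁ ^ p ≤ x₂) (hw0 : 0 ≤ w) (hw1 : w < 1) (hv : p * v < 1)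
    (hroot : scaledRatio p w v = x₁ ^ p / x₂) :
    (1 - w) * x₂ / ((1 - v) ^ p * (1 - p * w * v)) ∈ closure (attained p x₁ x₂ (1 - w)) := by
  have hp0 : 0 < p := by linarith
  have hx1p : 0 < x₁ ^ p := Real.rpow_pos_of_pos hx1 p
  have hx2' : 0 < x₂ := by linarith
  have main : ∀ v', p * v' < 1 → x₁ ^ p / x₂ < scaledRatio p w v' →
      x₁ ^ p * (1 - w) / ((1 - w * v') ^ p * (1 - p * v')) ∈
        closure (attained p x₁ x₂ (1 - w)) := by
    intro v' hv' hlt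
    obtain ⟨h1, h2, h3, h4⟩ := one_sub_pos_of_mul_lt_one hp hw0 hw1.le hv'
    have E1 : (1 - w) * (1 / (1 - v')) + (1 - (1 - w)) = (1 - w * v') / (1 - v') := by
      field_simp; ring
    have E2 : (1 - w) * (1 / (1 - p * v')) + (1 - (1 - w)) = (1 - p * w * v') / (1 - p * v') := by
      field_simp; ring
    have h1p : 0 < (1 - v') ^ p := Real.rpow_pos_of_pos h1 p
    have h3p : 0 < (1 - w * v') ^ p := Real.rpow_pos_of_pos h3 p
    have := mem_closure_attained_of_lt (s := 1 - w) (v := v') hp hx1 hx2 (by linarith)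
      (by linarith) (by linarith) hv' (by
        rw [E1, E2, Real.div_rpow h3.le h1.le]
        rw [scaledRatio, Real.div_rpow h3.le h1.le, div_lt_iff₀ hx2'] at hlt
        calc _ < ((1 - w * v') ^ p / (1 - v') ^ p * ((1 - p * v') / (1 - p * w * v')) * x₂) *
              ((1 - p * w * v') / (1 - p * v')) / ((1 - w * v') ^ p / (1 - v') ^ p) := by gcongr
          _ = x₂ := by
              generalize 1 - p * v' = A at *
              generalize 1 - p * w * v' = B at *
              field_simp)
    rw [E1, Real.div_rpow h3.le h1.le, Real.div_rpow zero_le_one h1.le, Real.one_rpow] at this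
    convert this using 1
    field_simp
  obtain ⟨h1, h2, h3, h4⟩ := one_sub_pos_of_mul_lt_one hp hw0 hw1.le hv
  have h1p : 0 < (1 - v) ^ p := Real.rpow_pos_of_pos h1 p
  have h3p : 0 < (1 - w * v) ^ p := Real.rpow_pos_of_pos h3 p
  have hval : (1 - w) * x₂ / ((1 - v) ^ p * (1 - p * w * v)) =
      x₁ ^ p * (1 - w) / ((1 - w * v) ^ p * (1 - p * v)) := by
    have : x₁ ^ p = scaledRatio p w v * x₂ := by rw [hroot]; field_simp
    rw [this, scaledRatio, Real.div_rpow h3.le h1.le]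
    generalize 1 - p * v = A at *
    generalize 1 - p * w * v = B at *
    field_simp
  have cont : Tendsto (fun v => x₁ ^ p * (1 - w) / ((1 - w * v) ^ p * (1 - p * v))) (𝓝 v)
      (𝓝 (x₁ ^ p * (1 - w) / ((1 - w * v) ^ p * (1 - p * v)))) := by
    apply ContinuousAt.tendsto
    refine ContinuousAt.div (by fun_prop) (ContinuousAt.mul ?_ (by fun_prop))
      (mul_pos h3p h2).ne'
    exact ContinuousAt.rpow_const (by fun_prop) (Or.inr hp0.le)
  rw [hval]
  rcases lt_trichotomy v 0 with hv0 | rfl | hv0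
  · refine isClosed_closure.mem_of_tendsto (cont.mono_left (nhdsWithin_le_nhds (s := Ioi v))) ?_
    filter_upwards [Ioo_mem_nhdsGT hv0] with v' hv'
    refine main v' ?_ ?_
    · nlinarith [hv'.2]
    · rw [← hroot]
      exact scaledRatio_strictMonoOn hp hw0 hw1 (mem_Iic.2 hv0.le) (mem_Iic.2 hv'.2.le) hv'.1
  · rw [scaledRatio_zero, eq_div_iff hx2'.ne', one_mul] at hroot
    have := subset_closure (attained_root (s := 1 - w) hp hx1 hx2 (by linarith) (by linarith))
    convert this using 1
    simp [mul_comm]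
  · refine isClosed_closure.mem_of_tendsto (cont.mono_left (nhdsWithin_le_nhds (s := Iio v))) ?_
    filter_upwards [Ioo_mem_nhdsLT hv0] with v' hv'
    have hv1 : v < 1 / p := by rw [lt_div_iff₀ hp0]; linarith
    refine main v' ?_ ?_
    · nlinarith [hv'.2]
    · rw [← hroot]
      exact scaledRatio_strictAntiOn hp hw0 hw1 ⟨hv'.1.le, hv'.2.trans hv1⟩ ⟨hv0.le, hv1⟩ hv'.2

end Extremal

/-! ### Passage to the limit along the dyadic generations -/

section Limits

open Filter Topology

variable {l r : ℝ}

/-- Lebesgue measure comes from the largest outer measure bounded by length on intervals, so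
domination on intervals passes to all sets. -/
lemma le_smul_volume_of_Ioc {ν : Measure ℝ} {c : ℝ≥0∞} (hc0 : c ≠ 0) (hc : c ≠ ∞)
    (h : ∀ a b : ℝ, ν (Ioc a b) ≤ c * ENNReal.ofReal (b - a)) : ν ≤ c • volume := by
  have key : (c⁻¹ • ν).toOuterMeasure ≤ (StieltjesFunction.id : StieltjesFunction ℝ).outer := by
    rw [StieltjesFunction.outer, OuterMeasure.le_ofFunction]
    intro s
    rw [StieltjesFunction.length_eq]
    refine le_iInf fun a => le_iInf fun b => le_iInf fun hs => ?_
    have hs' : s ⊆ Ioc a b := fun x hx =>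
      hs ⟨hx, notMem_botSet_of_lt (sub_one_lt x)⟩
    calc (c⁻¹ • ν) s ≤ (c⁻¹ • ν) (Ioc a b) := measure_mono hs'
      _ = c⁻¹ * ν (Ioc a b) := rfl
      _ ≤ c⁻¹ * (c * ENNReal.ofReal (b - a)) := by gcongr; exact h a b
      _ = ENNReal.ofReal (b - a) := by
        rw [← mul_assoc, ENNReal.inv_mul_cancel hc0 hc, one_mul]
  have key2 : c⁻¹ • ν ≤ volume := by
    rw [Real.volume_eq_stieltjes_id]
    refine Measure.le_intro fun s _ _ => ?_
    have := key s
    rwa [StieltjesFunction.measure_def]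
  refine Measure.le_intro fun s _ _ => ?_
  calc ν s = c * (c⁻¹ * ν s) := by rw [← mul_assoc, ENNReal.mul_inv_cancel hc0 hc, one_mul]
    _ ≤ c * volume s := by gcongr; exact key2 s

lemma eq_of_mem_dyadicIco (hlr : l < r) {n k k' : ℕ} {t : ℝ} (h : t ∈ dyadicIco l r n k)
    (h' : t ∈ dyadicIco l r n k') : k = k' := by
  have hh : 0 < (r - l) / 2 ^ n := div_pos (sub_pos.2 hlr) (by positivity)
  have aux : ∀ i j : ℕ, t ∈ dyadicIco l r n i → t ∈ dyadicIco l r n j → i ≤ j := by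
    intro i j hi hj
    have h1 : (i : ℝ) * ((r - l) / 2 ^ n) < (j + 1) * ((r - l) / 2 ^ n) := by
      have := hi.1
      have := hj.2
      linarith
    have : (i : ℝ) < j + 1 := lt_of_mul_lt_mul_right h1 hh.le
    have : i < j + 1 := by exact_mod_cast this
    omega
  exact le_antisymm (aux _ _ h h') (aux _ _ h' h)

lemma exists_mem_dyadicIco (hlr : l < r) (n : ℕ) {t : ℝ} (ht : t ∈ Ico l r) :
    ∃ k < 2 ^ n, t ∈ dyadicIco l r n k := by
  have hd : 0 < r - l := sub_pos.2 hlr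
  have hh : 0 < (r - l) / 2 ^ n := div_pos hd (by positivity)
  have h0 : 0 ≤ (t - l) / ((r - l) / 2 ^ n) := div_nonneg (sub_nonneg.2 ht.1) hh.le
  have h1 := Nat.floor_le h0
  have h2 := Nat.lt_floor_add_one ((t - l) / ((r - l) / 2 ^ n))
  rw [le_div_iff₀ hh] at h1
  rw [div_lt_iff₀ hh] at h2
  refine ⟨⌊(t - l) / ((r - l) / 2 ^ n)⌋₊, ?_, by linarith, by linarith⟩
  rw [Nat.floor_lt h0, div_lt_iff₀ hh]
  push_cast
  rw [mul_div_cancel₀ _ (by positivity)]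
  linarith [ht.2]

/-- A measure dominated by a multiple of Lebesgue measure on dyadic intervals is dominated by it on
all sets. -/
lemma restrict_le_smul_volume (hlr : l < r) {μ : Measure ℝ} {c : ℝ≥0∞} (hc0 : c ≠ 0) (hc : c ≠ ∞)
    (h : ∀ n k, k < 2 ^ n → μ (dyadicIco l r n k) ≤ c * volume (dyadicIco l r n k)) :
    μ.restrict (Ico l r) ≤ c • volume := by
  classical
  apply le_smul_volume_of_Ioc hc0 hc
  intro a b
  rcases le_or_gt b a with hab | hab
  · simp [Ioc_eq_empty (not_lt.2 hab)]
  have step : ∀ n : ℕ, μ.restrict (Ico l r) (Ioc a b) ≤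
      c * ENNReal.ofReal (b - a + 2 * ((r - l) / 2 ^ n)) := by
    intro n
    set d := (r - l) / 2 ^ n with hd
    let K := (Finset.range (2 ^ n)).filter fun k => (dyadicIco l r n k ∩ Ioc a b).Nonempty
    have hK : ∀ k ∈ K, k < 2 ^ n := fun k hk => Finset.mem_range.1 (Finset.mem_filter.1 hk).1
    have cover : Ioc a b ∩ Ico l r ⊆ ⋃ k ∈ K, dyadicIco l r n k := by
      rintro t ⟨ht, htI⟩
      obtain ⟨k, hk, htk⟩ := exists_mem_dyadicIco hlr n htI
      exact mem_biUnion (Finset.mem_filter.2 ⟨Finset.mem_range.2 hk, t, htk, ht⟩) htk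
    -- The dyadic intervals of length `d` that meet `(a, b]` stick out by at most `d` on each side.
    have inside : ⋃ k ∈ K, dyadicIco l r n k ⊆ Icc (a - d) (b + d) := by
      refine iUnion₂_subset fun k hk t ht => ?_
      obtain ⟨u, hu, hu'⟩ := (Finset.mem_filter.1 hk).2
      have e : l + ((k : ℝ) + 1) * d = l + k * d + d := by ring
      have := ht.1
      have := ht.2
      have := hu.1
      have := hu.2
      constructor <;> linarith [hu'.1, hu'.2]
    calc μ.restrict (Ico l r) (Ioc a b) = μ (Ioc a b ∩ Ico l r) :=
          Measure.restrict_apply measurableSet_Ioc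
      _ ≤ μ (⋃ k ∈ K, dyadicIco l r n k) := measure_mono cover
      _ ≤ ∑ k ∈ K, μ (dyadicIco l r n k) := measure_biUnion_finset_le _ _
      _ ≤ ∑ k ∈ K, c * volume (dyadicIco l r n k) :=
          Finset.sum_le_sum fun k hk => h n k (hK k hk)
      _ = c * volume (⋃ k ∈ K, dyadicIco l r n k) := by
          rw [← Finset.mul_sum, measure_biUnion_finset _ fun k _ => measurableSet_dyadicIco n k]
          intro i _ j _ hij
          exact Set.disjoint_left.2 fun t h1 h2 => hij (eq_of_mem_dyadicIco hlr h1 h2)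
      _ ≤ c * volume (Icc (a - d) (b + d)) := by gcongr
      _ = c * ENNReal.ofReal (b - a + 2 * d) := by
          rw [Real.volume_Icc]; congr 2; ring
  have lim : Tendsto (fun n : ℕ => c * ENNReal.ofReal (b - a + 2 * ((r - l) / 2 ^ n))) atTop
      (𝓝 (c * ENNReal.ofReal (b - a))) := by
    refine ENNReal.Tendsto.const_mul (ENNReal.tendsto_ofReal ?_) (Or.inr hc)
    have h1 : Tendsto (fun n : ℕ => (r - l) / 2 ^ n) atTop (𝓝 0) :=
      tendsto_const_nhds.div_atTop (tendsto_pow_atTop_atTop_of_one_lt one_lt_two)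
    simpa using (h1.const_mul 2).const_add (b - a)
  exact ge_of_tendsto' lim step

/-- Dyadic averages converge almost everywhere. -/
lemma ae_tendsto_dyadic_average (hlr : l < r) {φ : ℝ → ℝ≥0} (hφ : Measurable φ)
    (hfin : ∫⁻ t in Ico l r, (φ t : ℝ≥0∞) ≠ ∞) :
    ∀ᵐ t : ℝ, ∀ k : ℕ → ℕ, (∀ n, k n < 2 ^ n) → (∀ n, t ∈ dyadicIco l r n (k n)) →
      Tendsto (fun n => ⨍⁻ u in dyadicIco l r n (k n), (φ u : ℝ≥0∞) ∂volume) atTop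
        (𝓝 (φ t : ℝ≥0∞)) := by
  let F : ℝ → ℝ≥0∞ := (Ico l r).indicator fun t => (φ t : ℝ≥0∞)
  have hF : AEMeasurable F := (hφ.coe_nnreal_ennreal.indicator measurableSet_Ico).aemeasurable
  have hF' : ∫⁻ t, F t ≠ ∞ := by rwa [lintegral_indicator measurableSet_Ico]
  filter_upwards [(IsUnifLocDoublingMeasure.vitaliFamily (volume : Measure ℝ) 1).ae_tendsto_lintegral_div
    hF hF'] with t ht k hk htk
  have htI : t ∈ Ico l r := dyadicIco_subset_Ico hlr (hk 0) (htk 0)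
  have hd : 0 < r - l := sub_pos.2 hlr
  -- The closures of the dyadic intervals are closed balls about their midpoints that contain `t`,
  -- which is what the Vitali family with constant `1` admits; the added endpoint is a null set.
  let d : ℕ → ℝ := fun n => (r - l) / 2 ^ n / 2
  let w : ℕ → ℝ := fun n => l + k n * ((r - l) / 2 ^ n) + (r - l) / 2 ^ n / 2
  have hIcc : ∀ n, Metric.closedBall (w n) (d n) =
      Icc (l + k n * ((r - l) / 2 ^ n)) (l + (k n + 1) * ((r - l) / 2 ^ n)) := fun n => by
    rw [Real.closedBall_eq_Icc]
    congr 1 <;> simp only [w, d] <;> ring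
  have hdlim : Tendsto d atTop (𝓝[>] 0) := by
    refine tendsto_nhdsWithin_iff.2 ⟨?_, Eventually.of_forall fun n => ?_⟩
    · have h1 : Tendsto (fun n : ℕ => (r - l) / 2 ^ n) atTop (𝓝 0) :=
        tendsto_const_nhds.div_atTop (tendsto_pow_atTop_atTop_of_one_lt one_lt_two)
      simpa using h1.div_const 2
    · change 0 < (r - l) / 2 ^ n / 2
      positivity
  have hb := IsUnifLocDoublingMeasure.tendsto_closedBall_filterAt (μ := (volume : Measure ℝ))
    (K := 1) (x := t) w d hdlim (Eventually.of_forall fun n => by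
      rw [one_mul, hIcc]
      exact Ico_subset_Icc_self (htk n))
  have := ht.comp hb
  have hFt : F t = φ t := indicator_of_mem htI _
  rw [hFt] at this
  refine this.congr fun n => ?_
  simp only [Function.comp]
  have hae : (Icc (l + k n * ((r - l) / 2 ^ n)) (l + (k n + 1) * ((r - l) / 2 ^ n)) : Set ℝ)
      =ᵐ[volume] dyadicIco l r n (k n) := Ico_ae_eq_Icc.symm
  rw [hIcc, setLIntegral_congr hae, measure_congr hae, setLAverage_eq,
    setLIntegral_congr_fun (measurableSet_dyadicIco _ _) fun u hu =>
      indicator_of_mem (dyadicIco_subset_Ico hlr (hk n) hu) _]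

/-- Jensen's inequality for the power function. -/
lemma laverage_rpow_mul_le {p : ℝ} (hp : 1 ≤ p) {φ : ℝ → ℝ≥0} (hφ : Measurable φ) {s : Set ℝ}
    (h0 : volume s ≠ 0) (hfin : volume s ≠ ∞) :
    (⨍⁻ t in s, (φ t : ℝ≥0∞) ∂volume) ^ p * volume s ≤ ∫⁻ t in s, (φ t : ℝ≥0∞) ^ p := by
  have hp0 : 0 < p := by linarith
  let P : Measure ℝ := (volume s)⁻¹ • volume.restrict s
  have hP : IsProbabilityMeasure P := ⟨by
    simp only [P, Measure.smul_apply, Measure.restrict_apply_univ, smul_eq_mul]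
    exact ENNReal.inv_mul_cancel h0 hfin⟩
  have h := eLpNorm'_le_eLpNorm'_of_exponent_le (f := fun t => (φ t : ℝ)) one_pos hp P
    hφ.coe_nnreal_real.aestronglyMeasurable
  have hn : ∀ t, ‖(φ t : ℝ)‖ₑ = φ t := fun t => by
    rw [Real.enorm_eq_ofReal (NNReal.coe_nonneg _), ENNReal.ofReal_coe_nnreal]
  simp only [eLpNorm', hn, ENNReal.rpow_one, div_one] at h
  have h1 : (⨍⁻ t in s, (φ t : ℝ≥0∞) ∂volume) ≤ ((∫⁻ t in s, (φ t : ℝ≥0∞) ^ p) / volume s) ^ (1 / p) := by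
    rw [setLAverage_eq]
    simpa [P, lintegral_smul_measure, ENNReal.div_eq_inv_mul] using h
  have h2 := ENNReal.rpow_le_rpow h1 hp0.le
  rw [← ENNReal.rpow_mul, one_div_mul_cancel hp0.ne', ENNReal.rpow_one] at h2
  calc _ ≤ (∫⁻ t in s, (φ t : ℝ≥0∞) ^ p) / volume s * volume s := by gcongr
    _ = _ := ENNReal.div_mul_cancel h0 hfin

/-- If two sequences have lower limits at least `a` and `b` while their sum never exceeds the finite
`a + b`, neither can exceed its share in the limit. -/
lemma tendsto_of_liminf_le_of_add_le {u v : ℕ → ℝ≥0∞} {a b : ℝ≥0∞} (hab : a + b ≠ ∞)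
    (huv : ∀ n, u n + v n ≤ a + b) (hu : a ≤ liminf u atTop) (hv : b ≤ liminf v atTop) :
    Tendsto u atTop (𝓝 a) := by
  have ha : a ≠ ∞ := fun h => hab (by simp [h])
  have hb : b ≠ ∞ := fun h => hab (by simp [h])
  refine tendsto_order.2 ⟨fun c hc => eventually_lt_of_lt_liminf (hc.trans_le hu), fun c hc => ?_⟩
  obtain ⟨e, hae, hec⟩ := exists_between hc
  have he : e ≠ ∞ := ne_top_of_lt hec
  have hε : 0 < e - a := tsub_pos_of_lt hae
  have key : ∀ᶠ n in atTop, b ≤ v n + (e - a) := by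
    rcases eq_or_ne b 0 with rfl | hb0
    · exact Eventually.of_forall fun _ => zero_le
    · have : b - (e - a) < liminf v atTop := (ENNReal.sub_lt_self hb hb0 hε.ne').trans_le hv
      filter_upwards [eventually_lt_of_lt_liminf this] with n hn
      exact tsub_le_iff_right.1 hn.le
  filter_upwards [key] with n hn
  refine lt_of_le_of_lt ?_ hec
  have : u n + b ≤ e + b := by
    calc u n + b ≤ u n + (v n + (e - a)) := by gcongr
      _ = u n + v n + (e - a) := by ring
      _ ≤ a + b + (e - a) := add_le_add (huv n) le_rfl
      _ = a + (e - a) + b := by ring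
      _ = e + b := by rw [add_tsub_cancel_of_le hae.le]
  exact (ENNReal.add_le_add_iff_right hb).1 this

/-- The `p`-th powers of the dyadic averages converge in the mean with respect to each measure
dominated by a multiple of Lebesgue measure. -/
lemma tendsto_sum_average_rpow (hlr : l < r) {p : ℝ} (hp : 1 ≤ p) {φ : ℝ → ℝ≥0}
    (hφ : Measurable φ) (hfin : ∫⁻ t in Ico l r, (φ t : ℝ≥0∞) ≠ ∞)
    (hfinp : ∫⁻ t in Ico l r, (φ t : ℝ≥0∞) ^ p ≠ ∞) {ν : Measure ℝ} {c : ℝ≥0∞} (hc : c ≠ ∞)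
    (hν : ν.restrict (Ico l r) ≤ c • volume) :
    Tendsto (fun n => ∑ k ∈ Finset.range (2 ^ n),
      (⨍⁻ t in dyadicIco l r n k, (φ t : ℝ≥0∞) ∂volume) ^ p * ν (dyadicIco l r n k)) atTop
      (𝓝 (∫⁻ t in Ico l r, (φ t : ℝ≥0∞) ^ p ∂ν)) := by
  have hp0 : 0 < p := by linarith
  have hd : 0 < r - l := sub_pos.2 hlr
  set A : ℕ → ℕ → ℝ≥0∞ := fun n k => ⨍⁻ t in dyadicIco l r n k, (φ t : ℝ≥0∞) ∂volume with hA
  let Z : ℕ → ℝ → ℝ≥0∞ := fun n t =>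
    ∑ k ∈ Finset.range (2 ^ n), (dyadicIco l r n k).indicator (fun _ => A n k ^ p) t
  have hZm : ∀ n, Measurable (Z n) := fun n =>
    Finset.measurable_sum _ fun k _ => measurable_const.indicator (measurableSet_dyadicIco n k)
  have hZint : ∀ (τ : Measure ℝ) n, ∫⁻ t, Z n t ∂τ =
      ∑ k ∈ Finset.range (2 ^ n), A n k ^ p * τ (dyadicIco l r n k) := fun τ n => by
    rw [lintegral_finsetSum _ fun k _ =>
      measurable_const.indicator (measurableSet_dyadicIco n k)]
    refine Finset.sum_congr rfl fun k _ => ?_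
    rw [lintegral_indicator_const (measurableSet_dyadicIco n k)]
  have hres : ∀ (τ : Measure ℝ) n k, k < 2 ^ n →
      τ.restrict (Ico l r) (dyadicIco l r n k) = τ (dyadicIco l r n k) := fun τ n k hk => by
    rw [Measure.restrict_apply (measurableSet_dyadicIco n k),
      inter_eq_left.2 (dyadicIco_subset_Ico hlr hk)]
  have hZlim : ∀ᵐ t ∂(volume.restrict (Ico l r)),
      Tendsto (fun n => Z n t) atTop (𝓝 ((φ t : ℝ≥0∞) ^ p)) := by
    rw [ae_restrict_iff' measurableSet_Ico]
    filter_upwards [ae_tendsto_dyadic_average hlr hφ hfin] with t ht htI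
    choose k hk htk using fun n => exists_mem_dyadicIco hlr n htI
    have := (ht k hk htk).ennrpow_const p
    refine this.congr fun n => ?_
    simp only [Z]
    rw [Finset.sum_eq_single (k n)]
    · rw [indicator_of_mem (htk n)]
    · intro j _ hj
      exact indicator_of_notMem (fun h => hj (eq_of_mem_dyadicIco hlr h (htk n))) _
    · intro h
      exact absurd (Finset.mem_range.2 (hk n)) h
  -- Fatou's lemma bounds the lower limit from below both for `ν` and for the complement of `ν` in
  -- `c` times Lebesgue measure. Jensen's inequality bounds the sum of the two from above, so both
  -- converge.
  set lam : Measure ℝ := c • volume.restrict (Ico l r) with hlam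
  set ν₀ := ν.restrict (Ico l r) with hν₀
  have hνlam : ν₀ ≤ lam := by
    have := Measure.restrict_mono (le_refl (Ico l r)) hν
    rwa [Measure.restrict_restrict measurableSet_Ico, inter_self, Measure.restrict_smul] at this
  have hlamfin : IsFiniteMeasure lam := ⟨by
    rw [hlam, Measure.smul_apply, Measure.restrict_apply_univ, Real.volume_Ico, smul_eq_mul]
    exact ENNReal.mul_lt_top hc.lt_top ENNReal.ofReal_lt_top⟩
  have hνfin : IsFiniteMeasure ν₀ := isFiniteMeasure_of_le lam hνlam
  set ν₁ := lam - ν₀ with hν₁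
  have hsum : ν₀ + ν₁ = lam := by
    rw [add_comm, hν₁, Measure.sub_add_cancel_of_le hνlam]
  have hν₁lam : ν₁ ≤ lam := Measure.sub_le
  have hac : ∀ τ : Measure ℝ, τ ≤ lam → τ ≪ volume.restrict (Ico l r) := fun τ hτ =>
    (Measure.absolutelyContinuous_of_le hτ).trans Measure.smul_absolutelyContinuous
  have fatou : ∀ τ : Measure ℝ, τ ≤ lam →
      ∫⁻ t, (φ t : ℝ≥0∞) ^ p ∂τ ≤ liminf (fun n => ∫⁻ t, Z n t ∂τ) atTop := fun τ hτ => by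
    refine le_trans (le_of_eq ?_) (lintegral_liminf_le hZm)
    refine lintegral_congr_ae ?_
    filter_upwards [(hac τ hτ).ae_le hZlim] with t ht
    exact ht.liminf_eq.symm
  have total : ∫⁻ t, (φ t : ℝ≥0∞) ^ p ∂ν₀ + ∫⁻ t, (φ t : ℝ≥0∞) ^ p ∂ν₁ =
      c * ∫⁻ t in Ico l r, (φ t : ℝ≥0∞) ^ p := by
    rw [← lintegral_add_measure, hsum, hlam, lintegral_smul_measure, smul_eq_mul]
  have main := tendsto_of_liminf_le_of_add_le (u := fun n => ∫⁻ t, Z n t ∂ν₀)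
    (v := fun n => ∫⁻ t, Z n t ∂ν₁) (a := ∫⁻ t, (φ t : ℝ≥0∞) ^ p ∂ν₀)
    (b := ∫⁻ t, (φ t : ℝ≥0∞) ^ p ∂ν₁)
    (by rw [total]; exact ENNReal.mul_ne_top hc hfinp)
    (fun n => by
      rw [total, ← lintegral_add_measure, hsum, hlam, lintegral_smul_measure, smul_eq_mul, hZint]
      gcongr
      rw [← sum_lintegral_dyadicIco hlr volume _ n]
      refine Finset.sum_le_sum fun k hk => ?_
      rw [hres _ _ _ (Finset.mem_range.1 hk)]
      have hpos : 0 < (r - l) / 2 ^ n := by positivity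
      refine laverage_rpow_mul_le hp hφ ?_ ?_
      · rw [volume_dyadicIco]; simpa using hpos
      · rw [volume_dyadicIco]; exact ENNReal.ofReal_ne_top)
    (fatou ν₀ hνlam) (fatou ν₁ hν₁lam)
  refine main.congr fun n => ?_
  rw [hZint]
  refine Finset.sum_congr rfl fun k hk => ?_
  rw [hν₀, hres _ _ _ (Finset.mem_range.1 hk)]

end Limits

/-! ### The main inequality for an admissible triple -/

section Key

open Filter Topology

variable {p m M l r x₁ x₂ x₃ : ℝ} {φ : ℝ → ℝ≥0} {μ : Measure ℝ} {α : DyadicIndex → ℝ≥0}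

lemma subMass_ne_top_of_le {b : ℕ → ℕ → ℝ≥0∞} {c : ℝ} {n k : ℕ} {x : ℝ≥0∞}
    (h : x + subMass b n k ≤ ENNReal.ofReal c) : subMass b n k ≠ ∞ :=
  ne_top_of_le_ne_top ENNReal.ofReal_ne_top (le_add_self.trans h)

/-- The lower bound for the Carleson mass is a lower bound for the measure itself. -/
lemma le_measure_dyadicIco (hlr : l < r) {b : ℕ → ℕ → ℝ≥0∞} {c : ℝ≥0∞}
    (hlow : ∀ n k, k < 2 ^ n →
      c * volume (dyadicIco l r n k) ≤ μ (dyadicIco l r n k) + subMass b n k)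
    {n k : ℕ} (hk : k < 2 ^ n) (hfin : subMass b n k ≠ ∞) :
    c * volume (dyadicIco l r n k) ≤ μ (dyadicIco l r n k) := by
  -- Summing the lower bound over the descendants `j` generations below leaves out the coefficients
  -- of the first `j` generations. These exhaust the full sum as `j → ∞`, and the finite sum then
  -- cancels.
  have step : ∀ j, c * volume (dyadicIco l r n k) + ∑ j' ∈ Finset.range j,
      ∑ i ∈ Finset.range (2 ^ j'), b (n + j') (k * 2 ^ j' + i) ≤
      μ (dyadicIco l r n k) + subMass b n k := by
    intro j
    have h1 := eq_sum_descendants (F := fun n k => volume (dyadicIco l r n k))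
      (fun n k => measure_dyadicIco hlr volume n k) n k j
    have h2 := eq_sum_descendants (F := fun n k => μ (dyadicIco l r n k))
      (fun n k => measure_dyadicIco hlr μ n k) n k j
    have h3 : c * volume (dyadicIco l r n k) ≤ μ (dyadicIco l r n k) +
        ∑ i ∈ Finset.range (2 ^ j), subMass b (n + j) (k * 2 ^ j + i) := by
      rw [h1, h2, Finset.mul_sum, ← Finset.sum_add_distrib]
      refine Finset.sum_le_sum fun i hi => hlow _ _ ?_
      have hi' := Finset.mem_range.1 hi
      rw [pow_add]
      have : (k + 1) * 2 ^ j ≤ 2 ^ n * 2 ^ j := by gcongr; omega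
      nlinarith
    rw [subMass_eq_sum_add_sum b n k j]
    calc _ ≤ μ (dyadicIco l r n k) +
          (∑ i ∈ Finset.range (2 ^ j), subMass b (n + j) (k * 2 ^ j + i)) +
          ∑ j' ∈ Finset.range j, ∑ i ∈ Finset.range (2 ^ j'), b (n + j') (k * 2 ^ j' + i) :=
          add_le_add h3 le_rfl
      _ = _ := by ring
  have lim := (ENNReal.tendsto_nat_tsum fun j' =>
    ∑ i ∈ Finset.range (2 ^ j'), b (n + j') (k * 2 ^ j' + i)).const_add
      (c * volume (dyadicIco l r n k))
  have := le_of_tendsto' lim step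
  exact (ENNReal.add_le_add_iff_right hfin).1 this

/-- The Bellman induction for the normalised excess of mass, with coefficients kept only in the
generations below `n₀`. The lower bound is required of `μ` alone so that the normalised excess stays
non-negative after this truncation. -/
lemma finite_level_inequality (hp : 1 < p) {v : ℝ} (hv : v < 1) (hmM : m < M) (hlr : l < r)
    (hm : 0 ≤ m) (hx1 : 0 ≤ x₁) {b : ℕ → ℕ → ℝ≥0∞}
    (hμ : ∀ n k, k < 2 ^ n → ENNReal.ofReal (m * ((r - l) / 2 ^ n)) ≤ μ (dyadicIco l r n k))
    (hup : ∀ n k, k < 2 ^ n →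
      μ (dyadicIco l r n k) + subMass b n k ≤ ENNReal.ofReal (M * ((r - l) / 2 ^ n)))
    (hφ : ∫⁻ t in Ico l r, (φ t : ℝ≥0∞) = ENNReal.ofReal (x₁ * (r - l))) (n₀ : ℕ) :
    (p - 1) * v * (((∑ j ∈ Finset.range n₀, ∑ k ∈ Finset.range (2 ^ j),
          (⨍⁻ t in dyadicIco l r j k, (φ t : ℝ≥0∞) ∂volume).toReal ^ p * (b j k).toReal) +
        (∑ k ∈ Finset.range (2 ^ n₀),
          (⨍⁻ t in dyadicIco l r n₀ k, (φ t : ℝ≥0∞) ∂volume).toReal ^ p *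
            (μ (dyadicIco l r n₀ k)).toReal) -
        m * ∑ k ∈ Finset.range (2 ^ n₀),
          (⨍⁻ t in dyadicIco l r n₀ k, (φ t : ℝ≥0∞) ∂volume).toReal ^ p *
            (volume (dyadicIco l r n₀ k)).toReal) / ((M - m) * (r - l))) ≤
      (1 - v) ^ (1 - p) * ((∑ k ∈ Finset.range (2 ^ n₀),
          (⨍⁻ t in dyadicIco l r n₀ k, (φ t : ℝ≥0∞) ∂volume).toReal ^ p *
            (volume (dyadicIco l r n₀ k)).toReal) / (r - l)) -
        x₁ ^ p * (1 - v * (1 - ((μ (Ico l r)).toReal + (∑ j ∈ Finset.range n₀,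
          ∑ k ∈ Finset.range (2 ^ j), (b j k).toReal) - m * (r - l)) /
            ((M - m) * (r - l)))) ^ (1 - p) := by
  have hd : 0 < r - l := sub_pos.2 hlr
  have hW : 0 < M - m := sub_pos.2 hmM
  have he : ∀ n : ℕ, 0 < (r - l) / 2 ^ n := fun n => by positivity
  have he2 : ∀ n : ℕ, (r - l) / 2 ^ n = 2 * ((r - l) / 2 ^ (n + 1)) := fun n => by
    rw [pow_succ]; field_simp
  have hvol : ∀ n k, (volume (dyadicIco l r n k)).toReal = (r - l) / 2 ^ n := fun n k => by
    rw [volume_dyadicIco, ENNReal.toReal_ofReal (he n).le]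
  have hk1 : ∀ n k : ℕ, k < 2 ^ n → 2 * k < 2 ^ (n + 1) := fun n k h => by rw [pow_succ]; omega
  have hk2 : ∀ n k : ℕ, k < 2 ^ n → 2 * k + 1 < 2 ^ (n + 1) := fun n k h => by
    rw [pow_succ]; omega
  -- Without coefficients from generation `n₀` on, the terminal mass is the excess of `μ` alone, and
  -- the terminal sum is the step function approximation of the integral against `μ` minus `m` times
  -- that against Lebesgue measure.
  let b' : ℕ → ℕ → ℝ≥0∞ := fun n k => if n < n₀ then b n k else 0
  have hb' : ∀ n k, b' n k ≤ b n k := fun n k => by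
    simp only [b']; split_ifs <;> simp
  have hup' : ∀ n k, k < 2 ^ n →
      μ (dyadicIco l r n k) + subMass b' n k ≤ ENNReal.ofReal (M * ((r - l) / 2 ^ n)) :=
    fun n k hk => le_trans (by gcongr; exact subMass_mono hb' n k) (hup n k hk)
  have fμ : ∀ n k, k < 2 ^ n → μ (dyadicIco l r n k) ≠ ∞ := fun n k hk =>
    ne_top_of_le_ne_top ENNReal.ofReal_ne_top (le_self_add.trans (hup' n k hk))
  have fS : ∀ n k, k < 2 ^ n → subMass b' n k ≠ ∞ := fun n k hk =>
    subMass_ne_top_of_le (hup' n k hk)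
  have fφ : ∀ n k, k < 2 ^ n → ∫⁻ t in dyadicIco l r n k, (φ t : ℝ≥0∞) ≠ ∞ := fun n k hk =>
    ne_top_of_le_ne_top (by rw [hφ]; exact ENNReal.ofReal_ne_top)
      (lintegral_mono_set (dyadicIco_subset_Ico hlr hk))
  set a : ℕ → ℕ → ℝ := fun n k => (⨍⁻ t in dyadicIco l r n k, (φ t : ℝ≥0∞) ∂volume).toReal
    with ha
  have ea : ∀ n k, a n k = (∫⁻ t in dyadicIco l r n k, (φ t : ℝ≥0∞)).toReal / ((r - l) / 2 ^ n) :=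
    fun n k => by simp only [ha]; rw [setLAverage_eq, ENNReal.toReal_div, hvol]
  have ha2 : ∀ n k, k < 2 ^ n → a n k = (a (n + 1) (2 * k) + a (n + 1) (2 * k + 1)) / 2 := by
    intro n k hk
    rw [ea, ea, ea, lintegral_dyadicIco hlr, ENNReal.toReal_add (fφ _ _ (hk1 n k hk))
      (fφ _ _ (hk2 n k hk)), he2 n]
    have := (he (n + 1)).ne'
    generalize (r - l) / 2 ^ (n + 1) = e at *
    field_simp
  have ha0 : a 0 0 = x₁ := by
    rw [ea, dyadicIco_zero, hφ, ENNReal.toReal_ofReal (by positivity), pow_zero, div_one,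
      mul_div_cancel_right₀ _ hd.ne']
  let G : ℕ → ℕ → ℝ := fun n k => (μ (dyadicIco l r n k)).toReal
  let S : ℕ → ℕ → ℝ := fun n k => (subMass b' n k).toReal
  have hG : ∀ n k, k < 2 ^ n → G n k = G (n + 1) (2 * k) + G (n + 1) (2 * k + 1) :=
    fun n k hk => by
      simp only [G]
      rw [measure_dyadicIco hlr, ENNReal.toReal_add (fμ _ _ (hk1 n k hk)) (fμ _ _ (hk2 n k hk))]
  have fb : ∀ n k, k < 2 ^ n → b' n k ≠ ∞ := fun n k hk => by
    have := fS n k hk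
    rw [subMass_eq] at this
    exact ne_top_of_le_ne_top this le_self_add
  have hS : ∀ n k, k < 2 ^ n →
      S n k = (b' n k).toReal + (S (n + 1) (2 * k) + S (n + 1) (2 * k + 1)) := fun n k hk => by
    simp only [S]
    rw [subMass_eq, ENNReal.toReal_add (fb n k hk) (ENNReal.add_ne_top.2
      ⟨fS _ _ (hk1 n k hk), fS _ _ (hk2 n k hk)⟩),
      ENNReal.toReal_add (fS _ _ (hk1 n k hk)) (fS _ _ (hk2 n k hk))]
  have hGlow : ∀ n k, k < 2 ^ n → m * ((r - l) / 2 ^ n) ≤ G n k := fun n k hk => by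
    rw [← ENNReal.ofReal_le_iff_le_toReal (fμ n k hk)]
    exact hμ n k hk
  have hGS : ∀ n k, k < 2 ^ n → G n k + S n k ≤ M * ((r - l) / 2 ^ n) := fun n k hk => by
    have hM : 0 ≤ M * ((r - l) / 2 ^ n) := mul_nonneg (hm.trans hmM.le) (he n).le
    have := ENNReal.toReal_mono ENNReal.ofReal_ne_top (hup' n k hk)
    rwa [ENNReal.toReal_add (fμ n k hk) (fS n k hk), ENNReal.toReal_ofReal hM] at this
  have key := bellman_induction_terminal (a := a)
    (α := fun n k => (b' n k).toReal / ((M - m) * ((r - l) / 2 ^ n)))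
    (N := fun n k => (G n k + S n k - m * ((r - l) / 2 ^ n)) / ((M - m) * ((r - l) / 2 ^ n)))
    hp hv (fun _ _ => ENNReal.toReal_nonneg)
    (fun n k => div_nonneg ENNReal.toReal_nonneg (mul_nonneg hW.le (he n).le))
    (fun n k hk => div_nonneg (by
      have : 0 ≤ S n k := ENNReal.toReal_nonneg
      linarith [hGlow n k hk]) (mul_nonneg hW.le (he n).le))
    (fun n k hk => by
      rw [div_le_one (mul_pos hW (he n))]
      linarith [hGS n k hk])
    ha2
    (fun n k hk => by
      rw [hG n k hk, hS n k hk, he2 n]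
      have := (he (n + 1)).ne'
      generalize (r - l) / 2 ^ (n + 1) = e at *
      field_simp
      ring) n₀
  have S0 : ∀ k, S n₀ k = 0 := fun k => by
    simp only [S, subMass]
    rw [ENNReal.tsum_eq_zero.2 fun j => Finset.sum_eq_zero fun i _ => if_neg (by omega)]
    rfl
  have S00 : S 0 0 = ∑ j ∈ Finset.range n₀, ∑ k ∈ Finset.range (2 ^ j), (b j k).toReal := by
    simp only [S]
    rw [subMass_zero_zero, tsum_eq_sum (s := Finset.range n₀) fun j hj =>
      Finset.sum_eq_zero fun i _ => if_neg (fun h => hj (Finset.mem_range.2 h)),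
      ENNReal.toReal_sum fun j _ => ENNReal.sum_ne_top.2 fun k hk => fb j k (Finset.mem_range.1 hk)]
    refine Finset.sum_congr rfl fun j hj => ?_
    rw [ENNReal.toReal_sum fun k hk => fb j k (Finset.mem_range.1 hk)]
    exact Finset.sum_congr rfl fun k _ => by simp only [b', if_pos (Finset.mem_range.1 hj)]
  simp only [S00, ha0, pow_zero, div_one] at key
  have G00 : G 0 0 = (μ (Ico l r)).toReal := by simp only [G, dyadicIco_zero]
  rw [G00] at key
  have cancel : ∀ (n : ℕ) (x : ℝ), x / ((M - m) * ((r - l) / 2 ^ n)) / 2 ^ n =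
      x / ((M - m) * (r - l)) := fun n x => by field_simp
  have t1 : ∑ j ∈ Finset.range n₀, (∑ k ∈ Finset.range (2 ^ j),
      a j k ^ p * ((b' j k).toReal / ((M - m) * ((r - l) / 2 ^ j)))) / 2 ^ j =
      (∑ j ∈ Finset.range n₀, ∑ k ∈ Finset.range (2 ^ j), a j k ^ p * (b j k).toReal) /
        ((M - m) * (r - l)) := by
    rw [Finset.sum_div]
    refine Finset.sum_congr rfl fun j hj => ?_
    rw [Finset.sum_div, Finset.sum_div]
    refine Finset.sum_congr rfl fun k _ => ?_
    rw [← mul_div_assoc, cancel]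
    simp only [b', if_pos (Finset.mem_range.1 hj)]
  have t2 : (∑ k ∈ Finset.range (2 ^ n₀), a n₀ k ^ p *
      ((G n₀ k + S n₀ k - m * ((r - l) / 2 ^ n₀)) / ((M - m) * ((r - l) / 2 ^ n₀)))) / 2 ^ n₀ =
      ((∑ k ∈ Finset.range (2 ^ n₀), a n₀ k ^ p * G n₀ k) -
        m * ∑ k ∈ Finset.range (2 ^ n₀), a n₀ k ^ p * ((r - l) / 2 ^ n₀)) /
          ((M - m) * (r - l)) := by
    rw [Finset.mul_sum, ← Finset.sum_sub_distrib, Finset.sum_div, Finset.sum_div]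
    refine Finset.sum_congr rfl fun k _ => ?_
    rw [S0, ← mul_div_assoc, cancel]
    congr 1
    ring
  have t3 : (∑ k ∈ Finset.range (2 ^ n₀), a n₀ k ^ p) / 2 ^ n₀ =
      (∑ k ∈ Finset.range (2 ^ n₀), a n₀ k ^ p * ((r - l) / 2 ^ n₀)) / (r - l) := by
    rw [← Finset.sum_mul]
    field_simp
  rw [t1, t2, t3, ← add_div] at key
  simp only [hvol]
  convert key using 4
  ring

/-- The value of the functional on an admissible triple, with the inequality that gives the upper
bound for `0 < v < 1` and the lower bound for `v < 0`. -/
lemma IsBellmanAdmissible.exists_value (hp : 1 < p) (hm : 0 ≤ m) (hmM : m < M) (hlr : l < r)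
    (hx1 : 0 ≤ x₁) (hx2 : 0 ≤ x₂) (hm3 : m ≤ x₃) (h3M : x₃ ≤ M)
    (h : IsBellmanAdmissible p m M l r x₁ x₂ x₃ φ μ α) :
    ∃ F : ℝ, carlesonFunctional p l r φ μ α = ENNReal.ofReal F ∧ m * x₂ ≤ F ∧
      (x₃ = m → F = m * x₂) ∧
      ∀ v < 1, (p - 1) * v * ((F - m * x₂) / (M - m)) ≤
        (1 - v) ^ (1 - p) * x₂ - x₁ ^ p * (1 - v * ((M - x₃) / (M - m))) ^ (1 - p) := by
  have hp0 : 0 < p := by linarith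
  have hd : 0 < r - l := sub_pos.2 hlr
  have hW : 0 < M - m := sub_pos.2 hmM
  have hx3 : 0 ≤ x₃ := hm.trans hm3
  have hM0 : 0 ≤ M := hm.trans hmM.le
  have he : ∀ n : ℕ, 0 < (r - l) / 2 ^ n := fun n => by positivity
  have hvI : volume (Ico l r) = ENNReal.ofReal (r - l) := Real.volume_Ico
  have hv0 : ENNReal.ofReal (r - l) ≠ 0 := by simpa using hd
  have unavg : ∀ {y : ℝ≥0∞} {x : ℝ}, 0 ≤ x → y / ENNReal.ofReal (r - l) = ENNReal.ofReal x →
      y = ENNReal.ofReal (x * (r - l)) := fun {y x} hx hy => by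
    rw [ENNReal.ofReal_mul hx, ← hy, ENNReal.div_mul_cancel hv0 ENNReal.ofReal_ne_top]
  set b := extendIndex α with hb
  have i1 : ∫⁻ t in Ico l r, (φ t : ℝ≥0∞) = ENNReal.ofReal (x₁ * (r - l)) :=
    unavg hx1 (by rw [← hvI, ← setLAverage_eq]; exact h.average)
  have i2 : ∫⁻ t in Ico l r, (φ t : ℝ≥0∞) ^ p = ENNReal.ofReal (x₂ * (r - l)) :=
    unavg hx2 (by rw [← hvI, ← setLAverage_eq]; exact h.average_pow)
  have htsum : ∀ c : ℕ → ℕ → ℝ≥0∞, ∑' J : DyadicIndex, c J.1 J.2 * (α J : ℝ≥0∞) =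
      ∑' n, ∑ k ∈ Finset.range (2 ^ n), c n k * b n k := fun c => by
    rw [← tsum_dyadicIndex fun n k => c n k * b n k]
    exact tsum_congr fun J => by rw [hb, extendIndex_apply]
  have tot : μ (Ico l r) + subMass b 0 0 = ENNReal.ofReal (x₃ * (r - l)) := by
    refine unavg hx3 ?_
    rw [← hvI, ← h.mass, subMass_zero_zero, ← tsum_dyadicIndex b]
    congr 2
    exact tsum_congr fun J => by rw [hb, extendIndex_apply]
  have low : ∀ n k, k < 2 ^ n → ENNReal.ofReal m * volume (dyadicIco l r n k) ≤
      μ (dyadicIco l r n k) + subMass b n k := fun n k hk => by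
    have := h.lower_le ⟨n, ⟨k, hk⟩⟩
    rwa [carlesonMass_eq hlr, dyadicInterval_eq] at this
  have up : ∀ n k, k < 2 ^ n → μ (dyadicIco l r n k) + subMass b n k ≤
      ENNReal.ofReal M * volume (dyadicIco l r n k) := fun n k hk => by
    have := h.le_upper ⟨n, ⟨k, hk⟩⟩
    rwa [carlesonMass_eq hlr, dyadicInterval_eq] at this
  have up' : ∀ n k, k < 2 ^ n → μ (dyadicIco l r n k) + subMass b n k ≤
      ENNReal.ofReal (M * ((r - l) / 2 ^ n)) := fun n k hk => by
    have := up n k hk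
    rwa [volume_dyadicIco, ← ENNReal.ofReal_mul hM0] at this
  have hμlow : ∀ n k, k < 2 ^ n →
      ENNReal.ofReal (m * ((r - l) / 2 ^ n)) ≤ μ (dyadicIco l r n k) := fun n k hk => by
    have := le_measure_dyadicIco hlr low hk (subMass_ne_top_of_le (up' n k hk))
    rwa [volume_dyadicIco, ← ENNReal.ofReal_mul hm] at this
  have fμ : ∀ n k, k < 2 ^ n → μ (dyadicIco l r n k) ≠ ∞ := fun n k hk =>
    ne_top_of_le_ne_top ENNReal.ofReal_ne_top (le_self_add.trans (up' n k hk))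
  have fA : ∀ n k, k < 2 ^ n → (⨍⁻ t in dyadicIco l r n k, (φ t : ℝ≥0∞) ∂volume) ≠ ∞ :=
    fun n k hk => by
      rw [setLAverage_eq, volume_dyadicIco]
      refine ENNReal.div_ne_top (ne_top_of_le_ne_top (by rw [i1]; exact ENNReal.ofReal_ne_top)
        (lintegral_mono_set (dyadicIco_subset_Ico hlr hk))) ?_
      simpa using he n
  have fAp : ∀ n k, k < 2 ^ n → (⨍⁻ t in dyadicIco l r n k, (φ t : ℝ≥0∞) ∂volume) ^ p ≠ ∞ :=
    fun n k hk => ENNReal.rpow_ne_top_of_nonneg hp0.le (fA n k hk)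
  have hμM : μ.restrict (Ico l r) ≤ ENNReal.ofReal M • volume :=
    restrict_le_smul_volume hlr (by simpa using hm.trans_lt hmM) ENNReal.ofReal_ne_top
      fun n k hk => le_self_add.trans (up n k hk)
  have hfin1 : ∫⁻ t in Ico l r, (φ t : ℝ≥0∞) ≠ ∞ := by rw [i1]; exact ENNReal.ofReal_ne_top
  have hfin2 : ∫⁻ t in Ico l r, (φ t : ℝ≥0∞) ^ p ≠ ∞ := by rw [i2]; exact ENNReal.ofReal_ne_top
  have hE1 : ∫⁻ t in Ico l r, (φ t : ℝ≥0∞) ^ p ∂μ ≠ ∞ := by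
    have h1 : μ.restrict (Ico l r) ≤ ENNReal.ofReal M • volume.restrict (Ico l r) := by
      have := Measure.restrict_mono (le_refl (Ico l r)) hμM
      rwa [Measure.restrict_restrict measurableSet_Ico, inter_self, Measure.restrict_smul] at this
    refine ne_top_of_le_ne_top ?_ (lintegral_mono' h1 le_rfl)
    rw [lintegral_smul_measure, smul_eq_mul]
    exact ENNReal.mul_ne_top ENNReal.ofReal_ne_top hfin2
  let V : ℕ → ℝ := fun n => ∑ k ∈ Finset.range (2 ^ n),
    (⨍⁻ t in dyadicIco l r n k, (φ t : ℝ≥0∞) ∂volume).toReal ^ p * (μ (dyadicIco l r n k)).toReal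
  let Y : ℕ → ℝ := fun n => ∑ k ∈ Finset.range (2 ^ n),
    (⨍⁻ t in dyadicIco l r n k, (φ t : ℝ≥0∞) ∂volume).toReal ^ p *
      (volume (dyadicIco l r n k)).toReal
  let U : ℕ → ℝ := fun n => ∑ j ∈ Finset.range n, ∑ k ∈ Finset.range (2 ^ j),
    (⨍⁻ t in dyadicIco l r j k, (φ t : ℝ≥0∞) ∂volume).toReal ^ p * (b j k).toReal
  let B : ℕ → ℝ := fun n => ∑ j ∈ Finset.range n, ∑ k ∈ Finset.range (2 ^ j), (b j k).toReal
  have limV : Tendsto V atTop (𝓝 (∫⁻ t in Ico l r, (φ t : ℝ≥0∞) ^ p ∂μ).toReal) := by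
    refine ((ENNReal.tendsto_toReal hE1).comp (tendsto_sum_average_rpow hlr hp.le h.measurable hfin1
      hfin2 ENNReal.ofReal_ne_top hμM)).congr fun n => ?_
    simp only [Function.comp, V]
    rw [ENNReal.toReal_sum fun k hk => ENNReal.mul_ne_top (fAp n k (Finset.mem_range.1 hk))
      (fμ n k (Finset.mem_range.1 hk))]
    exact Finset.sum_congr rfl fun k _ => by rw [ENNReal.toReal_mul, ENNReal.toReal_rpow]
  have limY : Tendsto Y atTop (𝓝 (x₂ * (r - l))) := by
    have : (volume : Measure ℝ).restrict (Ico l r) ≤ (1 : ℝ≥0∞) • volume := by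
      rw [one_smul]; exact Measure.restrict_le_self
    have := (ENNReal.tendsto_toReal hfin2).comp (tendsto_sum_average_rpow hlr hp.le h.measurable
      hfin1 hfin2 ENNReal.one_ne_top this)
    rw [i2, ENNReal.toReal_ofReal (by positivity)] at this
    refine this.congr fun n => ?_
    simp only [Function.comp, Y]
    rw [ENNReal.toReal_sum fun k hk => ENNReal.mul_ne_top (fAp n k (Finset.mem_range.1 hk))
      (by rw [volume_dyadicIco]; exact ENNReal.ofReal_ne_top)]
    exact Finset.sum_congr rfl fun k _ => by rw [ENNReal.toReal_mul, ENNReal.toReal_rpow]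
  have fin := fun (v : ℝ) (hv : v < 1) (n : ℕ) =>
    finite_level_inequality hp hv hmM hlr hm hx1 hμlow up' i1 n
  have hVY : ∀ n, m * Y n ≤ V n := fun n => by
    simp only [V, Y]
    rw [Finset.mul_sum]
    refine Finset.sum_le_sum fun k hk => ?_
    have h1 := hμlow n k (Finset.mem_range.1 hk)
    rw [ENNReal.ofReal_le_iff_le_toReal (fμ n k (Finset.mem_range.1 hk))] at h1
    rw [volume_dyadicIco, ENNReal.toReal_ofReal (he n).le]
    have h2 : 0 ≤ (⨍⁻ t in dyadicIco l r n k, (φ t : ℝ≥0∞) ∂volume).toReal ^ p := by positivity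
    nlinarith
  have hU0 : ∀ n, 0 ≤ U n := fun n => by positivity
  have hpart : ∀ n, ∑ j ∈ Finset.range n, ∑ k ∈ Finset.range (2 ^ j),
      (⨍⁻ t in dyadicIco l r j k, (φ t : ℝ≥0∞) ∂volume) ^ p * b j k = ENNReal.ofReal (U n) := by
    intro n
    have hne : ∀ j k, k ∈ Finset.range (2 ^ j) →
        (⨍⁻ t in dyadicIco l r j k, (φ t : ℝ≥0∞) ∂volume) ^ p * b j k ≠ ∞ := fun j k hk =>
      ENNReal.mul_ne_top (fAp j k (Finset.mem_range.1 hk)) (extendIndex_ne_top α j k)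
    have hne' : ∀ j, ∑ k ∈ Finset.range (2 ^ j),
        (⨍⁻ t in dyadicIco l r j k, (φ t : ℝ≥0∞) ∂volume) ^ p * b j k ≠ ∞ := fun j =>
      ENNReal.sum_ne_top.2 fun k hk => hne j k hk
    rw [← ENNReal.ofReal_toReal (ENNReal.sum_ne_top.2 fun j _ => hne' j),
      ENNReal.toReal_sum fun j _ => hne' j]
    congr 1
    refine Finset.sum_congr rfl fun j _ => ?_
    rw [ENNReal.toReal_sum fun k hk => hne j k hk]
    exact Finset.sum_congr rfl fun k _ => by rw [ENNReal.toReal_mul, ENNReal.toReal_rpow]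
  -- Any `v` in `(0, 1)` bounds the partial sums, since the other terms on the left satisfy `V n - m
  -- Y n ≥ 0`; `v = 1 / 2` is taken. The series over the coefficients is thus finite before limits
  -- are taken.
  obtain ⟨C, hC⟩ : ∃ C, ∀ n, U n ≤ C := by
    obtain ⟨K, hK⟩ := limY.bddAbove_range
    refine ⟨((1 - 1 / 2) ^ (1 - p) * (K / (r - l))) / ((p - 1) * (1 / 2)) * ((M - m) * (r - l)),
      fun n => ?_⟩
    have h1 := fin (1 / 2) (by norm_num) n
    have hYK : Y n ≤ K := hK ⟨n, rfl⟩
    have hbase : 0 ≤ 1 - 1 / 2 * (1 - ((μ (Ico l r)).toReal + B n - m * (r - l)) /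
        ((M - m) * (r - l))) := by
      have h00 := hμlow 0 0 (by simp)
      rw [ENNReal.ofReal_le_iff_le_toReal (fμ 0 0 (by simp)), dyadicIco_zero, pow_zero,
        div_one] at h00
      have hB0 : 0 ≤ B n := by positivity
      have : 0 ≤ ((μ (Ico l r)).toReal + B n - m * (r - l)) / ((M - m) * (r - l)) :=
        div_nonneg (by linarith) (by positivity)
      linarith
    have h2 : (p - 1) * (1 / 2) * ((U n + V n - m * Y n) / ((M - m) * (r - l))) ≤
        (1 - 1 / 2) ^ (1 - p) * (K / (r - l)) := by
      refine h1.trans ?_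
      have : (0 : ℝ) ≤ (1 - 1 / 2) ^ (1 - p) := by positivity
      have h3 : (1 - 1 / 2 : ℝ) ^ (1 - p) * (Y n / (r - l)) ≤
          (1 - 1 / 2) ^ (1 - p) * (K / (r - l)) := by gcongr
      have h4 : 0 ≤ x₁ ^ p * (1 - 1 / 2 * (1 - ((μ (Ico l r)).toReal + B n - m * (r - l)) /
        ((M - m) * (r - l)))) ^ (1 - p) := mul_nonneg (by positivity) (Real.rpow_nonneg hbase _)
      linarith
    rw [mul_comm, ← le_div_iff₀ (by nlinarith), div_le_iff₀ (by positivity)] at h2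
    linarith [hVY n]
  have hE2le : ∑' n, ∑ k ∈ Finset.range (2 ^ n),
      (⨍⁻ t in dyadicIco l r n k, (φ t : ℝ≥0∞) ∂volume) ^ p * b n k ≤ ENNReal.ofReal C := by
    rw [ENNReal.tsum_eq_iSup_nat]
    exact iSup_le fun n => by rw [hpart]; exact ENNReal.ofReal_le_ofReal (hC n)
  set E2 := ∑' n, ∑ k ∈ Finset.range (2 ^ n),
      (⨍⁻ t in dyadicIco l r n k, (φ t : ℝ≥0∞) ∂volume) ^ p * b n k with hE2def
  have hE2 : E2 ≠ ∞ := ne_top_of_le_ne_top ENNReal.ofReal_ne_top hE2le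
  have limU : Tendsto U atTop (𝓝 E2.toReal) := by
    refine ((ENNReal.tendsto_toReal hE2).comp (ENNReal.tendsto_nat_tsum _)).congr fun n => ?_
    simp only [Function.comp]
    rw [hpart, ENNReal.toReal_ofReal (hU0 n)]
  have hsub : subMass b 0 0 ≠ ∞ := subMass_ne_top_of_le tot.le
  have hμI : μ (Ico l r) ≠ ∞ := by simpa using fμ 0 0 (by simp)
  have limB : Tendsto B atTop (𝓝 (subMass b 0 0).toReal) := by
    rw [subMass_zero_zero] at hsub ⊢
    refine ((ENNReal.tendsto_toReal hsub).comp (ENNReal.tendsto_nat_tsum _)).congr fun n => ?_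
    simp only [Function.comp, B]
    rw [ENNReal.toReal_sum fun j _ => ENNReal.sum_ne_top.2 fun k _ => extendIndex_ne_top α j k]
    exact Finset.sum_congr rfl fun j _ =>
      ENNReal.toReal_sum fun k _ => extendIndex_ne_top α j k
  have totR : (μ (Ico l r)).toReal + (subMass b 0 0).toReal = x₃ * (r - l) := by
    rw [← ENNReal.toReal_add hμI hsub, tot, ENNReal.toReal_ofReal (by positivity)]
  have limS := (limU.add limV).sub (limY.const_mul m)
  refine ⟨((∫⁻ t in Ico l r, (φ t : ℝ≥0∞) ^ p ∂μ).toReal + E2.toReal) / (r - l), ?_, ?_, ?_, ?_⟩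
  · rw [carlesonFunctional, hvI, ENNReal.ofReal_div_of_pos hd,
      ENNReal.ofReal_add ENNReal.toReal_nonneg ENNReal.toReal_nonneg, ENNReal.ofReal_toReal hE1,
      ENNReal.ofReal_toReal hE2]
    congr 2
    exact htsum fun n k => (⨍⁻ t in dyadicIco l r n k, (φ t : ℝ≥0∞) ∂volume) ^ p
  · have : (0 : ℝ) ≤ _ := ge_of_tendsto' limS fun n => by
      have := hVY n
      have := hU0 n
      linarith
    rw [le_div_iff₀ hd]
    linarith
  -- At `x₃ = m` no mass is left for the coefficients. In each generation the non-negative excesses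
  -- of `μ` over `m` times length sum to zero, so `V n = m Y n`.
  · intro h3
    have h00 := hμlow 0 0 (by simp)
    rw [ENNReal.ofReal_le_iff_le_toReal (fμ 0 0 (by simp)), dyadicIco_zero, pow_zero,
      div_one] at h00
    have hsub0 : 0 ≤ (subMass b 0 0).toReal := ENNReal.toReal_nonneg
    rw [h3] at totR
    have hs : subMass b 0 0 = 0 := by
      have : (subMass b 0 0).toReal = 0 := by linarith
      exact (ENNReal.toReal_eq_zero_iff _).1 this |>.resolve_right hsub
    have hb0 : ∀ n k, k < 2 ^ n → b n k = 0 := fun n k hk => by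
      rw [subMass_zero_zero, ENNReal.tsum_eq_zero] at hs
      exact (Finset.sum_eq_zero_iff.1 (hs n)) k (Finset.mem_range.2 hk)
    have hU : ∀ n, U n = 0 := fun n => Finset.sum_eq_zero fun j _ => Finset.sum_eq_zero fun k hk => by
      rw [hb0 j k (Finset.mem_range.1 hk)]; simp
    have hGm : ∀ n k, k < 2 ^ n →
        (μ (dyadicIco l r n k)).toReal - m * ((r - l) / 2 ^ n) = 0 := by
      intro n
      have hnn : ∀ k ∈ Finset.range (2 ^ n),
          0 ≤ (μ (dyadicIco l r n k)).toReal - m * ((r - l) / 2 ^ n) := fun k hk => by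
        have h1 := hμlow n k (Finset.mem_range.1 hk)
        rw [ENNReal.ofReal_le_iff_le_toReal (fμ n k (Finset.mem_range.1 hk))] at h1
        linarith
      have hsum : ∑ k ∈ Finset.range (2 ^ n),
          ((μ (dyadicIco l r n k)).toReal - m * ((r - l) / 2 ^ n)) = 0 := by
        rw [Finset.sum_sub_distrib, ← ENNReal.toReal_sum fun k hk => fμ n k (Finset.mem_range.1 hk),
          sum_measure_dyadicIco hlr, Finset.sum_const, Finset.card_range, nsmul_eq_mul]
        push_cast
        field_simp
        linarith
      intro k hk
      exact (Finset.sum_eq_zero_iff_of_nonneg hnn).1 hsum k (Finset.mem_range.2 hk)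
    have hV : ∀ n, V n = m * Y n := fun n => by
      simp only [V, Y]
      rw [Finset.mul_sum]
      refine Finset.sum_congr rfl fun k hk => ?_
      have := hGm n k (Finset.mem_range.1 hk)
      rw [volume_dyadicIco, ENNReal.toReal_ofReal (he n).le, sub_eq_zero.1 this]
      ring
    have := tendsto_nhds_unique limS (tendsto_const_nhds.congr (f₁ := fun _ => (0 : ℝ)) fun n => by
      rw [hU n, hV n]; ring)
    rw [div_eq_iff hd.ne']
    linarith
  · intro v hv
    have hw0 : 0 ≤ (M - x₃) / (M - m) := div_nonneg (by linarith) hW.le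
    have hw1 : (M - x₃) / (M - m) ≤ 1 := (div_le_one hW).2 (by linarith)
    have hN : 1 - (x₃ * (r - l) - m * (r - l)) / ((M - m) * (r - l)) = (M - x₃) / (M - m) := by
      field_simp; ring
    have hpos : 0 < 1 - v * ((M - x₃) / (M - m)) := by
      have := one_sub_mul_pos (N := 1 - (M - x₃) / (M - m)) hv (by linarith) (by linarith)
      simpa using this
    have limN : Tendsto (fun n => (1 - v * (1 - ((μ (Ico l r)).toReal + B n - m * (r - l)) /
        ((M - m) * (r - l)))) ^ (1 - p)) atTop
        (𝓝 ((1 - v * ((M - x₃) / (M - m))) ^ (1 - p))) := by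
      have h1 := (((((limB.const_add (μ (Ico l r)).toReal).sub_const (m * (r - l))).div_const
        ((M - m) * (r - l))).const_sub 1).const_mul v).const_sub 1
      rw [totR, hN] at h1
      exact h1.rpow_const (Or.inl hpos.ne')
    have lhs := (limS.div_const ((M - m) * (r - l))).const_mul ((p - 1) * v)
    have rhs := ((limY.div_const (r - l)).const_mul ((1 - v) ^ (1 - p))).sub
      (limN.const_mul (x₁ ^ p))
    have := le_of_tendsto_of_tendsto' lhs rhs (fin v hv)
    rw [mul_div_cancel_right₀ _ hd.ne'] at this
    refine le_trans (le_of_eq ?_) this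
    congr 1
    field_simp
    ring

end Key

/-! ### Sharp bounds at the root, and attained or approximated values -/

section Bounds

variable {p m M l r x₁ x₂ x₃ w v F : ℝ}

/-- After `x₁ ^ p` is eliminated by the root equation, this reduces to the polynomial identity `(1 -
v) (1 - p w v) - (1 - p v) (1 - w v) = (p - 1) v (1 - w)`. -/
lemma root_identity (hp : 1 < p) (hw0 : 0 ≤ w) (hw1 : w ≤ 1) (hv : p * v < 1) (hx2 : 0 < x₂)
    (hroot : scaledRatio p w v = x₁ ^ p / x₂) :
    (1 - v) ^ (1 - p) * x₂ - x₁ ^ p * (1 - v * w) ^ (1 - p) =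
      (p - 1) * v * ((1 - w) * x₂ / ((1 - v) ^ p * (1 - p * w * v))) := by
  obtain ⟨hD, hA, hE, hG⟩ := one_sub_pos_of_mul_lt_one hp hw0 hw1 hv
  have hx : x₁ ^ p = ((1 - w * v) / (1 - v)) ^ p * ((1 - p * v) / (1 - p * w * v)) * x₂ := by
    rw [← scaledRatio, hroot]; field_simp
  rw [hx, mul_comm v w, Real.div_rpow hE.le hD.le, Real.rpow_sub hD, Real.rpow_sub hE,
    Real.rpow_one, Real.rpow_one]
  have hDp := Real.rpow_pos_of_pos hD p
  have hEp := Real.rpow_pos_of_pos hE p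
  have key : (1 - v) * (1 - p * w * v) - (1 - p * v) * (1 - w * v) = (p - 1) * v * (1 - w) := by
    ring
  generalize (1 - v) ^ p = Dp at *
  generalize (1 - w * v) ^ p = Ep at *
  generalize 1 - p * w * v = G at *
  generalize 1 - p * v = A at *
  generalize 1 - v = D at *
  generalize 1 - w * v = E at *
  field_simp
  linear_combination key

/-- At `v = 0` both sides of the bound vanish because `x₁ ^ p = x₂`, so their difference has a local
minimum there. Its derivative is zero, and this is the asserted value of `Y`. -/
lemma eq_of_forall_bound (hx : x₁ ^ p = x₂) (hp : 1 < p) {Y : ℝ}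
    (h : ∀ v < 1, (p - 1) * v * Y ≤ (1 - v) ^ (1 - p) * x₂ - x₁ ^ p * (1 - v * w) ^ (1 - p)) :
    Y = (1 - w) * x₂ := by
  have d : ∀ c : ℝ, HasDerivAt (fun v : ℝ => (1 - v * c) ^ (1 - p)) ((p - 1) * c) 0 := by
    intro c
    have h1 := (((hasDerivAt_id' (0 : ℝ)).mul_const c).const_sub 1).rpow_const (p := 1 - p)
      (Or.inl (by simp))
    convert h1 using 1
    simp
    ring
  have hd := ((((d 1).mul_const x₂).sub ((d w).const_mul (x₁ ^ p))).sub
    (((hasDerivAt_id' (0 : ℝ)).const_mul (p - 1)).mul_const Y))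
  have hmin : IsLocalMin (fun v : ℝ => (1 - v * 1) ^ (1 - p) * x₂ - x₁ ^ p * (1 - v * w) ^ (1 - p) -
      (p - 1) * v * Y) 0 := by
    filter_upwards [Iio_mem_nhds (zero_lt_one' ℝ)] with v hv
    have := h v hv
    simp only [mul_one, zero_mul, mul_zero, sub_zero, Real.one_rpow]
    linarith
  have := hmin.hasDerivAt_eq_zero hd
  rw [hx] at this
  have hp1 : p - 1 ≠ 0 := by linarith
  apply mul_left_cancel₀ hp1
  linear_combination -this

/-- The value which the Bellman functions take at the points with the parameter `v`. -/
noncomputable def paramValue (p m M x₂ x₃ v : ℝ) : ℝ :=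
  (x₃ - m) * x₂ / ((1 - v) ^ p * (1 - p * ((M - x₃) / (M - m)) * v)) + m * x₂

lemma paramValue_eq (hmM : m < M) :
    paramValue p m M x₂ x₃ v = m * x₂ + (M - m) * ((1 - (M - x₃) / (M - m)) * x₂ /
        ((1 - v) ^ p * (1 - p * ((M - x₃) / (M - m)) * v))) := by
  have hW : M - m ≠ 0 := by linarith
  rw [paramValue, ← mul_div_assoc (M - m), ← mul_assoc (M - m),
    show (M - m) * (1 - (M - x₃) / (M - m)) = x₃ - m by field_simp; ring, add_comm]

/-- The factor `v` is kept so that the statement serves both Bellman functions: division by it gives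
an upper or a lower bound according to its sign. -/
lemma mul_le_paramValue (hp : 1 < p) (hmM : m < M) (hx2 : 0 < x₂)
    (hm3 : m ≤ x₃) (h3M : x₃ ≤ M)
    (hv : p * v < 1) (hroot : scaledRatio p ((M - x₃) / (M - m)) v = x₁ ^ p / x₂)
    (hF : ∀ v < 1, (p - 1) * v * ((F - m * x₂) / (M - m)) ≤
      (1 - v) ^ (1 - p) * x₂ - x₁ ^ p * (1 - v * ((M - x₃) / (M - m))) ^ (1 - p)) :
    v * F ≤ v * paramValue p m M x₂ x₃ v := by
  have hW : 0 < M - m := by linarith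
  have hw0 : 0 ≤ (M - x₃) / (M - m) := div_nonneg (by linarith) hW.le
  have hw1 : (M - x₃) / (M - m) ≤ 1 := (div_le_one hW).2 (by linarith)
  have h := hF v (by linarith [(one_sub_pos_of_mul_lt_one hp hw0 hw1 hv).1])
  rw [root_identity hp hw0 hw1 hv hx2 hroot, mul_assoc, mul_assoc,
    mul_le_mul_iff_right₀ (by linarith), ← mul_div_assoc, div_le_iff₀ hW] at h
  rw [paramValue_eq hmM]
  linarith

lemma eq_paramValue_of_eq_zero (hp : 1 < p) (hmM : m < M) (hx2 : 0 < x₂)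
    (hv : p * v < 1) (hroot : scaledRatio p ((M - x₃) / (M - m)) v = x₁ ^ p / x₂)
    (hF : ∀ v < 1, (p - 1) * v * ((F - m * x₂) / (M - m)) ≤
      (1 - v) ^ (1 - p) * x₂ - x₁ ^ p * (1 - v * ((M - x₃) / (M - m))) ^ (1 - p))
    (h0 : v = 0) : F = paramValue p m M x₂ x₃ v := by
  have hW : 0 < M - m := by linarith
  subst h0
  rw [scaledRatio_zero, eq_comm, div_eq_one_iff_eq hx2.ne'] at hroot
  have := eq_of_forall_bound hroot hp hF
  rw [paramValue_eq hmM, mul_zero, sub_zero, Real.one_rpow, mul_one, div_one, ← this]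
  field_simp
  ring

lemma le_paramValue (hp : 1 < p) (hmM : m < M) (hx2 : 0 < x₂)
    (hm3 : m ≤ x₃) (h3M : x₃ ≤ M)
    (hv : p * v < 1) (hroot : scaledRatio p ((M - x₃) / (M - m)) v = x₁ ^ p / x₂)
    (hF : ∀ v < 1, (p - 1) * v * ((F - m * x₂) / (M - m)) ≤
      (1 - v) ^ (1 - p) * x₂ - x₁ ^ p * (1 - v * ((M - x₃) / (M - m))) ^ (1 - p))
    (h0 : 0 ≤ v) : F ≤ paramValue p m M x₂ x₃ v := by
  rcases h0.eq_or_lt with h | h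
  · exact (eq_paramValue_of_eq_zero hp hmM hx2 hv hroot hF h.symm).le
  · exact le_of_mul_le_mul_left (mul_le_paramValue hp hmM hx2 hm3 h3M hv hroot hF) h

lemma paramValue_le (hp : 1 < p) (hmM : m < M) (hx2 : 0 < x₂)
    (hm3 : m ≤ x₃) (h3M : x₃ ≤ M)
    (hv : p * v < 1) (hroot : scaledRatio p ((M - x₃) / (M - m)) v = x₁ ^ p / x₂)
    (hF : ∀ v < 1, (p - 1) * v * ((F - m * x₂) / (M - m)) ≤
      (1 - v) ^ (1 - p) * x₂ - x₁ ^ p * (1 - v * ((M - x₃) / (M - m))) ^ (1 - p))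
    (h0 : v ≤ 0) : paramValue p m M x₂ x₃ v ≤ F := by
  rcases h0.eq_or_lt with h | h
  · exact (eq_paramValue_of_eq_zero hp hmM hx2 hv hroot hF h).ge
  · have := mul_le_paramValue hp hmM hx2 hm3 h3M hv hroot hF
    exact (mul_le_mul_left_of_neg h).1 this

lemma paramValue_mem_closure (hp : 1 < p) (hm : 0 ≤ m) (hmM : m < M) (hlr : l < r) (hx1 : 0 < x₁)
    (hx2 : x₁ ^ p ≤ x₂) (hm3 : m < x₃) (h3M : x₃ ≤ M) (hv : p * v < 1)
    (hroot : scaledRatio p ((M - x₃) / (M - m)) v = x₁ ^ p / x₂) :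
    ENNReal.ofReal (paramValue p m M x₂ x₃ v) ∈ closure (bellmanValues p m M l r x₁ x₂ x₃) := by
  have hW : 0 < M - m := by linarith
  have hw0 : 0 ≤ (M - x₃) / (M - m) := div_nonneg (by linarith) hW.le
  have hw1 : (M - x₃) / (M - m) < 1 := (div_lt_one hW).2 (by linarith)
  have hX : 0 ≤ x₂ := (Real.rpow_nonneg hx1.le p).trans hx2
  have hc : Continuous fun f => ENNReal.ofReal (m * x₂ + (M - m) * f) :=
    ENNReal.continuous_ofReal.comp (by fun_prop)
  rw [paramValue_eq hmM]
  refine map_mem_closure (f := fun f => ENNReal.ofReal (m * x₂ + (M - m) * f)) hc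
    (mem_closure_attained_of_root hp hx1 hx2 hw0 hw1 hv hroot)
    fun f hf => ?_
  have := mem_bellmanValues_of_attained hm hmM hlr hX (by linarith) hf
  rwa [show m + (M - m) * (1 - (M - x₃) / (M - m)) = x₃ by field_simp; ring] at this

/-- A test function that vanishes where the measure exceeds its lower bound. -/
lemma ofReal_mul_mem_bellmanValues (hp : 1 < p) (hm : 0 ≤ m) (hmM : m < M) (hlr : l < r)
    (hx1 : 0 < x₁) (hx2 : x₁ ^ p ≤ x₂) (hm3 : m ≤ x₃) (h3M : x₃ ≤ M)
    (hlow : x₁ ^ p / x₂ ≤ ((M - x₃) / (M - m)) ^ (p - 1)) :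
    ENNReal.ofReal (m * x₂) ∈ bellmanValues p m M l r x₁ x₂ x₃ := by
  have hW : 0 < M - m := by linarith
  have hd : 0 < r - l := sub_pos.2 hlr
  have hw0 : 0 ≤ (M - x₃) / (M - m) := div_nonneg (by linarith) hW.le
  have hw1 : (M - x₃) / (M - m) ≤ 1 := (div_le_one hW).2 (by linarith)
  obtain ⟨φ, θ, hφ, hθ, -, hθp, hz, i1, j1⟩ := exists_testFunction hp hx1 hx2 hlr
  -- The support of the test function fits into the portion `w` of the interval on which the measure
  -- will have density `m`; the density is `M` on the remaining portion `1 - w`, which makes the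
  -- total `x₃`.
  have hθw : θ ≤ (M - x₃) / (M - m) := by
    rw [← hθp] at hlow
    exact (Real.rpow_le_rpow_iff hθ.le hw0 (by linarith)).1 hlow
  set w := (M - x₃) / (M - m) with hw
  have hwW : (M - m) * w = M - x₃ := by rw [hw]; field_simp
  have hsub : Ico (l + w * (r - l)) r ⊆ Ico l r := Ico_subset_Ico_left (by nlinarith)
  have mass : ∀ μ : Measure ℝ, ∀ J, carlesonMass l r μ (fun _ => 0) J = μ (dyadicInterval l r J) :=
    fun μ J => by simp [carlesonMass]
  refine ⟨φ, ENNReal.ofReal m • volume +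
    ENNReal.ofReal (M - m) • volume.restrict (Ico (l + w * (r - l)) r), fun _ => 0,
    ⟨hφ, ?_, ?_, ?_, ?_, ?_, ?_⟩, ?_⟩
  · intro t; simp
  · rw [setLAverage_eq, i1, Real.volume_Ico, ← ENNReal.ofReal_div_of_pos hd,
      mul_div_cancel_right₀ _ hd.ne']
  · rw [setLAverage_eq, j1, Real.volume_Ico, ← ENNReal.ofReal_div_of_pos hd,
      mul_div_cancel_right₀ _ hd.ne']
  · rw [Measure.add_apply, Measure.smul_apply, Measure.smul_apply,
      Measure.restrict_apply measurableSet_Ico, inter_eq_right.2 hsub, Real.volume_Ico,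
      Real.volume_Ico, smul_eq_mul, smul_eq_mul, ← ENNReal.ofReal_mul hm,
      ← ENNReal.ofReal_mul hW.le, ← ENNReal.ofReal_add (by positivity)
        (mul_nonneg hW.le (by nlinarith))]
    simp only [ENNReal.coe_zero, tsum_zero, add_zero]
    rw [← ENNReal.ofReal_div_of_pos hd]
    congr 1
    rw [div_eq_iff hd.ne']
    linear_combination -(r - l) * hwW
  · intro J
    rw [mass, Measure.add_apply, Measure.smul_apply, smul_eq_mul]
    exact le_self_add
  · intro J
    rw [mass, Measure.add_apply, Measure.smul_apply, Measure.smul_apply, smul_eq_mul, smul_eq_mul]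
    calc _ ≤ ENNReal.ofReal m * volume (dyadicInterval l r J) +
        ENNReal.ofReal (M - m) * volume (dyadicInterval l r J) := by
          gcongr
          exact Measure.restrict_le_self
      _ = _ := by
          rw [← add_mul, ← ENNReal.ofReal_add hm hW.le]; congr 2; ring
  · have hzero : ∫⁻ t in Ico (l + w * (r - l)) r, (φ t : ℝ≥0∞) ^ p = 0 := by
      rw [setLIntegral_congr_fun (g := fun _ => 0) measurableSet_Ico, lintegral_zero]
      intro t ht
      have : φ t = 0 := hz t (by have := ht.1; nlinarith)
      simp [this, show 0 < p by linarith]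
    rw [carlesonFunctional, Measure.restrict_add, Measure.restrict_smul, Measure.restrict_smul,
      Measure.restrict_restrict measurableSet_Ico, inter_eq_right.2 hsub, lintegral_add_measure,
      lintegral_smul_measure, lintegral_smul_measure, j1, hzero]
    simp only [ENNReal.coe_zero, mul_zero, tsum_zero, add_zero, smul_eq_mul]
    rw [Real.volume_Ico, ← ENNReal.ofReal_mul hm, ← ENNReal.ofReal_div_of_pos hd]
    congr 1
    field_simp

lemma zero_mem_bellmanValues (hp : 1 < p) (hlr : l < r) (hm3 : m ≤ x₃) (h3M : x₃ ≤ M) :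
    0 ∈ bellmanValues p m M l r 0 0 x₃ := by
  have hd : 0 < r - l := sub_pos.2 hlr
  have hp0 : 0 < p := by linarith
  have mass : ∀ μ : Measure ℝ, ∀ J, carlesonMass l r μ (fun _ => 0) J = μ (dyadicInterval l r J) :=
    fun μ J => by simp [carlesonMass]
  refine ⟨fun _ => 0, ENNReal.ofReal x₃ • volume, fun _ => 0,
    ⟨measurable_const, ?_, ?_, ?_, ?_, ?_, ?_⟩, ?_⟩
  · intro t; simp
  · simp
  · simp [hp0]
  · simp only [Measure.smul_apply, smul_eq_mul, ENNReal.coe_zero, tsum_zero, add_zero]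
    rw [ENNReal.mul_div_cancel_right] <;> simp [hlr]
  · intro J
    rw [mass, Measure.smul_apply, smul_eq_mul]
    gcongr
  · intro J
    rw [mass, Measure.smul_apply, smul_eq_mul]
    gcongr
  · simp [carlesonFunctional, hp0]

end Bounds

/-! ### Assembly of the theorem -/

theorem mainTheorem4 (p q m M l r : ℝ) (hp : 1 < p) (hq : q = p / (p - 1))
    (hm : 0 ≤ m) (hmM : m < M) (hlr : l < r) :
    (∀ x₁ x₂ x₃ : ℝ, 0 < x₁ → x₁ ^ p ≤ x₂ → m ≤ x₃ → x₃ ≤ M →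
      -- the upper Bellman function
      (m < x₃ →
        (∃! a, IsUpperRoot p q m M x₁ x₂ x₃ a) ∧
        ∀ a, IsUpperRoot p q m M x₁ x₂ x₃ a →
          upperBellman p m M l r x₁ x₂ x₃ = ENNReal.ofReal (bellmanFormula p q m M x₂ x₃ a)) ∧
      (x₃ = m → upperBellman p m M l r x₁ x₂ x₃ = ENNReal.ofReal (m * x₂)) ∧
      -- the two descriptions of the domain of the lower formula agree
      (M - (M - m) * (x₁ ^ q / x₂ ^ (q - 1)) < x₃ ↔
        (M - x₃) ^ (p - 1) * x₂ < (M - m) ^ (p - 1) * x₁ ^ p) ∧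
      -- the lower Bellman function
      (M - (M - m) * (x₁ ^ q / x₂ ^ (q - 1)) < x₃ →
        (∃! a, IsLowerRoot p q m M x₁ x₂ x₃ a) ∧
        ∀ a, IsLowerRoot p q m M x₁ x₂ x₃ a →
          lowerBellman p m M l r x₁ x₂ x₃ = ENNReal.ofReal (bellmanFormula p q m M x₂ x₃ a)) ∧
      (x₃ ≤ M - (M - m) * (x₁ ^ q / x₂ ^ (q - 1)) →
        lowerBellman p m M l r x₁ x₂ x₃ = ENNReal.ofReal (m * x₂))) ∧
    -- the degenerate points, where the test function vanishes almost everywhere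
    (∀ x₃ : ℝ, m ≤ x₃ → x₃ ≤ M →
      upperBellman p m M l r 0 0 x₃ = 0 ∧ lowerBellman p m M l r 0 0 x₃ = 0) := by
  have hW : 0 < M - m := by linarith
  refine ⟨fun x₁ x₂ x₃ hx1 hx2 hm3 h3M => ?_, fun x₃ hm3 h3M => ?_⟩
  · have hx1p : 0 < x₁ ^ p := Real.rpow_pos_of_pos hx1 p
    have hX : 0 < x₂ := by linarith
    have hdom := lower_domain_iff hp hq hmM hx1 hx2 h3M
    refine ⟨fun hlt => ?_, fun heq => ?_, hdom.1, fun hlow => ?_, fun hlow => ?_⟩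
    · obtain ⟨huniq, hval⟩ := upperRoot_spec hp hq hmM hx1 hx2 hlt h3M
      refine ⟨huniq, fun a ha => ?_⟩
      obtain ⟨v, ⟨hv0, hv1⟩, hroot, hB⟩ := hval a ha
      have hv : p * v < 1 := by rwa [lt_div_iff₀' (by linarith)] at hv1
      rw [hB, ← paramValue]
      have hub : ∀ y ∈ bellmanValues p m M l r x₁ x₂ x₃,
          y ≤ ENNReal.ofReal (paramValue p m M x₂ x₃ v) := by
        rintro _ ⟨φ, μ, α, h, rfl⟩
        obtain ⟨F, hF, -, -, hb⟩ := h.exists_value hp hm hmM hlr hx1.le hX.le hm3 h3M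
        rw [hF]
        exact ENNReal.ofReal_le_ofReal (le_paramValue hp hmM hX hm3 h3M hv hroot hb hv0)
      refine le_antisymm (sSup_le hub) ?_
      -- The value is known only as a limit of attained values, which suffices because the set of
      -- numbers at most the supremum is closed.
      exact closure_minimal (fun y hy => le_sSup hy) isClosed_Iic
        (paramValue_mem_closure hp hm hmM hlr hx1 hx2 hlt h3M hv hroot)
    · refine le_antisymm (sSup_le ?_) (le_sSup ?_)
      · rintro _ ⟨φ, μ, α, h, rfl⟩
        obtain ⟨F, hF, -, he, -⟩ := h.exists_value hp hm hmM hlr hx1.le hX.le hm3 h3M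
        rw [hF, he heq]
      · have := mem_bellmanValues_of_attained hm hmM hlr hX.le le_rfl
          (attained_root hp hx1 hx2 le_rfl zero_le_one)
        simpa [heq] using this
    · have hlow' := hdom.2.1 hlow
      -- At `x₃ = m` the ratio `w` is `1`, and the condition would say `x₂ < x₁ ^ p`.
      have hlt : m < x₃ := by
        refine lt_of_le_of_ne hm3 fun h => ?_
        rw [← h, div_self hW.ne', Real.one_rpow, lt_div_iff₀ hX] at hlow'
        linarith
      obtain ⟨huniq, hval⟩ := lowerRoot_spec hp hq hmM hx1 hx2 hlt h3M hlow'
      refine ⟨huniq, fun a ha => ?_⟩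
      obtain ⟨v, hv0, hroot, hB⟩ := hval a ha
      have hv : p * v < 1 := by nlinarith
      rw [hB, ← paramValue]
      refine le_antisymm ?_ (le_sInf ?_)
      · exact closure_minimal (fun y hy => sInf_le hy) isClosed_Ici
          (paramValue_mem_closure hp hm hmM hlr hx1 hx2 hlt h3M hv hroot)
      · rintro _ ⟨φ, μ, α, h, rfl⟩
        obtain ⟨F, hF, -, -, hb⟩ := h.exists_value hp hm hmM hlr hx1.le hX.le hm3 h3M
        rw [hF]
        exact ENNReal.ofReal_le_ofReal (paramValue_le hp hmM hX hm3 h3M hv hroot hb hv0)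
    · have hlow' := not_lt.1 (hdom.2.not.1 (not_lt.2 hlow))
      refine le_antisymm
        (sInf_le (ofReal_mul_mem_bellmanValues hp hm hmM hlr hx1 hx2 hm3 h3M hlow')) (le_sInf ?_)
      rintro _ ⟨φ, μ, α, h, rfl⟩
      obtain ⟨F, hF, hle, -, -⟩ := h.exists_value hp hm hmM hlr hx1.le hX.le hm3 h3M
      rw [hF]
      exact ENNReal.ofReal_le_ofReal hle
  · have h0 := zero_mem_bellmanValues hp hlr hm3 h3M
    refine ⟨le_antisymm (sSup_le ?_) zero_le, le_antisymm (sInf_le h0) zero_le⟩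
    rintro _ ⟨φ, μ, α, h, rfl⟩
    obtain ⟨F, hF, -, -, hb⟩ := h.exists_value hp hm hmM hlr le_rfl le_rfl hm3 h3M
    -- With `x₁ = x₂ = 0` the right-hand side of the bound is zero, so any `v` in `(0, 1)` forces `F
    -- ≤ 0`.
    have hb' := hb (1 / 2) (by norm_num)
    rw [Real.zero_rpow (by linarith), mul_zero, mul_zero, zero_mul, sub_zero, sub_zero] at hb'
    have hF0 : F ≤ 0 := by
      by_contra! hpos
      have : 0 < (p - 1) * (1 / 2) * (F / (M - m)) :=
        mul_pos (mul_pos (by linarith) (by norm_num)) (div_pos hpos hW)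
      linarith
    rw [hF, ENNReal.ofReal_of_nonpos hF0]
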